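/- **Setting.** Let $f:[0,\infty)\times\mathbb R^n\to\mathbb R^n$, $\sigma:[0,\infty)\times\mathbb R^n\to\mathbb R^{n\times m}$ and $a_t=\sigma_t\sigma_t'$, the coefficients of $dX_t=f_t(X_t)\,dt+\sigma_t(X_t)\,dW_t$. Assume $f\in C^{1,0}$ and $a\in C^{2,0}$ (continuous in $(t,x)$ together with the $x$-derivatives up to order 1, resp. 2), and $2x'f_t(x)+\|a_t(x)\|\le K(1+|x|^2)$ for some $K>0$, all $t\ge0$ and all $x$, where $\|a\|=\operatorname{tr}a$ is the trace norm. Put $\mathcal L_t^*g=-\sum_i\partial_i(f_{t,i}\,g)+\frac12\sum_{i,j}\partial_i\partial_j(a_{t,ij}\,g)$. Let $(p_t)_{t\ge0}$ be probability densities on $\mathbb R^n$, positive almost everywhere, of regularity $C^{2,1}$ in $(x,t)$ on $[0,\infty)\times\mathbb R^n$, that solve the Fokker–Planck equation $\partial_tp_t=\mathcal L_t^*p_t$ (for instance the densities of the laws of $X_t$). Put $\alpha_t=\mathcal L_t^*p_t/p_t$. Derivatives and limits in $t$ are taken within $[0,\infty)$. For an a.e. positive probability density $p$ let $L^\Phi(p)$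 be the Orlicz space of the Young function $\Phi(x)=\cosh x-1$, $B_p=\{U\in L^\Phi(p):E_p[U]=0\}$, $K_p(u)=\log E_p[e^u]$, and $S_p$ the interior in $B_p$ of $\{u : E_p[e^u]<\infty\}$. Let $\mathcal E=\{e^{u-K_r(u)}\,r:u\in S_r\}$ be a maximal exponential family, a manifold with the global charts $s_q(p)=\log\frac pq-E_q[\log\frac pq]\in B_q$, $q\in\mathcal E$. The spaces $L^\Phi(q)$, $q\in\mathcal E$, coincide with equivalent norms, and are denoted by $L^\Phi$. A submanifold of $\mathcal E$ is a set $\mathcal N\subset\mathcal E$ such that for each $q\in\mathcal N$ there are closed complementary subspaces $V^1,V^2$ of $B_q$ and a $C^2$ diffeomorphism of a neighbourhood of $0=s_q(q)$ in $S_q$ onto a product of open sets of $V^1$ and $V^2$ that maps $s_q(\mathcal N)$, within that neighbourhood, onto the part of the product in $V^1\times\{0\}$; it is finite dimensional if the spaces $V^1$ can be chosen so. A vector $V\in B_q$ is tangent to $\mathcal N$ at $q$ if it is the velocity at $q$, in the chart $s_q$, of a curve in $\mathcal N$ through $q$. **Proposition.** (i) If $t\mapsto p_t$ is differentiable at $t\ge0$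 as a map into $\mathcal E$ (that is, $p_s\in\mathcal E$ for $s$ near $t$ and $s\mapsto s_q(p_s)$ is differentiable at $t$ for every $q\in\mathcal E$), then $\alpha_t$ is a tangent vector: $\alpha_t\in B_{p_t}$, and $\alpha_t$ is the derivative at $s=t$ of $s\mapsto s_{p_t}(p_s)\in B_{p_t}$. (ii) If $p_{t_0}\in\mathcal E$ and $t\mapsto\alpha_t$ is continuous at $t_0\ge0$ into $L^\Phi$ (in particular $\alpha_t\in L^\Phi$ for $t$ near $t_0$), then $t\mapsto p_t$ is differentiable at $t_0$ as a map into $\mathcal E$. (iii) Let $\mathcal N$ be a submanifold of $\mathcal E$ with $p_0\in\mathcal N$. Suppose that $t\mapsto\alpha_t$ is continuous into $L^\Phi$ at every $t\ge0$ with $p_t\in\mathcal E$, and that for all $t\ge0$ and all $q\in\mathcal N$ the density $q$ has a $C^2$ version and $\mathcal L_t^*q/q$ belongs to $B_q$ and is tangent to $\mathcal N$ at $q$. Suppose also that $\mathcal N$ is finite dimensional, or, more generally, that the time dependent vector field $q\mapsto\mathcal L_t^*q/q$ on $\mathcal N$, read in the charts of $\mathcal E$, is continuous in $t$ and locally Lipschitz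 in $q$, locally uniformly in $t$. Then $p_t$ evolves in $\mathcal N$ up to its first exit time: there is $\tau\in(0,\infty]$ such that $p_t\in\mathcal N$ for all $t\in[0,\tau)$ and, if $\tau<\infty$, then $p_\tau\notin\mathcal N$. If moreover $\mathcal N$ is closed in $\mathcal E$ and $\tau<\infty$, then $p_\tau\notin\mathcal E$; so in that case $p_t$ stays in $\mathcal N$ as long as it stays in $\mathcal E$. -/

import Mathlib

open MeasureTheory Set Filter Topology
open scoped ENNReal NNReal

noncomputable section

/-! ### Densities and the exponential Orlicz spaces -/

section Densities

variable {Ω : Type*} [MeasurableSpace Ω] {μ : Measure Ω}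

/-- The (almost everywhere classes of) strictly positive probability densities with respect to
the reference measure `μ`. -/
structure PosDensity {Ω : Type*} [MeasurableSpace Ω] (μ : Measure Ω) where
  toFun : Ω →ₘ[μ] ℝ
  pos : ∀ᵐ x ∂μ, 0 < toFun x
  integrable : Integrable toFun μ
  integral_eq_one : ∫ x, toFun x ∂μ = 1

/-- The probability measure `p · μ`. -/
def PosDensity.prob (p : PosDensity μ) : Measure Ω :=
  μ.withDensity (fun x => ENNReal.ofReal (p.toFun x))

/-- The expectation `E_p[U]`. -/
def PosDensity.expect (p : PosDensity μ) (U : Ω → ℝ) : ℝ := ∫ x, U x ∂p.prob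

/-- The modular `E_p[Φ(U)]` of the Young function `Φ(x) = cosh x - 1`. -/
def PosDensity.modular (p : PosDensity μ) (U : Ω → ℝ) : ℝ≥0∞ :=
  ∫⁻ x, ENNReal.ofReal (Real.cosh (U x) - 1) ∂p.prob

theorem PosDensity.isProbabilityMeasure (p : PosDensity μ) : IsProbabilityMeasure p.prob := by
  constructor
  rw [PosDensity.prob, withDensity_apply _ MeasurableSet.univ, Measure.restrict_univ,
    ← ofReal_integral_eq_lintegral_ofReal p.integrable (p.pos.mono fun x hx => hx.le),
    p.integral_eq_one, ENNReal.ofReal_one]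

theorem PosDensity.prob_absolutelyContinuous (p : PosDensity μ) : p.prob ≪ μ :=
  withDensity_absolutelyContinuous _ _

theorem PosDensity.absolutelyContinuous_prob (p : PosDensity μ) : μ ≪ p.prob := by
  refine withDensity_absolutelyContinuous' p.integrable.aestronglyMeasurable.aemeasurable.ennreal_ofReal ?_
  filter_upwards [p.pos] with x hx
  simpa using hx

theorem PosDensity.modular_congr (p : PosDensity μ) {U V : Ω → ℝ} (h : U =ᵐ[μ] V) :
    p.modular U = p.modular V := by
  refine lintegral_congr_ae ?_
  filter_upwards [p.prob_absolutelyContinuous.ae_le h] with x hx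
  rw [hx]

theorem cosh_convex_aux {a b x y : ℝ} (ha : 0 ≤ a) (hb : 0 ≤ b) (hab : a + b = 1) :
    Real.cosh (a * x + b * y) - 1 ≤ a * (Real.cosh x - 1) + b * (Real.cosh y - 1) := by
  have h1 := convexOn_exp.2 (mem_univ x) (mem_univ y) ha hb hab
  have h2 := convexOn_exp.2 (mem_univ (-x)) (mem_univ (-y)) ha hb hab
  simp only [smul_eq_mul] at h1 h2
  have h3 : a * -x + b * -y = -(a * x + b * y) := by ring
  rw [h3] at h2
  rw [Real.cosh_eq, Real.cosh_eq, Real.cosh_eq]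
  linarith

theorem PosDensity.modular_convex (p : PosDensity μ) {U V : Ω → ℝ}
    (hU : AEMeasurable U μ) {a b : ℝ} (ha : 0 ≤ a) (hb : 0 ≤ b) (hab : a + b = 1) :
    p.modular (fun x => a * U x + b * V x) ≤
      ENNReal.ofReal a * p.modular U + ENNReal.ofReal b * p.modular V := by
  have hU' : AEMeasurable U p.prob := hU.mono_ac p.prob_absolutelyContinuous
  unfold PosDensity.modular
  rw [← lintegral_const_mul' _ _ ENNReal.ofReal_ne_top,
    ← lintegral_const_mul' _ _ ENNReal.ofReal_ne_top, ← lintegral_add_left']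
  · refine lintegral_mono fun x => ?_
    have h1 : 0 ≤ Real.cosh (U x) - 1 := by linarith [Real.one_le_cosh (U x)]
    have h2 : 0 ≤ Real.cosh (V x) - 1 := by linarith [Real.one_le_cosh (V x)]
    rw [← ENNReal.ofReal_mul ha, ← ENNReal.ofReal_mul hb, ← ENNReal.ofReal_add (by positivity)
      (by positivity)]
    exact ENNReal.ofReal_le_ofReal (cosh_convex_aux ha hb hab)
  · exact ((Real.measurable_cosh.comp_aemeasurable hU').sub_const 1).ennreal_ofReal.const_mul _

theorem PosDensity.modular_zero (p : PosDensity μ) : p.modular (fun _ => 0) = 0 := by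
  simp [PosDensity.modular]

theorem PosDensity.modular_smul_le (p : PosDensity μ) {U : Ω → ℝ} (hU : AEMeasurable U μ)
    {a : ℝ} (ha : 0 ≤ a) (ha1 : a ≤ 1) :
    p.modular (fun x => a * U x) ≤ ENNReal.ofReal a * p.modular U := by
  have h := p.modular_convex (V := fun _ => 0) hU ha (sub_nonneg.2 ha1) (by ring)
  simpa [p.modular_zero] using h

/-- The Orlicz space `L^Φ(p)`: the random variables `U` with `E_p[Φ(r U)] < ∞` for some `r > 0`.
For all `p` these are subspaces of the same space of random variables. -/
def LPhi (p : PosDensity μ) : Submodule ℝ (Ω →ₘ[μ] ℝ) where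
  carrier := {U | ∃ r : ℝ, 0 < r ∧ p.modular (fun x => r * U x) < ∞}
  zero_mem' := by
    refine ⟨1, one_pos, ?_⟩
    have : p.modular (fun x => 1 * (0 : Ω →ₘ[μ] ℝ) x) = p.modular (fun _ => 0) := by
      refine p.modular_congr ?_
      filter_upwards [AEEqFun.coeFn_zero (α := Ω) (μ := μ) (β := ℝ)] with x hx
      simp [hx]
    rw [this, p.modular_zero]
    exact ENNReal.zero_lt_top
  add_mem' := by
    rintro U V ⟨r, hr, hU⟩ ⟨s, hs, hV⟩
    have hrs : 0 < r + s := add_pos hr hs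
    refine ⟨r * s / (r + s), by positivity, ?_⟩
    have h := p.modular_convex (U := fun x => r * U x) (V := fun x => s * V x)
      (U.aestronglyMeasurable.aemeasurable.const_mul r)
      (a := s / (r + s)) (b := r / (r + s)) (by positivity) (by positivity)
      (by field_simp; ring)
    refine lt_of_le_of_lt (le_of_eq_of_le (p.modular_congr ?_) h) ?_
    · filter_upwards [AEEqFun.coeFn_add U V] with x hx
      rw [hx, Pi.add_apply]
      field_simp
    · exact ENNReal.add_lt_top.2 ⟨ENNReal.mul_lt_top ENNReal.ofReal_lt_top hU,
        ENNReal.mul_lt_top ENNReal.ofReal_lt_top hV⟩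
  smul_mem' := by
    rintro c U ⟨r, hr, hU⟩
    have hc : 0 < |c| + 1 := by positivity
    refine ⟨r / (|c| + 1), by positivity, ?_⟩
    have h := p.modular_smul_le (U := fun x => r * U x)
      (U.aestronglyMeasurable.aemeasurable.const_mul r)
      (a := |c| / (|c| + 1)) (by positivity) (by rw [div_le_one hc]; linarith)
    refine lt_of_le_of_lt (le_of_eq_of_le ?_ h) (ENNReal.mul_lt_top ENNReal.ofReal_lt_top hU)
    refine lintegral_congr_ae ?_
    filter_upwards [p.prob_absolutelyContinuous.ae_le (AEEqFun.coeFn_smul c U)] with x hx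
    rw [hx, Pi.smul_apply, smul_eq_mul, ← Real.cosh_abs,
      ← Real.cosh_abs (|c| / (|c| + 1) * (r * U x))]
    congr 3
    simp only [abs_mul, abs_div, abs_abs, abs_of_pos hc]
    ring

/-- The Luxemburg norm of `L^Φ(p)`. -/
instance LPhi.instNorm (p : PosDensity μ) : Norm (LPhi p) where
  norm U := sInf {c : ℝ | 0 < c ∧ p.modular (fun x => c⁻¹ * (U : Ω →ₘ[μ] ℝ) x) ≤ 1}

/-- The closed unit ball of the modular. -/
def LPhi.unitSet (p : PosDensity μ) : Set (LPhi p) :=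
  {U | p.modular (fun x => (U : Ω →ₘ[μ] ℝ) x) ≤ 1}

theorem LPhi.modular_coe_smul (p : PosDensity μ) (c : ℝ) (U : LPhi p) :
    p.modular (fun x => ((c • U : LPhi p) : Ω →ₘ[μ] ℝ) x) =
      p.modular (fun x => c * (U : Ω →ₘ[μ] ℝ) x) := by
  refine p.modular_congr ?_
  filter_upwards [AEEqFun.coeFn_smul c (U : Ω →ₘ[μ] ℝ)] with x hx
  rw [Submodule.coe_smul, hx, Pi.smul_apply, smul_eq_mul]

theorem LPhi.norm_eq_gauge (p : PosDensity μ) (U : LPhi p) :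
    ‖U‖ = gauge (LPhi.unitSet p) U := by
  rw [gauge_def']
  change sInf _ = sInf _
  congr 1
  ext c
  simp only [mem_ofPred_eq, LPhi.unitSet, mem_Ioi, LPhi.modular_coe_smul]

theorem LPhi.convex_unitSet (p : PosDensity μ) : Convex ℝ (LPhi.unitSet p) := by
  intro U hU V hV a b ha hb hab
  have h := p.modular_convex (U := fun x => (U : Ω →ₘ[μ] ℝ) x) (V := fun x => (V : Ω →ₘ[μ] ℝ) x)
    (U : Ω →ₘ[μ] ℝ).aestronglyMeasurable.aemeasurable ha hb hab
  change p.modular _ ≤ 1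
  refine (le_of_eq_of_le (p.modular_congr ?_) h).trans ?_
  · filter_upwards [AEEqFun.coeFn_add (a • (U : Ω →ₘ[μ] ℝ)) (b • (V : Ω →ₘ[μ] ℝ)),
      AEEqFun.coeFn_smul a (U : Ω →ₘ[μ] ℝ), AEEqFun.coeFn_smul b (V : Ω →ₘ[μ] ℝ)] with x h1 h2 h3
    rw [Submodule.coe_add, Submodule.coe_smul, Submodule.coe_smul, h1, Pi.add_apply, h2, h3]
    simp
  · calc ENNReal.ofReal a * p.modular (fun x => (U : Ω →ₘ[μ] ℝ) x)
          + ENNReal.ofReal b * p.modular (fun x => (V : Ω →ₘ[μ] ℝ) x)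
        ≤ ENNReal.ofReal a * 1 + ENNReal.ofReal b * 1 := by gcongr <;> assumption
      _ = 1 := by rw [mul_one, mul_one, ← ENNReal.ofReal_add ha hb, hab, ENNReal.ofReal_one]

theorem LPhi.balanced_unitSet (p : PosDensity μ) : Balanced ℝ (LPhi.unitSet p) := by
  rintro c hc _ ⟨U, hU, rfl⟩
  change p.modular _ ≤ 1
  rw [LPhi.modular_coe_smul]
  have h := p.modular_smul_le (U := fun x => (U : Ω →ₘ[μ] ℝ) x)
    (U : Ω →ₘ[μ] ℝ).aestronglyMeasurable.aemeasurable (a := |c|) (abs_nonneg c) (by simpa using hc)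
  have h2 : p.modular (fun x => c * (U : Ω →ₘ[μ] ℝ) x) =
      p.modular (fun x => |c| * (U : Ω →ₘ[μ] ℝ) x) := by
    unfold PosDensity.modular
    congr 1
    ext x
    rw [← Real.cosh_abs, ← Real.cosh_abs (|c| * _), abs_mul, abs_mul, abs_abs]
  rw [h2]
  refine h.trans ?_
  calc ENNReal.ofReal |c| * p.modular (fun x => (U : Ω →ₘ[μ] ℝ) x) ≤ 1 * 1 := by
        gcongr
        · exact ENNReal.ofReal_le_one.2 (by simpa using hc)
        · exact hU
    _ = 1 := one_mul 1

theorem LPhi.exists_pos_smul_mem (p : PosDensity μ) (U : LPhi p) :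
    ∃ r : ℝ, 0 < r ∧ r • U ∈ LPhi.unitSet p := by
  obtain ⟨r, hr, hU⟩ := U.2
  set M := (p.modular (fun x => r * (U : Ω →ₘ[μ] ℝ) x)).toReal with hM
  have hM0 : 0 ≤ M := ENNReal.toReal_nonneg
  refine ⟨r / (M + 1), by positivity, ?_⟩
  change p.modular _ ≤ 1
  rw [LPhi.modular_coe_smul]
  have h := p.modular_smul_le (U := fun x => r * (U : Ω →ₘ[μ] ℝ) x)
    ((U : Ω →ₘ[μ] ℝ).aestronglyMeasurable.aemeasurable.const_mul r)
    (a := 1 / (M + 1)) (by positivity) (by rw [div_le_one (by positivity)]; linarith)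
  have he : (fun x => r / (M + 1) * (U : Ω →ₘ[μ] ℝ) x) =
      fun x => 1 / (M + 1) * (r * (U : Ω →ₘ[μ] ℝ) x) := by
    ext x; ring
  rw [he]
  refine h.trans ?_
  rw [← ENNReal.ofReal_toReal hU.ne, ← hM, ← ENNReal.ofReal_mul (by positivity)]
  refine ENNReal.ofReal_le_one.2 ?_
  rw [one_div_mul_eq_div, div_le_one (by positivity)]
  linarith

theorem LPhi.absorbent_unitSet (p : PosDensity μ) : Absorbent ℝ (LPhi.unitSet p) := by
  intro U
  obtain ⟨r, hr, hU⟩ := LPhi.exists_pos_smul_mem p U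
  refine Absorbs.of_norm ⟨r⁻¹, fun c hc => ?_⟩
  rw [singleton_subset_iff]
  have hc0 : 0 < |c| := lt_of_lt_of_le (by positivity) hc
  have hcne : c ≠ 0 := abs_pos.1 hc0
  rw [mem_smul_set_iff_inv_smul_mem₀ hcne]
  have : c⁻¹ • U = (c⁻¹ * r⁻¹) • (r • U) := by
    rw [smul_smul, mul_assoc, inv_mul_cancel₀ hr.ne', mul_one]
  rw [this]
  refine (LPhi.balanced_unitSet p).smul_mem ?_ hU
  rw [norm_mul, norm_inv, Real.norm_eq_abs, Real.norm_eq_abs, abs_of_pos (inv_pos.2 hr)]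
  rw [inv_mul_le_one₀ hc0]
  exact hc

theorem LPhi.eq_zero_of_norm_eq_zero (p : PosDensity μ) (U : LPhi p) (h : ‖U‖ = 0) : U = 0 := by
  rw [LPhi.norm_eq_gauge] at h
  have hmem : ∀ n : ℕ, p.modular (fun x => (n : ℝ) * (U : Ω →ₘ[μ] ℝ) x) ≤ 1 := by
    intro n
    have h1 : gauge (LPhi.unitSet p) ((n : ℝ) • U) < 1 := by
      rw [gauge_smul_of_nonneg (Nat.cast_nonneg n), h]; simp
    have h0 : (0 : LPhi p) ∈ LPhi.unitSet p :=
      (LPhi.absorbent_unitSet p).zero_mem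
    have h2 := setOfPred_gauge_lt_one_subset_self (LPhi.convex_unitSet p) h0 (LPhi.absorbent_unitSet p) h1
    change p.modular _ ≤ 1 at h2
    rwa [LPhi.modular_coe_smul] at h2
  have hmeas : AEMeasurable (fun x => (U : Ω →ₘ[μ] ℝ) x) p.prob :=
    (U : Ω →ₘ[μ] ℝ).aestronglyMeasurable.aemeasurable.mono_ac p.prob_absolutelyContinuous
  have hm0 : p.modular (fun x => (U : Ω →ₘ[μ] ℝ) x) = 0 := by
    by_contra hne
    have hn : ∀ n : ℕ, (n + 1 : ℕ) * p.modular (fun x => (U : Ω →ₘ[μ] ℝ) x) ≤ 1 := by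
      intro n
      have hpos : (0 : ℝ) < (n + 1 : ℕ) := by positivity
      have h3 := p.modular_smul_le (U := fun x => ((n + 1 : ℕ) : ℝ) * (U : Ω →ₘ[μ] ℝ) x)
        ((U : Ω →ₘ[μ] ℝ).aestronglyMeasurable.aemeasurable.const_mul _)
        (a := (((n + 1 : ℕ) : ℝ))⁻¹) (by positivity)
        (inv_le_one_of_one_le₀ (by exact_mod_cast Nat.succ_le_succ (Nat.zero_le n)))
      have he : (fun x => (((n + 1 : ℕ) : ℝ))⁻¹ * (((n + 1 : ℕ) : ℝ) * (U : Ω →ₘ[μ] ℝ) x)) =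
          fun x => (U : Ω →ₘ[μ] ℝ) x := by
        ext x; rw [← mul_assoc, inv_mul_cancel₀ hpos.ne', one_mul]
      rw [he, ENNReal.ofReal_inv_of_pos hpos, ENNReal.ofReal_natCast] at h3
      have h4 := h3.trans (mul_le_mul_right (hmem (n + 1)) _)
      rw [mul_one] at h4
      calc ((n + 1 : ℕ) : ℝ≥0∞) * p.modular (fun x => (U : Ω →ₘ[μ] ℝ) x)
          ≤ ((n + 1 : ℕ) : ℝ≥0∞) * ((n + 1 : ℕ) : ℝ≥0∞)⁻¹ := by gcongr
        _ = 1 := ENNReal.mul_inv_cancel (by simp) (ENNReal.natCast_ne_top _)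
    obtain ⟨n, hlt⟩ := ENNReal.exists_nat_mul_gt hne (b := 1) ENNReal.one_ne_top
    refine absurd (hn n) (not_le.2 (hlt.trans_le ?_))
    gcongr
    exact Nat.le_succ n
  have hmeas' : AEMeasurable
      (fun x => ENNReal.ofReal (Real.cosh ((U : Ω →ₘ[μ] ℝ) x) - 1)) p.prob :=
    ((Real.measurable_cosh.comp_aemeasurable hmeas).sub_const 1).ennreal_ofReal
  rw [PosDensity.modular, lintegral_eq_zero_iff' hmeas'] at hm0
  have hU0 : ⇑(U : Ω →ₘ[μ] ℝ) =ᵐ[μ] ⇑(0 : Ω →ₘ[μ] ℝ) := by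
    filter_upwards [p.absolutelyContinuous_prob.ae_le hm0,
      AEEqFun.coeFn_zero (α := Ω) (μ := μ) (β := ℝ)] with x hx hx0
    rw [hx0]
    simp only [Pi.zero_apply, ENNReal.ofReal_eq_zero] at hx ⊢
    by_contra hne
    have := Real.one_lt_cosh.2 hne
    linarith
  exact Subtype.ext (AEEqFun.ext hU0)

theorem LPhi.normCore (p : PosDensity μ) : NormedSpace.Core ℝ (LPhi p) where
  norm_nonneg U := by
    rw [LPhi.norm_eq_gauge]; exact gauge_nonneg U
  norm_smul c U := by
    simp only [LPhi.norm_eq_gauge]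
    exact gauge_smul (LPhi.balanced_unitSet p) c U
  norm_triangle U V := by
    simp only [LPhi.norm_eq_gauge]
    exact gauge_add_le (LPhi.convex_unitSet p) (LPhi.absorbent_unitSet p) U V
  norm_eq_zero_iff U := by
    refine ⟨LPhi.eq_zero_of_norm_eq_zero p U, ?_⟩
    rintro rfl
    rw [LPhi.norm_eq_gauge, gauge_zero]

instance LPhi.instNormedAddCommGroup (p : PosDensity μ) : NormedAddCommGroup (LPhi p) :=
  NormedAddCommGroup.ofCore (LPhi.normCore p)

instance LPhi.instNormedSpace (p : PosDensity μ) : NormedSpace ℝ (LPhi p) :=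
  NormedSpace.ofCore (LPhi.normCore p)


theorem LPhi.integrable (p : PosDensity μ) (U : LPhi p) :
    Integrable (fun x => (U : Ω →ₘ[μ] ℝ) x) p.prob := by
  have := p.isProbabilityMeasure
  obtain ⟨r, hr, hU⟩ := U.2
  have hmeas : AEMeasurable (fun x => (U : Ω →ₘ[μ] ℝ) x) p.prob :=
    (U : Ω →ₘ[μ] ℝ).aestronglyMeasurable.aemeasurable.mono_ac p.prob_absolutelyContinuous
  have hc : AEMeasurable (fun x => Real.cosh (r * (U : Ω →ₘ[μ] ℝ) x) - 1) p.prob :=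
    (Real.measurable_cosh.comp_aemeasurable (hmeas.const_mul r)).sub_const 1
  have hI : Integrable (fun x => Real.cosh (r * (U : Ω →ₘ[μ] ℝ) x) - 1) p.prob := by
    refine ⟨hc.aestronglyMeasurable, ?_⟩
    rw [hasFiniteIntegral_iff_ofReal
      (Eventually.of_forall fun x => by
        simp)]
    exact hU
  refine Integrable.mono' (((hI.const_mul 2).add (integrable_const (2 : ℝ))).const_mul r⁻¹)
    hmeas.aestronglyMeasurable (Eventually.of_forall fun x => ?_)
  have h1 : |r * (U : Ω →ₘ[μ] ℝ) x| ≤ 2 * Real.cosh (r * (U : Ω →ₘ[μ] ℝ) x) := by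
    rw [← Real.cosh_abs, Real.cosh_eq]
    have h2 := Real.add_one_le_exp |r * (U : Ω →ₘ[μ] ℝ) x|
    have h3 := Real.exp_pos (-|r * (U : Ω →ₘ[μ] ℝ) x|)
    linarith
  rw [abs_mul, abs_of_pos hr] at h1
  rw [Real.norm_eq_abs, Pi.add_apply]
  calc |(U : Ω →ₘ[μ] ℝ) x| = r⁻¹ * (r * |(U : Ω →ₘ[μ] ℝ) x|) := by
        rw [← mul_assoc, inv_mul_cancel₀ hr.ne', one_mul]
    _ ≤ r⁻¹ * (2 * (Real.cosh (r * (U : Ω →ₘ[μ] ℝ) x) - 1) + 2) := by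
        gcongr
        linarith

theorem LPhi.expect_add (p : PosDensity μ) (U V : LPhi p) :
    p.expect ((U + V : LPhi p) : Ω →ₘ[μ] ℝ) =
      p.expect (U : Ω →ₘ[μ] ℝ) + p.expect (V : Ω →ₘ[μ] ℝ) := by
  unfold PosDensity.expect
  rw [← integral_add (LPhi.integrable p U) (LPhi.integrable p V)]
  refine integral_congr_ae ?_
  filter_upwards [p.prob_absolutelyContinuous.ae_le
    (AEEqFun.coeFn_add (U : Ω →ₘ[μ] ℝ) (V : Ω →ₘ[μ] ℝ))] with x hx
  rw [Submodule.coe_add, hx, Pi.add_apply]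

theorem LPhi.expect_smul (p : PosDensity μ) (c : ℝ) (U : LPhi p) :
    p.expect ((c • U : LPhi p) : Ω →ₘ[μ] ℝ) = c * p.expect (U : Ω →ₘ[μ] ℝ) := by
  unfold PosDensity.expect
  rw [← integral_const_mul]
  refine integral_congr_ae ?_
  filter_upwards [p.prob_absolutelyContinuous.ae_le
    (AEEqFun.coeFn_smul c (U : Ω →ₘ[μ] ℝ))] with x hx
  rw [Submodule.coe_smul, hx, Pi.smul_apply, smul_eq_mul]

/-- The model space `B_p = L₀^Φ(p)` of the `p`-centered elements of `L^Φ(p)`, with the norm of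
`L^Φ(p)`. -/
def BSpace (p : PosDensity μ) : Submodule ℝ (LPhi p) where
  carrier := {U | p.expect (U : Ω →ₘ[μ] ℝ) = 0}
  zero_mem' := by
    have h := LPhi.expect_smul p 0 0
    rwa [zero_smul, zero_mul] at h
  add_mem' := by
    intro U V hU hV
    change p.expect _ = 0
    rw [LPhi.expect_add, show p.expect (U : Ω →ₘ[μ] ℝ) = 0 from hU,
      show p.expect (V : Ω →ₘ[μ] ℝ) = 0 from hV, add_zero]
  smul_mem' := by
    intro c U hU
    change p.expect _ = 0
    rw [LPhi.expect_smul, show p.expect (U : Ω →ₘ[μ] ℝ) = 0 from hU, mul_zero]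

/-- The random variable represented by an element of `B_p`. -/
def BSpace.fn {p : PosDensity μ} (U : BSpace p) : Ω → ℝ := ((U : LPhi p) : Ω →ₘ[μ] ℝ)

/-- The constant random variables belong to `L^Φ(p)`. -/
def LPhi.const (p : PosDensity μ) (c : ℝ) : LPhi p :=
  ⟨AEEqFun.const Ω c, by
    have := p.isProbabilityMeasure
    refine ⟨1, one_pos, ?_⟩
    have h : p.modular (fun x => 1 * (AEEqFun.const Ω c : Ω →ₘ[μ] ℝ) x) =
        p.modular (fun _ => c) := by
      refine p.modular_congr ?_
      filter_upwards [AEEqFun.coeFn_const (μ := μ) Ω c] with x hx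
      rw [one_mul, hx, Function.const_apply]
    rw [h]
    simp [PosDensity.modular]⟩

theorem LPhi.expect_const (p : PosDensity μ) (c : ℝ) :
    p.expect (LPhi.const p c : Ω →ₘ[μ] ℝ) = c := by
  have := p.isProbabilityMeasure
  have h : p.expect (LPhi.const p c : Ω →ₘ[μ] ℝ) = ∫ _, c ∂p.prob := by
    refine integral_congr_ae ?_
    filter_upwards [p.prob_absolutelyContinuous.ae_le (AEEqFun.coeFn_const (μ := μ) Ω c)] with x hx
    change (AEEqFun.const Ω c : Ω →ₘ[μ] ℝ) x = c
    rw [hx, Function.const_apply]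
  rw [h]
  simp

/-- The centering `U ↦ U - E_p[U]`. -/
def LPhi.center (p : PosDensity μ) (U : LPhi p) : BSpace p :=
  ⟨U - LPhi.const p (p.expect (U : Ω →ₘ[μ] ℝ)), by
    change p.expect _ = 0
    rw [sub_eq_add_neg, ← neg_one_smul ℝ, LPhi.expect_add, LPhi.expect_smul, LPhi.expect_const]
    ring⟩

/-! ### The exponential manifold -/

/-- The moment generating functional `G_p(U) = E_p[exp U]` is finite at `U`. -/
def mgfFinite (p : PosDensity μ) : Set (BSpace p) :=
  {U | Integrable (fun x => Real.exp (BSpace.fn U x)) p.prob}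

/-- The domain `S_p`: the interior in `B_p` of the proper domain of `G_p`. -/
def expDomain (p : PosDensity μ) : Set (BSpace p) := interior (mgfFinite p)

/-- The cumulant generating functional `K_p(U) = log E_p[exp U]`. -/
def cgf (p : PosDensity μ) (U : BSpace p) : ℝ := Real.log (p.expect fun x => Real.exp (BSpace.fn U x))

/-- The maximal exponential family at `p`: the densities `exp(u - K_p(u)) · p` with `u ∈ S_p`. -/
def maxExp (p : PosDensity μ) : Set (PosDensity μ) :=
  {q | ∃ u ∈ expDomain p,
    ∀ᵐ x ∂μ, q.toFun x = Real.exp (BSpace.fn u x - cgf p u) * p.toFun x}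

/-- The random variable `log (q / p)`. -/
def logRatio (p q : PosDensity μ) : Ω →ₘ[μ] ℝ :=
  AEEqFun.mk (fun x => Real.log (q.toFun x / p.toFun x))
    (Real.measurable_log.comp_aemeasurable
      (q.toFun.aestronglyMeasurable.aemeasurable.div
        p.toFun.aestronglyMeasurable.aemeasurable)).aestronglyMeasurable

open Classical in
/-- The chart `s_p(q) = log (q / p) - E_p[log (q / p)] ∈ B_p`. It is only used at densities `q`
of the maximal exponential family of `p`, where `log (q / p) ∈ L^Φ(p)`; elsewhere it may have
the value `0`. -/
def expChart (p q : PosDensity μ) : BSpace p :=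
  if h : logRatio p q ∈ LPhi p then LPhi.center p ⟨logRatio p q, h⟩ else 0

/-- The curve `c`, considered for times in `I`, is differentiable at `t₀ ∈ I` as a map into the
exponential manifold `M` (a maximal exponential family with its atlas of global charts `s_q`,
`q ∈ M`). -/
def DifferentiableIntoAt (M : Set (PosDensity μ)) (c : ℝ → PosDensity μ) (I : Set ℝ)
    (t₀ : ℝ) : Prop :=
  (∀ᶠ t in 𝓝[I] t₀, c t ∈ M) ∧
    ∀ q ∈ M, DifferentiableWithinAt ℝ (fun t => expChart q (c t)) I t₀

/-- The family `(α t)` of random variables, for times in `I`, is continuous at `t₀` as a map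
into `L^Φ(p)`. -/
def ContinuousIntoLPhiAt (p : PosDensity μ) (α : ℝ → Ω → ℝ) (I : Set ℝ) (t₀ : ℝ) : Prop :=
  ∃ A : ℝ → LPhi p, (∀ᶠ t in 𝓝[I] t₀, ⇑(A t : Ω →ₘ[μ] ℝ) =ᵐ[μ] α t) ∧
    ContinuousWithinAt A I t₀

/-! ### Submanifolds -/

/-- A splitting chart for `N` at `q`, read in the chart `s_q` of the exponential manifold: the
model space `B_q` splits into two closed complementary subspaces `V₁`, `V₂`, and `σ` is a
`C²` diffeomorphism of a neighbourhood of `0 = s_q(q)` inside `S_q` onto the product of an open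
set of `V₁` and an open set of `V₂`, which maps the part of `N` in that neighbourhood onto the
part of its range in `V₁ × {0}`. -/
structure SplittingChart (N : Set (PosDensity μ)) (q : PosDensity μ) where
  V₁ : Submodule ℝ (BSpace q)
  V₂ : Submodule ℝ (BSpace q)
  isClosed_V₁ : IsClosed (V₁ : Set (BSpace q))
  isClosed_V₂ : IsClosed (V₂ : Set (BSpace q))
  isCompl : IsCompl V₁ V₂
  σ : OpenPartialHomeomorph (BSpace q) (V₁ × V₂)
  source_subset : σ.source ⊆ expDomain q
  zero_mem_source : (0 : BSpace q) ∈ σ.source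
  target_eq_prod : ∃ (O₁ : Set V₁) (O₂ : Set V₂), IsOpen O₁ ∧ IsOpen O₂ ∧ σ.target = O₁ ×ˢ O₂
  contDiffOn : ContDiffOn ℝ 2 σ σ.source
  contDiffOn_symm : ContDiffOn ℝ 2 σ.symm σ.target
  mem_iff : ∀ u ∈ σ.source, u ∈ expChart q '' N ↔ (σ u).2 = 0

/-- `N` is a (`C²`, in particular any smooth) submanifold of the exponential manifold `M`. -/
def IsSubmanifold (M N : Set (PosDensity μ)) : Prop :=
  N ⊆ M ∧ ∀ q ∈ N, Nonempty (SplittingChart N q)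

/-- `N` is a finite dimensional submanifold of the exponential manifold `M`. -/
def IsFiniteDimSubmanifold (M N : Set (PosDensity μ)) : Prop :=
  N ⊆ M ∧ ∀ q ∈ N, ∃ C : SplittingChart N q, FiniteDimensional ℝ C.V₁

/-- `V ∈ B_q` is tangent to `N` at `q`: it is the velocity at `q` of a curve in `N`. -/
def IsTangentTo (N : Set (PosDensity μ)) (q : PosDensity μ) (V : BSpace q) : Prop :=
  ∃ c : ℝ → PosDensity μ, c 0 = q ∧ (∀ᶠ s in 𝓝 0, c s ∈ N) ∧
    HasDerivAt (fun s => expChart q (c s)) V 0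

/-- `N` is closed in the exponential manifold `M`: a point `q` of `M` belongs to `N` as soon as
`s_q(q) = 0` lies in the closure of `s_q(N)`. -/
def IsClosedIn (M N : Set (PosDensity μ)) : Prop :=
  ∀ q ∈ M, (0 : BSpace q) ∈ closure (expChart q '' N) → q ∈ N

end Densities

/-! ### The Fokker-Planck equation -/

section FokkerPlanck

/-- The partial derivative `∂g/∂xᵢ`. -/
def pderivAt {n : ℕ} (i : Fin n) (g : EuclideanSpace ℝ (Fin n) → ℝ)
    (x : EuclideanSpace ℝ (Fin n)) : ℝ :=
  fderiv ℝ g x (EuclideanSpace.single i 1)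

/-- The forward operator
`L* g = - ∑ᵢ ∂ᵢ (bᵢ g) + 1/2 ∑ᵢⱼ ∂ᵢ ∂ⱼ (aᵢⱼ g)` with drift `b` and diffusion matrix `a`. -/
def forwardOp {n : ℕ} (b : EuclideanSpace ℝ (Fin n) → EuclideanSpace ℝ (Fin n))
    (a : EuclideanSpace ℝ (Fin n) → Matrix (Fin n) (Fin n) ℝ)
    (g : EuclideanSpace ℝ (Fin n) → ℝ) (x : EuclideanSpace ℝ (Fin n)) : ℝ :=
  -(∑ i, pderivAt i (fun y => b y i * g y) x) +
    1 / 2 * ∑ i, ∑ j, pderivAt i (pderivAt j (fun y => a y i j * g y)) x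

/-- The function `L* g / g`. -/
def forwardScore {n : ℕ} (b : EuclideanSpace ℝ (Fin n) → EuclideanSpace ℝ (Fin n))
    (a : EuclideanSpace ℝ (Fin n) → Matrix (Fin n) (Fin n) ℝ)
    (g : EuclideanSpace ℝ (Fin n) → ℝ) (x : EuclideanSpace ℝ (Fin n)) : ℝ :=
  forwardOp b a g x / g x

/-- Regularity `C^{k,0}` on `[0,∞) × ℝⁿ`: `k` times differentiable with respect to `x`, with all
derivatives with respect to `x` up to the order `k` continuous in `(t, x)`. -/
def IsCk0 {n : ℕ} {F : Type*} [NormedAddCommGroup F] [NormedSpace ℝ F] (k : ℕ)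
    (g : ℝ → EuclideanSpace ℝ (Fin n) → F) : Prop :=
  (∀ t, 0 ≤ t → ContDiff ℝ k (g t)) ∧
    ∀ j ≤ k, ContinuousOn
      (fun z : ℝ × EuclideanSpace ℝ (Fin n) => iteratedFDeriv ℝ j (g z.1) z.2)
      (Ici 0 ×ˢ univ)

/-- The diffusion matrix `a = σ σ'`. -/
def diffusionMatrix {n m : ℕ} (σ : ℝ → EuclideanSpace ℝ (Fin n) → Matrix (Fin n) (Fin m) ℝ)
    (t : ℝ) (x : EuclideanSpace ℝ (Fin n)) : Matrix (Fin n) (Fin n) ℝ :=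
  σ t x * (σ t x).transpose

/-- The standing assumptions on the stochastic differential equation
`dX = f_t(X) dt + σ_t(X) dW` and on the densities `p t`, `t ≥ 0`: the regularity and growth of the
coefficients, and `p` a classical solution of the Fokker-Planck equation consisting of almost
everywhere positive probability densities; `P t` is the class of `p t`. The norm of the positive
semidefinite matrix `a` in the growth condition is its trace norm. The regularity `C^{2,1}` of `p`
is `C^{2,0}` together with the equation, whose right hand side is continuous in `(t, x)`. At `t = 0`
the time derivative is one-sided. -/
structure IsFokkerPlanckFlow {n m : ℕ}
    (f : ℝ → EuclideanSpace ℝ (Fin n) → EuclideanSpace ℝ (Fin n))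
    (σ : ℝ → EuclideanSpace ℝ (Fin n) → Matrix (Fin n) (Fin m) ℝ)
    (p : ℝ → EuclideanSpace ℝ (Fin n) → ℝ)
    (P : ℝ → PosDensity (volume : Measure (EuclideanSpace ℝ (Fin n)))) : Prop where
  drift_regular : IsCk0 1 f
  diffusion_regular : ∀ i j, IsCk0 2 (fun t x => diffusionMatrix σ t x i j)
  growth : ∃ K : ℝ, 0 < K ∧ ∀ t, 0 ≤ t → ∀ x,
    2 * inner ℝ x (f t x) + (diffusionMatrix σ t x).trace ≤ K * (1 + ‖x‖ ^ 2)
  density_regular : IsCk0 2 p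
  fokkerPlanck : ∀ t, 0 ≤ t → ∀ x,
    HasDerivWithinAt (fun s => p s x) (forwardOp (f t) (diffusionMatrix σ t) (p t) x) (Ici 0) t
  density : ∀ t, 0 ≤ t → ⇑(P t).toFun =ᵐ[volume] p t

/-- `V ∈ B_q` is the random variable `L_t* q / q`, computed with the twice continuously
differentiable version of the density `q`. -/
def IsForwardScore {n m : ℕ}
    (f : ℝ → EuclideanSpace ℝ (Fin n) → EuclideanSpace ℝ (Fin n))
    (σ : ℝ → EuclideanSpace ℝ (Fin n) → Matrix (Fin n) (Fin m) ℝ) (t : ℝ)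
    (q : PosDensity (volume : Measure (EuclideanSpace ℝ (Fin n)))) (V : BSpace q) : Prop :=
  ∃ g : EuclideanSpace ℝ (Fin n) → ℝ, ContDiff ℝ 2 g ∧ ⇑q.toFun =ᵐ[volume] g ∧
    BSpace.fn V =ᵐ[volume] forwardScore (f t) (diffusionMatrix σ t) g

/-- For all `t ≥ 0` the random variable `L_t* q / q` is tangent to `N` at `q`, for all `q ∈ N`. -/
def ForwardTangentTo {n m : ℕ}
    (f : ℝ → EuclideanSpace ℝ (Fin n) → EuclideanSpace ℝ (Fin n))
    (σ : ℝ → EuclideanSpace ℝ (Fin n) → Matrix (Fin n) (Fin m) ℝ)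
    (N : Set (PosDensity (volume : Measure (EuclideanSpace ℝ (Fin n))))) : Prop :=
  ∀ t, 0 ≤ t → ∀ q ∈ N, ∃ V : BSpace q, IsForwardScore f σ t q V ∧ IsTangentTo N q V

/-- The time dependent vector field `q ↦ L_t* q / q` on `N` is continuous in `t` and locally
Lipschitz in `q`, locally uniformly in `t`: around every `q₀ ∈ N` and every time `t₀ ≥ 0` this holds
for its expression `F t (s_{q₀}(q)) = V - E_{q₀}[V]`, `V = L_t* q / q`, in the chart `s_{q₀}`. -/
def ForwardLocallyLipschitzOn {n m : ℕ}
    (f : ℝ → EuclideanSpace ℝ (Fin n) → EuclideanSpace ℝ (Fin n))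
    (σ : ℝ → EuclideanSpace ℝ (Fin n) → Matrix (Fin n) (Fin m) ℝ)
    (N : Set (PosDensity (volume : Measure (EuclideanSpace ℝ (Fin n))))) : Prop :=
  ∀ q₀ ∈ N, ∀ t₀, 0 ≤ t₀ →
    ∃ (F : ℝ → BSpace q₀ → BSpace q₀) (O : Set (BSpace q₀)) (ε : ℝ) (L : ℝ≥0),
      O ∈ 𝓝 (0 : BSpace q₀) ∧ 0 < ε ∧
      (∀ t ∈ Ici 0 ∩ Metric.ball t₀ ε, ∀ q ∈ N, expChart q₀ q ∈ O →
        ∀ V : BSpace q, IsForwardScore f σ t q V →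
          BSpace.fn (F t (expChart q₀ q)) =ᵐ[volume] fun x => BSpace.fn V x - q₀.expect (BSpace.fn V)) ∧
      (∀ t ∈ Ici 0 ∩ Metric.ball t₀ ε, LipschitzOnWith L (F t) (O ∩ expChart q₀ '' N)) ∧
      ∀ u ∈ O ∩ expChart q₀ '' N, ContinuousOn (fun t => F t u) (Ici 0 ∩ Metric.ball t₀ ε)

end FokkerPlanck

end

noncomputable section

/-! ### Luxemburg norm, exponential moments and completeness of the Orlicz space. -/

section OrliczNorm

variable {Ω : Type*} [MeasurableSpace Ω] {μ : Measure Ω}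

/-! Membership in a common maximal exponential family amounts to the symmetric relation
`ExpConnected`: log(q/p) belongs to both Orlicz spaces. These spaces then coincide with equivalent
norms and the chart changes are affine, so differentiability may be tested in one chart.

Part (i): a velocity V at p in the chart of p forces the densities to be differentiable in L¹ with
derivative pV (`integral_abs_sub_sub_le`). By Fatou's lemma an L¹ derivative agrees almost
everywhere with the pointwise time derivative, here L*p
(`HasL1DerivWithinAt.ae_eq_of_hasDerivWithinAt`). Hence V = L*p/p.

Part (ii): for almost every x, log p_t − log p_{t₀} is the time integral of the score α
(`log_sub_log_eq_intervalIntegral`). Jensen's inequality for the modular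
(`PosDensity.modular_intervalIntegral_le`) then bounds the norm of log(p_t/p_{t₀}) − (t − t₀)α_{t₀}
by |t − t₀| times the oscillation of α near t₀.

Part (iii): since q ↦ L*q/q is tangent to N, it is a vector field in the coordinates of V₁, and
Picard-Lindelöf yields a local integral curve inside N. As in (i), this curve solves the
Fokker-Planck equation in L¹; so does p_t while it stays in the exponential manifold, by (ii) and
(i). The two agree by the uniqueness theorem `eq_of_hasL1DerivWithinAt_forwardOp`. Its engine is the
functional ∫ cd/(c+d) of two solutions: yz/(y+z) is concave and homogeneous of degree one, so the
minimum principle makes this functional nondecreasing in time, up to a logarithmic cutoff whose cost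
is controlled by the one-sided growth condition. Its largest value 1/2 is attained only for c = d,
so equality at the initial time persists.

In finite dimension the Lipschitz property of the field is proved, not assumed. Tested against φ,
the score W of a density proportional to exp(u)q₀ satisfies E[φ exp(u) W] = E[(Lφ) exp(u)], with
expectations under q₀. The right side is Lipschitz in u and continuous in t; the left side is linear
in the coordinates of W, and finitely many φ determine them (`exists_affinePairing_lower`).

Persistence in N for a short time gives the first exit time, and continuity in the chart at the exit
point gives the statement on closed N. -/

theorem LPhi.modular_inv_mul_le_one {p : PosDensity μ} {U : LPhi p} {c : ℝ} (h : ‖U‖ < c) :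
    p.modular (fun x => c⁻¹ * (U : Ω →ₘ[μ] ℝ) x) ≤ 1 := by
  have hc : 0 < c := (norm_nonneg U).trans_lt h
  have h1 : gauge (LPhi.unitSet p) (c⁻¹ • U) < 1 := by
    rw [gauge_smul_of_nonneg (inv_nonneg.2 hc.le), ← LPhi.norm_eq_gauge, smul_eq_mul,
      inv_mul_lt_one₀ hc]
    exact h
  have h2 := setOfPred_gauge_lt_one_subset_self (LPhi.convex_unitSet p)
    (LPhi.absorbent_unitSet p).zero_mem (LPhi.absorbent_unitSet p) h1
  change p.modular _ ≤ 1 at h2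
  rwa [LPhi.modular_coe_smul] at h2

theorem LPhi.norm_le_of_modular_le_one {p : PosDensity μ} {U : LPhi p} {c : ℝ} (hc : 0 < c)
    (h : p.modular (fun x => c⁻¹ * (U : Ω →ₘ[μ] ℝ) x) ≤ 1) : ‖U‖ ≤ c :=
  csInf_le ⟨0, fun _ hx => hx.1.le⟩ ⟨hc, h⟩

theorem PosDensity.aemeasurable_prob (p : PosDensity μ) (U : Ω →ₘ[μ] ℝ) : AEMeasurable U p.prob :=
  U.aestronglyMeasurable.aemeasurable.mono_ac p.prob_absolutelyContinuous

theorem exp_abs_le_two_mul_cosh (y : ℝ) : Real.exp |y| ≤ 2 * Real.cosh y := by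
  rw [← Real.cosh_abs, Real.cosh_eq]
  linarith [Real.exp_pos (-|y|)]

theorem cosh_le_exp_abs (y : ℝ) : Real.cosh y ≤ Real.exp |y| := by
  rw [← Real.cosh_abs, Real.cosh_eq]
  have := Real.exp_le_exp.2 (neg_le_self (abs_nonneg y))
  linarith

theorem abs_le_cosh (y : ℝ) : |y| ≤ Real.cosh y := by
  have h := Real.one_le_cosh y
  by_cases hy : |y| ≤ 1
  · linarith
  · have h2 := Real.self_le_sinh_iff.2 (abs_nonneg y)
    have h3 := Real.sinh_lt_cosh |y|
    rw [Real.cosh_abs] at h3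
    linarith

/-- Controls the second-order remainder of the exponential by the Young function itself. -/
theorem abs_exp_sub_one_sub_le (y : ℝ) : |Real.exp y - 1 - y| ≤ 2 * (Real.cosh y - 1) := by
  rw [abs_of_nonneg (by linarith [Real.add_one_le_exp y]), Real.cosh_eq]
  linarith [Real.add_one_le_exp (-y)]

/-- Convexity alone would give the factor `c`. The square comes from cosh z − 1 = 2 sinh²(z/2)
together with sinh(cz) ≤ c sinh z for z ≥ 0. It makes the modular quadratically small in the norm,
hence negligible to first order along a differentiable curve. -/
theorem cosh_mul_sub_one_le {c : ℝ} (hc : 0 ≤ c) (hc1 : c ≤ 1) (y : ℝ) :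
    Real.cosh (c * y) - 1 ≤ c ^ 2 * (Real.cosh y - 1) := by
  wlog hy : 0 ≤ y generalizing y
  · have := this (-y) (by linarith)
    rwa [mul_neg, Real.cosh_neg, Real.cosh_neg] at this
  have key : ∀ z : ℝ, Real.cosh z - 1 = 2 * Real.sinh (z / 2) ^ 2 := by
    intro z
    have h1 := Real.cosh_two_mul (z / 2)
    have h2 := Real.cosh_sq (z / 2)
    rw [mul_div_cancel₀ z two_ne_zero] at h1
    linarith
  rw [key, key]
  have hy2 : 0 ≤ y / 2 := by positivity
  have h3 : Real.sinh (c * y / 2) ≤ c * Real.sinh (y / 2) := by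
    have hmono : MonotoneOn (fun z => c * Real.sinh z - Real.sinh (c * z)) (Ici 0) := by
      refine monotoneOn_of_deriv_nonneg (convex_Ici 0) (by fun_prop) (by fun_prop) ?_
      intro z hz
      rw [interior_Ici, mem_Ioi] at hz
      have hd : HasDerivAt (fun z => c * Real.sinh z - Real.sinh (c * z))
          (c * Real.cosh z - Real.cosh (c * z) * (c * 1)) z :=
        ((Real.hasDerivAt_sinh z).const_mul c).sub
          ((Real.hasDerivAt_sinh _).comp z ((hasDerivAt_id z).const_mul c))
      rw [hd.deriv]
      have : Real.cosh (c * z) ≤ Real.cosh z := by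
        rw [Real.cosh_le_cosh, abs_mul, abs_of_nonneg hc]
        nlinarith [abs_nonneg z]
      nlinarith
    have h := hmono (mem_Ici.2 le_rfl) (mem_Ici.2 hy2) hy2
    simp only [Real.sinh_zero, mul_zero, sub_self] at h
    rw [mul_div_assoc]
    linarith
  have h4 : 0 ≤ Real.sinh (c * y / 2) := Real.sinh_nonneg_iff.2 (by positivity)
  nlinarith

theorem PosDensity.lintegral_exp_abs_le (p : PosDensity μ) (U : Ω → ℝ) :
    ∫⁻ x, ENNReal.ofReal (Real.exp |U x|) ∂p.prob ≤ 2 * p.modular U + 2 := by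
  have := p.isProbabilityMeasure
  calc ∫⁻ x, ENNReal.ofReal (Real.exp |U x|) ∂p.prob
      ≤ ∫⁻ x, (2 * ENNReal.ofReal (Real.cosh (U x) - 1) + 2) ∂p.prob := by
        refine lintegral_mono fun x => ?_
        have h : (2 : ℝ≥0∞) = ENNReal.ofReal 2 := by simp
        rw [h, ← ENNReal.ofReal_mul zero_le_two, ← ENNReal.ofReal_add
          (by linarith [Real.one_le_cosh (U x)]) zero_le_two]
        exact ENNReal.ofReal_le_ofReal (by linarith [exp_abs_le_two_mul_cosh (U x)])
    _ = 2 * p.modular U + 2 := by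
        rw [lintegral_add_right _ measurable_const, lintegral_const_mul' _ _ (by simp)]
        simp [PosDensity.modular]

theorem PosDensity.modular_le_lintegral_exp_abs (p : PosDensity μ) (U : Ω → ℝ) :
    p.modular U ≤ ∫⁻ x, ENNReal.ofReal (Real.exp |U x|) ∂p.prob :=
  lintegral_mono fun x => ENNReal.ofReal_le_ofReal (by linarith [cosh_le_exp_abs (U x)])

theorem PosDensity.mem_LPhi_iff (p : PosDensity μ) (U : Ω →ₘ[μ] ℝ) :
    U ∈ LPhi p ↔ ∃ r : ℝ, 0 < r ∧ ∫⁻ x, ENNReal.ofReal (Real.exp (r * |U x|)) ∂p.prob < ∞ := by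
  have key : ∀ r : ℝ, 0 < r → ∀ x, |r * U x| = r * |U x| := fun r hr x => by
    rw [abs_mul, abs_of_pos hr]
  constructor
  · rintro ⟨r, hr, h⟩
    refine ⟨r, hr, ?_⟩
    have h1 := p.lintegral_exp_abs_le (fun x => r * U x)
    simp only [key r hr] at h1
    refine h1.trans_lt (ENNReal.add_lt_top.2 ⟨ENNReal.mul_lt_top (by simp) h, by simp⟩)
  · rintro ⟨r, hr, h⟩
    refine ⟨r, hr, (p.modular_le_lintegral_exp_abs _).trans_lt ?_⟩
    simpa only [key r hr] using h

theorem LPhi.lintegral_abs_le {p : PosDensity μ} {U : LPhi p} {c : ℝ} (h : ‖U‖ < c) :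
    ∫⁻ x, ENNReal.ofReal |(U : Ω →ₘ[μ] ℝ) x| ∂p.prob ≤ ENNReal.ofReal (2 * c) := by
  have := p.isProbabilityMeasure
  have hc : 0 < c := (norm_nonneg U).trans_lt h
  calc ∫⁻ x, ENNReal.ofReal |(U : Ω →ₘ[μ] ℝ) x| ∂p.prob
      ≤ ∫⁻ x, ENNReal.ofReal c *
          (ENNReal.ofReal (Real.cosh (c⁻¹ * (U : Ω →ₘ[μ] ℝ) x) - 1) + 1) ∂p.prob := by
        refine lintegral_mono fun x => ?_
        have h1 := abs_le_cosh (c⁻¹ * (U : Ω →ₘ[μ] ℝ) x)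
        rw [abs_mul, abs_of_pos (inv_pos.2 hc), inv_mul_le_iff₀ hc] at h1
        rw [← ENNReal.ofReal_one, ← ENNReal.ofReal_add (by linarith [Real.one_le_cosh (c⁻¹ * (U : Ω →ₘ[μ] ℝ) x)]) zero_le_one,
          ← ENNReal.ofReal_mul hc.le]
        exact ENNReal.ofReal_le_ofReal (by rwa [sub_add_cancel])
    _ = ENNReal.ofReal c * (p.modular (fun x => c⁻¹ * (U : Ω →ₘ[μ] ℝ) x) + 1) := by
        rw [lintegral_const_mul' _ _ ENNReal.ofReal_ne_top, lintegral_add_right _ measurable_const]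
        simp [PosDensity.modular]
    _ ≤ ENNReal.ofReal c * (1 + 1) := by
        gcongr
        exact LPhi.modular_inv_mul_le_one h
    _ = ENNReal.ofReal (2 * c) := by
        rw [mul_comm 2 c, ENNReal.ofReal_mul hc.le, one_add_one_eq_two]
        simp

theorem LPhi.integral_abs_le {p : PosDensity μ} (U : LPhi p) :
    ∫ x, |(U : Ω →ₘ[μ] ℝ) x| ∂p.prob ≤ 2 * ‖U‖ := by
  refine le_of_forall_pos_le_add fun ε hε => ?_
  have h := LPhi.lintegral_abs_le (U := U) (c := ‖U‖ + ε / 2) (by linarith)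
  rw [integral_eq_lintegral_of_nonneg_ae (Eventually.of_forall fun x => abs_nonneg _)
    (LPhi.integrable p U).abs.aestronglyMeasurable]
  refine (ENNReal.toReal_mono ENNReal.ofReal_ne_top h).trans ?_
  rw [ENNReal.toReal_ofReal (by positivity)]
  linarith

theorem LPhi.modular_le_sq {p : PosDensity μ} {U : LPhi p} {c : ℝ} (h : ‖U‖ < c) (hc1 : c ≤ 1) :
    p.modular (fun x => (U : Ω →ₘ[μ] ℝ) x) ≤ ENNReal.ofReal (c ^ 2) := by
  have hc : 0 < c := (norm_nonneg U).trans_lt h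
  calc p.modular (fun x => (U : Ω →ₘ[μ] ℝ) x)
      ≤ ∫⁻ x, ENNReal.ofReal (c ^ 2) *
          ENNReal.ofReal (Real.cosh (c⁻¹ * (U : Ω →ₘ[μ] ℝ) x) - 1) ∂p.prob := by
        refine lintegral_mono fun x => ?_
        rw [← ENNReal.ofReal_mul (by positivity)]
        refine ENNReal.ofReal_le_ofReal ?_
        have := cosh_mul_sub_one_le hc.le hc1 (c⁻¹ * (U : Ω →ₘ[μ] ℝ) x)
        rwa [mul_inv_cancel_left₀ hc.ne'] at this
    _ ≤ ENNReal.ofReal (c ^ 2) * 1 := by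
        rw [lintegral_const_mul' _ _ ENNReal.ofReal_ne_top]
        gcongr
        exact LPhi.modular_inv_mul_le_one h
    _ = _ := mul_one _

theorem LPhi.lintegral_exp_abs_le {p : PosDensity μ} {U : LPhi p} {c : ℝ} (h : ‖U‖ < c) :
    ∫⁻ x, ENNReal.ofReal (Real.exp (c⁻¹ * |(U : Ω →ₘ[μ] ℝ) x|)) ∂p.prob ≤ 4 := by
  have hc : 0 < c := (norm_nonneg U).trans_lt h
  have h1 := p.lintegral_exp_abs_le (fun x => c⁻¹ * (U : Ω →ₘ[μ] ℝ) x)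
  simp only [abs_mul, abs_of_pos (inv_pos.2 hc)] at h1
  refine h1.trans ?_
  calc 2 * p.modular (fun x => c⁻¹ * (U : Ω →ₘ[μ] ℝ) x) + 2 ≤ 2 * 1 + 2 := by
        gcongr
        exact LPhi.modular_inv_mul_le_one h
    _ = 4 := by norm_num

/-- A Cauchy sequence for the Luxemburg norm is Cauchy in L¹(p), so a subsequence converges almost
everywhere, and Fatou's lemma carries the modular bounds on differences to the limit.
Picard-Lindelöf needs this when V₁ is infinite dimensional. -/
theorem LPhi.completeSpace (p : PosDensity μ) : CompleteSpace (LPhi p) := by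
  have := p.isProbabilityMeasure
  refine Metric.complete_of_cauchySeq_tendsto fun u hu => ?_
  set g : ℕ → Lp ℝ 1 p.prob := fun k => (LPhi.integrable p (u k)).toL1 _ with hg
  have hsub : ∀ k l, (fun x => ((u k - u l : LPhi p) : Ω →ₘ[μ] ℝ) x) =ᵐ[μ]
      fun x => (u k : Ω →ₘ[μ] ℝ) x - (u l : Ω →ₘ[μ] ℝ) x := fun k l => by
    filter_upwards [AEEqFun.coeFn_sub (u k : Ω →ₘ[μ] ℝ) (u l : Ω →ₘ[μ] ℝ)] with x hx
    rw [Submodule.coe_sub, hx, Pi.sub_apply]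
  have hdist : ∀ k l, dist (g k) (g l) ≤ 2 * dist (u k) (u l) := fun k l => by
    rw [dist_eq_norm, dist_eq_norm, hg, ← Integrable.toL1_sub, L1.norm_of_fun_eq_integral_norm]
    refine le_of_eq_of_le (integral_congr_ae ?_) (LPhi.integral_abs_le (u k - u l))
    filter_upwards [p.prob_absolutelyContinuous.ae_le (hsub k l)] with x hx
    rw [hx, Pi.sub_apply, Real.norm_eq_abs]
  have hgc : CauchySeq g := by
    rw [Metric.cauchySeq_iff] at hu ⊢
    intro ε hε
    obtain ⟨N, hN⟩ := hu (ε / 2) (by positivity)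
    exact ⟨N, fun k hk l hl => (hdist k l).trans_lt (by linarith [hN k hk l hl])⟩
  obtain ⟨f, hf⟩ := cauchySeq_tendsto_of_complete hgc
  obtain ⟨ns, hns, hlim⟩ := (tendstoInMeasure_of_tendsto_Lp hf).exists_seq_tendsto_ae
  have hfm : AEStronglyMeasurable f μ := (Lp.aestronglyMeasurable f).mono_ac
    p.absolutelyContinuous_prob
  have hlim' : ∀ᵐ x ∂μ, Tendsto (fun i => (u (ns i) : Ω →ₘ[μ] ℝ) x) atTop (𝓝 (f x)) := by
    refine p.absolutelyContinuous_prob.ae_le ?_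
    have hae : ∀ᵐ x ∂p.prob, ∀ k, g k x = (u k : Ω →ₘ[μ] ℝ) x :=
      ae_all_iff.2 fun k => Integrable.coeFn_toL1 _
    filter_upwards [hlim, hae] with x hx hx2
    simpa only [hx2] using hx
  have key : ∀ c : ℝ, 0 < c → ∃ N, ∀ k ≥ N,
      p.modular (fun x => c⁻¹ * ((u k : Ω →ₘ[μ] ℝ) x - f x)) ≤ 1 := by
    intro c hc
    obtain ⟨N, hN⟩ := Metric.cauchySeq_iff.1 hu c hc
    refine ⟨N, fun k hk => ?_⟩
    have hFm : ∀ V : Ω →ₘ[μ] ℝ, AEMeasurable (fun x => ENNReal.ofReal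
        (Real.cosh (c⁻¹ * ((u k : Ω →ₘ[μ] ℝ) x - V x)) - 1)) p.prob := fun V =>
      ((Real.measurable_cosh.comp_aemeasurable (((p.aemeasurable_prob _).sub
        (p.aemeasurable_prob V)).const_mul _)).sub_const 1).ennreal_ofReal
    have hF := lintegral_liminf_le' (u := atTop) (fun i => hFm (u (ns i) : Ω →ₘ[μ] ℝ))
    calc p.modular (fun x => c⁻¹ * ((u k : Ω →ₘ[μ] ℝ) x - f x))
        = ∫⁻ x, liminf (fun i => ENNReal.ofReal (Real.cosh
            (c⁻¹ * ((u k : Ω →ₘ[μ] ℝ) x - (u (ns i) : Ω →ₘ[μ] ℝ) x)) - 1)) atTop ∂p.prob := by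
          refine lintegral_congr_ae ?_
          filter_upwards [p.prob_absolutelyContinuous.ae_le hlim'] with x hx
          refine (Tendsto.liminf_eq ?_).symm
          exact (ENNReal.continuous_ofReal.tendsto _).comp
            (((Real.continuous_cosh.tendsto _).comp
              ((tendsto_const_nhds.sub hx).const_mul _)).sub_const 1)
      _ ≤ _ := hF
      _ ≤ 1 := by
          refine liminf_le_of_frequently_le' (Eventually.frequently ?_)
          filter_upwards [hns.tendsto_atTop.eventually_ge_atTop N] with i hi
          have h1 := hN k hk (ns i) hi
          rw [dist_eq_norm] at h1
          refine le_of_eq_of_le (p.modular_congr ?_) (LPhi.modular_inv_mul_le_one h1)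
          filter_upwards [hsub k (ns i)] with x hx
          rw [hx]
  have hmk : ∀ k, (fun x => ((u k : Ω →ₘ[μ] ℝ) - AEEqFun.mk f hfm) x) =ᵐ[μ]
      fun x => (u k : Ω →ₘ[μ] ℝ) x - f x := fun k => by
    filter_upwards [AEEqFun.coeFn_sub (u k : Ω →ₘ[μ] ℝ) (AEEqFun.mk f hfm),
      AEEqFun.coeFn_mk f hfm] with x hx hx2
    rw [hx, Pi.sub_apply, hx2]
  have hmod : ∀ (k : ℕ) (c : ℝ), p.modular (fun x => c⁻¹ * ((u k : Ω →ₘ[μ] ℝ) - AEEqFun.mk f hfm) x) =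
      p.modular (fun x => c⁻¹ * ((u k : Ω →ₘ[μ] ℝ) x - f x)) := fun k c =>
    p.modular_congr ((hmk k).mono fun x hx => by simp only at hx ⊢; rw [hx])
  have hmem : AEEqFun.mk f hfm ∈ LPhi p := by
    obtain ⟨N, hN⟩ := key 1 one_pos
    have h1 : (u N : Ω →ₘ[μ] ℝ) - AEEqFun.mk f hfm ∈ LPhi p :=
      ⟨1⁻¹, by norm_num, by rw [hmod]; exact (hN N le_rfl).trans_lt ENNReal.one_lt_top⟩
    have h2 := (LPhi p).sub_mem (u N).2 h1
    rwa [sub_sub_cancel] at h2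
  refine ⟨⟨_, hmem⟩, Metric.tendsto_atTop.2 fun ε hε => ?_⟩
  obtain ⟨N, hN⟩ := key (ε / 2) (by positivity)
  refine ⟨N, fun k hk => ?_⟩
  rw [dist_eq_norm]
  refine (LPhi.norm_le_of_modular_le_one (half_pos hε) ?_).trans_lt (half_lt_self hε)
  exact (hmod k (ε / 2)).trans_le (hN k hk)

end OrliczNorm

/-! ### Comparison of the Orlicz spaces of two densities; affine change of charts. -/

section Connection

variable {Ω : Type*} [MeasurableSpace Ω] {μ : Measure Ω}

theorem PosDensity.ext_ae {p q : PosDensity μ} (h : p.toFun =ᵐ[μ] q.toFun) : p = q := by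
  have h' := AEEqFun.ext h
  cases p
  cases q
  congr

theorem PosDensity.aemeasurable (p : PosDensity μ) : AEMeasurable p.toFun μ :=
  p.toFun.aestronglyMeasurable.aemeasurable

theorem PosDensity.lintegral_prob (p : PosDensity μ) (F : Ω → ℝ≥0∞) :
    ∫⁻ x, F x ∂p.prob = ∫⁻ x, ENNReal.ofReal (p.toFun x) * F x ∂μ :=
  lintegral_withDensity_eq_lintegral_mul_non_measurable₀ _ p.aemeasurable.ennreal_ofReal
    (Eventually.of_forall fun _ => ENNReal.ofReal_lt_top) F

theorem PosDensity.integral_prob (p : PosDensity μ) (F : Ω → ℝ) :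
    ∫ x, F x ∂p.prob = ∫ x, p.toFun x * F x ∂μ := by
  rw [PosDensity.prob, integral_withDensity_eq_integral_toReal_smul₀
    p.aemeasurable.ennreal_ofReal (Eventually.of_forall fun _ => ENNReal.ofReal_lt_top)]
  refine integral_congr_ae ?_
  filter_upwards [p.pos] with x hx
  simp only [smul_eq_mul]
  rw [ENNReal.toReal_ofReal hx.le]

theorem PosDensity.integrable_prob_iff (p : PosDensity μ) (F : Ω → ℝ) :
    Integrable F p.prob ↔ Integrable (fun x => p.toFun x * F x) μ := by
  rw [PosDensity.prob, integrable_withDensity_iff_integrable_smul₀'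
    p.aemeasurable.ennreal_ofReal (Eventually.of_forall fun _ => ENNReal.ofReal_lt_top)]
  refine integrable_congr ?_
  filter_upwards [p.pos] with x hx
  simp only [smul_eq_mul]
  rw [ENNReal.toReal_ofReal hx.le]

theorem coeFn_logRatio (p q : PosDensity μ) :
    ⇑(logRatio p q) =ᵐ[μ] fun x => Real.log (q.toFun x) - Real.log (p.toFun x) := by
  filter_upwards [AEEqFun.coeFn_mk (μ := μ) (fun x => Real.log (q.toFun x / p.toFun x))
    (Real.measurable_log.comp_aemeasurable (q.aemeasurable.div
        p.aemeasurable)).aestronglyMeasurable, p.pos, q.pos] with x hx hp hq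
  rw [logRatio, hx, Real.log_div hq.ne' hp.ne']

theorem exp_logRatio (p q : PosDensity μ) :
    ∀ᵐ x ∂μ, q.toFun x = p.toFun x * Real.exp (logRatio p q x) := by
  filter_upwards [coeFn_logRatio p q, p.pos, q.pos] with x hx hp hq
  rw [hx, Real.exp_sub, Real.exp_log hq, Real.exp_log hp]
  field_simp

theorem logRatio_add (p q s : PosDensity μ) : logRatio p q + logRatio q s = logRatio p s := by
  refine AEEqFun.ext ?_
  filter_upwards [AEEqFun.coeFn_add (logRatio p q) (logRatio q s), coeFn_logRatio p q,
    coeFn_logRatio q s, coeFn_logRatio p s] with x h1 h2 h3 h4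
  rw [h1, Pi.add_apply, h2, h3, h4]
  ring

theorem logRatio_self (p : PosDensity μ) : logRatio p p = 0 := by
  have h := logRatio_add p p p
  rwa [add_eq_left] at h

theorem neg_logRatio (p q : PosDensity μ) : -logRatio p q = logRatio q p :=
  neg_eq_of_add_eq_zero_right (by rw [logRatio_add, logRatio_self])

/-- Pointwise dichotomy with θ = ε/(1+ε). Either θU ≤ ε|log(q/p)|, and the first integral dominates;
or log(q/p) < U/(1+ε), and then q exp(θU) = p exp(log(q/p) + θU) ≤ p exp(U). -/
theorem lintegral_exp_transfer (p q : PosDensity μ) {ε : ℝ} (hε : 0 < ε) (U : Ω → ℝ) :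
    ∫⁻ x, ENNReal.ofReal (Real.exp (ε / (1 + ε) * U x)) ∂q.prob ≤
      ∫⁻ x, ENNReal.ofReal (Real.exp (ε * |logRatio p q x|)) ∂q.prob +
        ∫⁻ x, ENNReal.ofReal (Real.exp (U x)) ∂p.prob := by
  rw [q.lintegral_prob, q.lintegral_prob, p.lintegral_prob, ← lintegral_add_left']
  · refine lintegral_mono_ae ?_
    filter_upwards [exp_logRatio p q, p.pos, q.pos] with x hx hp hq
    rw [← ENNReal.ofReal_mul hq.le, ← ENNReal.ofReal_mul hq.le, ← ENNReal.ofReal_mul hp.le,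
      ← ENNReal.ofReal_add (by positivity) (by positivity)]
    refine ENNReal.ofReal_le_ofReal ?_
    by_cases h : ε / (1 + ε) * U x ≤ ε * |logRatio p q x|
    · have : Real.exp (ε / (1 + ε) * U x) ≤ Real.exp (ε * |logRatio p q x|) := Real.exp_le_exp.2 h
      have h2 : 0 ≤ p.toFun x * Real.exp (U x) := by positivity
      nlinarith
    · push Not at h
      have h3 : logRatio p q x + ε / (1 + ε) * U x ≤ U x := by
        have h4 := le_abs_self (logRatio p q x)
        have h5 : ε / (1 + ε) * U x = ε * (U x / (1 + ε)) := by ring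
        rw [h5] at h ⊢
        have h6 : logRatio p q x < U x / (1 + ε) := h4.trans_lt (lt_of_mul_lt_mul_left h hε.le)
        have h7 : U x = U x / (1 + ε) + ε * (U x / (1 + ε)) := by
          field_simp
        linarith
      have h4 : q.toFun x * Real.exp (ε / (1 + ε) * U x) ≤ p.toFun x * Real.exp (U x) := by
        rw [hx, mul_assoc, ← Real.exp_add]
        gcongr
      have h5 : 0 ≤ q.toFun x * Real.exp (ε * |logRatio p q x|) := by positivity
      linarith
  · exact q.aemeasurable.ennreal_ofReal.mul ((Real.measurable_exp.comp_aemeasurable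
      ((continuous_abs.measurable.comp_aemeasurable
        (logRatio p q).aestronglyMeasurable.aemeasurable).const_mul ε)).ennreal_ofReal)

theorem LPhi.exists_lintegral_exp_le {p q : PosDensity μ} (h : logRatio p q ∈ LPhi q) :
    ∃ θ : ℝ, 0 < θ ∧ ∃ C : ℝ, 0 ≤ C ∧ ∀ U : Ω → ℝ,
      ∫⁻ x, ENNReal.ofReal (Real.exp (θ * U x)) ∂q.prob ≤
        ENNReal.ofReal C + ∫⁻ x, ENNReal.ofReal (Real.exp (U x)) ∂p.prob := by
  obtain ⟨ε, hε, hfin⟩ := (q.mem_LPhi_iff _).1 h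
  refine ⟨ε / (1 + ε), by positivity,
    (∫⁻ x, ENNReal.ofReal (Real.exp (ε * |logRatio p q x|)) ∂q.prob).toReal,
    ENNReal.toReal_nonneg, fun U => ?_⟩
  rw [ENNReal.ofReal_toReal hfin.ne]
  exact lintegral_exp_transfer p q hε U

theorem LPhi.le_of_logRatio_mem {p q : PosDensity μ} (h : logRatio p q ∈ LPhi q) :
    LPhi p ≤ LPhi q := by
  intro U hU
  obtain ⟨θ, hθ, C, hC, hT⟩ := LPhi.exists_lintegral_exp_le h
  obtain ⟨r, hr, hfin⟩ := (p.mem_LPhi_iff _).1 hU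
  refine (q.mem_LPhi_iff _).2 ⟨θ * r, by positivity, ?_⟩
  simp only [mul_assoc]
  exact (hT fun x => r * |U x|).trans_lt (ENNReal.add_lt_top.2 ⟨ENNReal.ofReal_lt_top, hfin⟩)

theorem LPhi.exists_norm_inclusion_le {p q : PosDensity μ} (h : logRatio p q ∈ LPhi q) :
    ∃ M : ℝ, ∀ (U : LPhi p) (V : LPhi q),
      (V : Ω →ₘ[μ] ℝ) = U → ‖V‖ ≤ M * ‖U‖ := by
  obtain ⟨θ, hθ, C, hC, hT⟩ := LPhi.exists_lintegral_exp_le h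
  -- The 4 bounds E_p[exp(|U|/c)] for ‖U‖ < c. Convexity of the modular turns the bound C + 4 into 1
  -- by dividing the argument by C + 4.
  refine ⟨(C + 4) / θ, fun U V hUV => ?_⟩
  refine le_of_forall_pos_le_add fun ε hε => ?_
  set c := ‖U‖ + ε * θ / (C + 4) with hc
  have hlt : ‖U‖ < c := by
    have : 0 < ε * θ / (C + 4) := by positivity
    linarith
  have hc0 : 0 < c := (norm_nonneg _).trans_lt hlt
  have h1 := (hT fun x => c⁻¹ * |(U : Ω →ₘ[μ] ℝ) x|).trans
    (add_le_add le_rfl (LPhi.lintegral_exp_abs_le hlt))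
  have h2 : q.modular (fun x => θ * c⁻¹ * (U : Ω →ₘ[μ] ℝ) x) ≤ ENNReal.ofReal (C + 4) := by
    refine (q.modular_le_lintegral_exp_abs _).trans ?_
    rw [ENNReal.ofReal_add hC (by norm_num), ENNReal.ofReal_ofNat]
    simpa only [abs_mul, abs_of_pos hθ, abs_of_pos (inv_pos.2 hc0), mul_assoc] using h1
  have h3 := q.modular_smul_le (U := fun x => θ * c⁻¹ * (U : Ω →ₘ[μ] ℝ) x)
    ((U : Ω →ₘ[μ] ℝ).aestronglyMeasurable.aemeasurable.const_mul _)
    (a := (C + 4)⁻¹) (by positivity) (inv_le_one_of_one_le₀ (by linarith))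
  have h4 : ‖V‖ ≤ c * (C + 4) / θ := by
    refine LPhi.norm_le_of_modular_le_one (by positivity) ?_
    have h5 : (c * (C + 4) / θ)⁻¹ = (C + 4)⁻¹ * (θ * c⁻¹) := by
      field_simp
    rw [h5, hUV]
    simp only [mul_assoc] at h2 h3 ⊢
    refine h3.trans ((mul_le_mul_right h2 _).trans ?_)
    rw [← ENNReal.ofReal_mul (by positivity), inv_mul_cancel₀ (by positivity), ENNReal.ofReal_one]
  refine h4.trans (le_of_eq ?_)
  rw [hc]
  field_simp

/-- The inclusion of `L^Φ(p)` into `L^Φ(q)`, for `log (q / p) ∈ L^Φ(q)`. -/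
def LPhi.inclusion {p q : PosDensity μ} (h : logRatio p q ∈ LPhi q) : LPhi p →L[ℝ] LPhi q :=
  LinearMap.mkContinuousOfExistsBound (Submodule.inclusion (LPhi.le_of_logRatio_mem h))
    ((LPhi.exists_norm_inclusion_le h).imp fun _ hM U => hM U _ (Submodule.coe_inclusion _ U))

@[simp]
theorem LPhi.coe_inclusion {p q : PosDensity μ} (h : logRatio p q ∈ LPhi q) (U : LPhi p) :
    (LPhi.inclusion h U : Ω →ₘ[μ] ℝ) = U := by
  rw [LPhi.inclusion, LinearMap.mkContinuousOfExistsBound_apply, Submodule.coe_inclusion]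

theorem LPhi.coe_const (p : PosDensity μ) (c : ℝ) :
    ((LPhi.const p c : LPhi p) : Ω →ₘ[μ] ℝ) = AEEqFun.const Ω c := rfl

theorem LPhi.smul_const_one (p : PosDensity μ) (c : ℝ) : c • LPhi.const p 1 = LPhi.const p c := by
  refine Subtype.ext (AEEqFun.ext ?_)
  filter_upwards [AEEqFun.coeFn_smul c (LPhi.const p 1 : Ω →ₘ[μ] ℝ),
    AEEqFun.coeFn_const (μ := μ) Ω c, AEEqFun.coeFn_const (μ := μ) Ω (1 : ℝ)] with x h1 h2 h3
  rw [Submodule.coe_smul, h1, Pi.smul_apply, LPhi.coe_const, LPhi.coe_const, h2, h3]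
  simp

theorem LPhi.abs_expect_le {p : PosDensity μ} (U : LPhi p) :
    |p.expect (U : Ω →ₘ[μ] ℝ)| ≤ 2 * ‖U‖ :=
  (abs_integral_le_integral_abs).trans (LPhi.integral_abs_le U)

/-- The expectation `E_p` as a continuous linear functional. -/
def LPhi.expectL (p : PosDensity μ) : LPhi p →L[ℝ] ℝ :=
  LinearMap.mkContinuous
    { toFun := fun U => p.expect (U : Ω →ₘ[μ] ℝ)
      map_add' := LPhi.expect_add p
      map_smul' := LPhi.expect_smul p } 2 LPhi.abs_expect_le

/-- The centering as a continuous linear map. -/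
def LPhi.centerL (p : PosDensity μ) : LPhi p →L[ℝ] BSpace p :=
  (ContinuousLinearMap.id ℝ (LPhi p) -
    (LPhi.expectL p).smulRight (LPhi.const p 1)).codRestrict (BSpace p) fun U => by
      have h := (LPhi.center p U).2
      simp only [sub_apply, ContinuousLinearMap.smulRight_apply,
        LPhi.smul_const_one]
      exact h

theorem LPhi.centerL_apply (p : PosDensity μ) (U : LPhi p) :
    LPhi.centerL p U = LPhi.center p U := by
  refine Subtype.ext ?_
  change U - (p.expect (U : Ω →ₘ[μ] ℝ)) • LPhi.const p 1 = _
  rw [LPhi.smul_const_one]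
  rfl

theorem LPhi.centerL_const (p : PosDensity μ) (c : ℝ) : LPhi.centerL p (LPhi.const p c) = 0 := by
  refine Subtype.ext ?_
  change LPhi.const p c - (p.expect (LPhi.const p c : Ω →ₘ[μ] ℝ)) • LPhi.const p 1 = 0
  rw [LPhi.smul_const_one, LPhi.expect_const, sub_self]

theorem LPhi.fn_centerL (p : PosDensity μ) (U : LPhi p) :
    BSpace.fn (LPhi.centerL p U) =ᵐ[μ]
      fun x => (U : Ω →ₘ[μ] ℝ) x - p.expect (U : Ω →ₘ[μ] ℝ) := by
  rw [LPhi.centerL_apply]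
  filter_upwards [AEEqFun.coeFn_sub (U : Ω →ₘ[μ] ℝ)
    (AEEqFun.const Ω (p.expect (U : Ω →ₘ[μ] ℝ))),
    AEEqFun.coeFn_const (μ := μ) Ω (p.expect (U : Ω →ₘ[μ] ℝ))] with x h1 h2
  exact h1.trans (by rw [Pi.sub_apply, h2]; rfl)

/-- The change of the model space `B_p → B_q`, `U ↦ U - E_q[U]`. -/
def BSpace.transport {p q : PosDensity μ} (h : logRatio p q ∈ LPhi q) : BSpace p →L[ℝ] BSpace q :=
  (LPhi.centerL q).comp ((LPhi.inclusion h).comp (BSpace p).subtypeL)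

theorem BSpace.transport_apply {p q : PosDensity μ} (h : logRatio p q ∈ LPhi q) (U : BSpace p) :
    BSpace.transport h U = LPhi.centerL q (LPhi.inclusion h (U : LPhi p)) := rfl

theorem LPhi.inclusion_const {p q : PosDensity μ} (h : logRatio p q ∈ LPhi q) (c : ℝ) :
    LPhi.inclusion h (LPhi.const p c) = LPhi.const q c :=
  Subtype.ext (by rw [LPhi.coe_inclusion, LPhi.coe_const, LPhi.coe_const])

theorem LPhi.coe_centerL (p : PosDensity μ) (U : LPhi p) :
    ((LPhi.centerL p U : BSpace p) : LPhi p) =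
      U - LPhi.const p (p.expect (U : Ω →ₘ[μ] ℝ)) := by
  rw [LPhi.centerL_apply]; rfl

theorem BSpace.transport_centerL {p q : PosDensity μ} (h : logRatio p q ∈ LPhi q) (U : LPhi p) :
    BSpace.transport h (LPhi.centerL p U) = LPhi.centerL q (LPhi.inclusion h U) := by
  rw [BSpace.transport_apply, LPhi.coe_centerL, map_sub, map_sub, LPhi.inclusion_const,
    LPhi.centerL_const, sub_zero]

theorem BSpace.fn_transport {p q : PosDensity μ} (h : logRatio p q ∈ LPhi q) (U : BSpace p) :
    BSpace.fn (BSpace.transport h U) =ᵐ[μ] fun x => BSpace.fn U x - q.expect (BSpace.fn U) := by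
  have h1 := LPhi.fn_centerL q (LPhi.inclusion h (U : LPhi p))
  rw [LPhi.coe_inclusion] at h1
  exact h1

/-- `p` and `q` are connected by an open exponential arc. -/
def ExpConnected (p q : PosDensity μ) : Prop := logRatio p q ∈ LPhi p ∧ logRatio p q ∈ LPhi q

theorem ExpConnected.refl (p : PosDensity μ) : ExpConnected p p := by
  rw [ExpConnected, logRatio_self]
  exact ⟨zero_mem _, zero_mem _⟩

theorem ExpConnected.symm {p q : PosDensity μ} (h : ExpConnected p q) : ExpConnected q p := by
  rw [ExpConnected, ← neg_logRatio]
  exact ⟨neg_mem h.2, neg_mem h.1⟩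

theorem ExpConnected.LPhi_eq {p q : PosDensity μ} (h : ExpConnected p q) : LPhi p = LPhi q :=
  le_antisymm (LPhi.le_of_logRatio_mem h.2) (LPhi.le_of_logRatio_mem h.symm.2)

theorem ExpConnected.trans {p q s : PosDensity μ} (h : ExpConnected p q) (h' : ExpConnected q s) :
    ExpConnected p s := by
  rw [ExpConnected, ← logRatio_add p q s]
  refine ⟨add_mem h.1 (h.LPhi_eq ▸ h'.1), add_mem ?_ h'.2⟩
  rw [← h'.LPhi_eq]
  exact h.2

theorem expChart_eq {p q : PosDensity μ} (h : logRatio p q ∈ LPhi p) :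
    expChart p q = LPhi.centerL p ⟨logRatio p q, h⟩ := by
  rw [expChart, dif_pos h, LPhi.centerL_apply]

theorem expChart_self (p : PosDensity μ) : expChart p p = 0 := by
  have h : logRatio p p ∈ LPhi p := by rw [logRatio_self]; exact zero_mem _
  rw [expChart_eq h, show (⟨logRatio p p, h⟩ : LPhi p) = 0 from Subtype.ext (logRatio_self p),
    map_zero]

/-- This holds because log(s/q) = log(s/p) − log(q/p), while centering at q erases the constants
introduced by centering at p. Charts thus differ by a continuous affine map. -/
theorem expChart_transport {p q s : PosDensity μ} (h : ExpConnected p q) (h' : ExpConnected p s) :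
    expChart q s = BSpace.transport h.2 (expChart p s) - BSpace.transport h.2 (expChart p q) := by
  have hqs := h.symm.trans h'
  rw [expChart_eq hqs.1, expChart_eq h.1, expChart_eq h'.1, BSpace.transport_centerL,
    BSpace.transport_centerL, ← map_sub]
  congr 1
  refine Subtype.ext ?_
  rw [Submodule.coe_sub, LPhi.coe_inclusion, LPhi.coe_inclusion]
  change logRatio q s = logRatio p s - logRatio p q
  rw [← logRatio_add p q s, add_sub_cancel_left]

end Connection

/-! ### Maximal exponential families as classes of `ExpConnected`; from chart velocity to L¹
derivative. -/

section MaximalFamily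

variable {Ω : Type*} [MeasurableSpace Ω] {μ : Measure Ω}

theorem BSpace.fn_eq_coe {p : PosDensity μ} (U : BSpace p) :
    BSpace.fn U = ((U : LPhi p) : Ω →ₘ[μ] ℝ) := rfl

theorem BSpace.aemeasurable_fn {p : PosDensity μ} (U : BSpace p) : AEMeasurable (BSpace.fn U) μ :=
  ((U : LPhi p) : Ω →ₘ[μ] ℝ).aestronglyMeasurable.aemeasurable

theorem BSpace.fn_sub {p : PosDensity μ} (U V : BSpace p) :
    BSpace.fn (U - V) =ᵐ[μ] fun x => BSpace.fn U x - BSpace.fn V x :=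
  AEEqFun.coeFn_sub ((U : LPhi p) : Ω →ₘ[μ] ℝ) ((V : LPhi p) : Ω →ₘ[μ] ℝ)

theorem BSpace.fn_smul {p : PosDensity μ} (c : ℝ) (U : BSpace p) :
    BSpace.fn (c • U) =ᵐ[μ] fun x => c * BSpace.fn U x :=
  AEEqFun.coeFn_smul c ((U : LPhi p) : Ω →ₘ[μ] ℝ)

theorem BSpace.integrable_fn {p : PosDensity μ} (U : BSpace p) : Integrable (BSpace.fn U) p.prob :=
  LPhi.integrable p U

theorem BSpace.ext_ae {p : PosDensity μ} {U V : BSpace p} (h : BSpace.fn U =ᵐ[μ] BSpace.fn V) :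
    U = V :=
  Subtype.ext (Subtype.ext (AEEqFun.ext h))

theorem PosDensity.integrable_of_lintegral_exp {q : PosDensity μ} {U : Ω → ℝ}
    (hU : AEMeasurable U μ) (h : ∫⁻ x, ENNReal.ofReal (Real.exp |U x|) ∂q.prob < ∞) :
    Integrable (fun x => Real.exp (U x)) q.prob := by
  refine ⟨(Real.measurable_exp.comp_aemeasurable
    (hU.mono_ac q.prob_absolutelyContinuous)).aestronglyMeasurable, ?_⟩
  rw [hasFiniteIntegral_iff_ofReal (Eventually.of_forall fun x => (Real.exp_pos _).le)]
  refine (lintegral_mono fun x => ENNReal.ofReal_le_ofReal ?_).trans_lt h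
  exact Real.exp_le_exp.2 (le_abs_self _)

theorem fn_expChart {p q : PosDensity μ} (h : logRatio p q ∈ LPhi p) :
    BSpace.fn (expChart p q) =ᵐ[μ] fun x => logRatio p q x - p.expect (logRatio p q) := by
  rw [expChart_eq h]
  exact LPhi.fn_centerL p _

theorem cgf_expChart {p q : PosDensity μ} (h : logRatio p q ∈ LPhi p) :
    Integrable (fun x => Real.exp (BSpace.fn (expChart p q) x)) p.prob ∧
      p.expect (fun x => Real.exp (BSpace.fn (expChart p q) x)) =
        Real.exp (-p.expect (logRatio p q)) := by
  have hae : (fun x => p.toFun x * Real.exp (BSpace.fn (expChart p q) x)) =ᵐ[μ]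
      fun x => Real.exp (-p.expect (logRatio p q)) * q.toFun x := by
    filter_upwards [fn_expChart h, exp_logRatio p q] with x hx hx2
    rw [hx, hx2, sub_eq_add_neg, Real.exp_add]
    ring
  constructor
  · rw [p.integrable_prob_iff, integrable_congr hae]
    exact q.integrable.const_mul _
  · rw [PosDensity.expect, p.integral_prob, integral_congr_ae hae, integral_const_mul,
      q.integral_eq_one, mul_one]

theorem toFun_eq_of_logRatio_mem {p q : PosDensity μ} (h : logRatio p q ∈ LPhi p) :
    ∀ᵐ x ∂μ, q.toFun x =
      Real.exp (BSpace.fn (expChart p q) x - cgf p (expChart p q)) * p.toFun x := by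
  filter_upwards [fn_expChart h, exp_logRatio p q] with x hx hx2
  rw [hx, hx2, cgf, (cgf_expChart h).2, Real.log_exp]
  ring_nf

theorem ExpConnected.eq_of_expChart_eq {p q q' : PosDensity μ} (h : ExpConnected p q)
    (h' : ExpConnected p q') (heq : expChart p q = expChart p q') : q = q' := by
  refine PosDensity.ext_ae ?_
  filter_upwards [toFun_eq_of_logRatio_mem h.1, toFun_eq_of_logRatio_mem h'.1] with x h1 h2
  rw [h1, h2, heq]

/-- For v near u = s_p(q), exp(v)p is a constant times exp(v − u)q, and the transfer estimate from p
to q makes exp|v − u| integrable under q once ‖v − u‖ < θ. So u has a ball of radius θ inside the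
domain. -/
theorem ExpConnected.mem_maxExp {p q : PosDensity μ} (h : ExpConnected p q) : q ∈ maxExp p := by
  refine ⟨expChart p q, ?_, toFun_eq_of_logRatio_mem h.1⟩
  obtain ⟨θ, hθ, C, hC, hT⟩ := LPhi.exists_lintegral_exp_le h.2
  rw [expDomain, mem_interior_iff_mem_nhds, Metric.mem_nhds_iff]
  refine ⟨θ, hθ, fun v hv => ?_⟩
  rw [Metric.mem_ball, dist_eq_norm] at hv
  have h1 := (hT fun x => θ⁻¹ * |BSpace.fn (v - expChart p q) x|).trans
    (add_le_add le_rfl (LPhi.lintegral_exp_abs_le (U := ((v - expChart p q : BSpace p) : LPhi p)) hv))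
  simp only [mul_inv_cancel_left₀ hθ.ne'] at h1
  have h2 := PosDensity.integrable_of_lintegral_exp (BSpace.aemeasurable_fn (v - expChart p q))
    (h1.trans_lt (ENNReal.add_lt_top.2 ⟨ENNReal.ofReal_lt_top, by simp⟩))
  change Integrable _ _
  rw [q.integrable_prob_iff] at h2
  rw [p.integrable_prob_iff]
  refine (h2.const_mul (Real.exp (cgf p (expChart p q)))).congr ?_
  filter_upwards [toFun_eq_of_logRatio_mem h.1, BSpace.fn_sub v (expChart p q)] with x hx hx2
  rw [hx, hx2]
  calc _ = p.toFun x * (Real.exp (cgf p (expChart p q)) *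
        Real.exp (BSpace.fn (expChart p q) x - cgf p (expChart p q)) *
          Real.exp (BSpace.fn v x - BSpace.fn (expChart p q) x)) := by ring
    _ = _ := by
      rw [← Real.exp_add, ← Real.exp_add]
      congr 2
      ring

/-- Interiority of u leaves room for (1 + r)u with some r > 0, and E_q[exp(r ℓ)] = E_p[exp((1 +
r)ℓ)] for ℓ = log(q/p) handles ℓ ≥ 0. Where ℓ ≤ 0 one has q ≤ p, and integrability under p suffices.
-/
theorem expConnected_of_mem_maxExp {p q : PosDensity μ} (h : q ∈ maxExp p) : ExpConnected p q := by
  have := p.isProbabilityMeasure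
  obtain ⟨u, hu, hq⟩ := h
  have hℓ : ⇑(logRatio p q) =ᵐ[μ] fun x => BSpace.fn u x - cgf p u := by
    filter_upwards [coeFn_logRatio p q, hq, p.pos] with x h1 h2 h3
    rw [h1, h2, Real.log_mul (Real.exp_pos _).ne' h3.ne', Real.log_exp, add_sub_cancel_right]
  have hmem : logRatio p q ∈ LPhi p := by
    have h1 : logRatio p q = ((u : LPhi p) - LPhi.const p (cgf p u) : LPhi p) := by
      refine AEEqFun.ext ?_
      filter_upwards [hℓ, AEEqFun.coeFn_sub ((u : LPhi p) : Ω →ₘ[μ] ℝ) (AEEqFun.const Ω (cgf p u)),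
        AEEqFun.coeFn_const (μ := μ) Ω (cgf p u)] with x h2 h3 h4
      rw [h2, Submodule.coe_sub, LPhi.coe_const, h3, Pi.sub_apply, h4]
      rfl
    rw [h1]
    exact Subtype.mem _
  refine ⟨hmem, ?_⟩
  obtain ⟨r₀, hr₀, hfin⟩ := (p.mem_LPhi_iff _).1 hmem
  have hcont : Tendsto (fun r : ℝ => (1 + r) • u) (𝓝[>] 0) (𝓝 u) := by
    have : Continuous (fun r : ℝ => (1 + r) • u) := by fun_prop
    have h2 := this.tendsto 0
    rw [add_zero, one_smul] at h2
    exact h2.mono_left nhdsWithin_le_nhds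
  have hev : ∀ᶠ r : ℝ in 𝓝[>] 0, (1 + r) • u ∈ mgfFinite p ∧ r ≤ r₀ ∧ 0 < r :=
    (hcont.eventually (mem_interior_iff_mem_nhds.1 hu)).and
      ((eventually_nhdsWithin_of_eventually_nhds (eventually_le_nhds hr₀)).and
        self_mem_nhdsWithin)
  obtain ⟨r, hr1, hr2, hr⟩ := hev.exists
  refine (q.mem_LPhi_iff _).2 ⟨r, hr, ?_⟩
  have hI : Integrable (fun x => Real.exp ((1 + r) * BSpace.fn u x)) p.prob := by
    refine Integrable.congr hr1 ?_
    filter_upwards [p.prob_absolutelyContinuous.ae_le (BSpace.fn_smul (1 + r) u)] with x hx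
    rw [hx]
  have hI2 := (hI.const_mul (Real.exp (-((1 + r) * cgf p u)))).lintegral_lt_top
  calc ∫⁻ x, ENNReal.ofReal (Real.exp (r * |logRatio p q x|)) ∂q.prob
      ≤ ∫⁻ x, (ENNReal.ofReal (Real.exp (-((1 + r) * cgf p u)) *
          Real.exp ((1 + r) * BSpace.fn u x)) +
          ENNReal.ofReal (Real.exp (r₀ * |logRatio p q x|))) ∂p.prob := by
        rw [q.lintegral_prob, p.lintegral_prob]
        refine lintegral_mono_ae ?_
        filter_upwards [hℓ, exp_logRatio p q, p.pos, q.pos] with x h1 h2 hp hq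
        rw [← ENNReal.ofReal_add (by positivity) (by positivity), ← ENNReal.ofReal_mul hp.le,
          ← ENNReal.ofReal_mul hq.le]
        refine ENNReal.ofReal_le_ofReal ?_
        rw [h2, mul_assoc]
        refine mul_le_mul_of_nonneg_left ?_ hp.le
        have h3 : Real.exp (-((1 + r) * cgf p u)) * Real.exp ((1 + r) * BSpace.fn u x) =
            Real.exp ((1 + r) * logRatio p q x) := by
          rw [← Real.exp_add, h1]
          congr 1
          ring
        rw [h3, ← Real.exp_add]
        rcases le_total 0 (logRatio p q x) with h0 | h0
        · rw [abs_of_nonneg h0, show logRatio p q x + r * logRatio p q x =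
            (1 + r) * logRatio p q x by ring]
          linarith [Real.exp_pos (r₀ * logRatio p q x)]
        · have : Real.exp (logRatio p q x + r * |logRatio p q x|) ≤
              Real.exp (r₀ * |logRatio p q x|) := by
            refine Real.exp_le_exp.2 ?_
            nlinarith [abs_nonneg (logRatio p q x)]
          linarith [Real.exp_pos ((1 + r) * logRatio p q x)]
    _ < ∞ := by
        have hm : AEMeasurable (fun x => ENNReal.ofReal (Real.exp (r₀ * |logRatio p q x|)))
            p.prob := (Real.measurable_exp.comp_aemeasurable
          ((continuous_abs.measurable.comp_aemeasurable
            (p.aemeasurable_prob _)).const_mul r₀)).ennreal_ofReal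
        rw [lintegral_add_right' _ hm]
        exact ENNReal.add_lt_top.2 ⟨hI2, hfin⟩

theorem mem_maxExp_iff {p q : PosDensity μ} : q ∈ maxExp p ↔ ExpConnected p q :=
  ⟨expConnected_of_mem_maxExp, ExpConnected.mem_maxExp⟩

theorem expConnected_of_mem {r p q : PosDensity μ} (hp : p ∈ maxExp r) (hq : q ∈ maxExp r) :
    ExpConnected p q :=
  (mem_maxExp_iff.1 hp).symm.trans (mem_maxExp_iff.1 hq)

theorem mem_maxExp_of_expConnected {r p q : PosDensity μ} (hp : p ∈ maxExp r)
    (h : ExpConnected p q) : q ∈ maxExp r :=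
  mem_maxExp_iff.2 ((mem_maxExp_iff.1 hp).trans h)

theorem LPhi.modular_le_norm_sq {p : PosDensity μ} {U : LPhi p} (h : ‖U‖ < 1) :
    p.modular (fun x => (U : Ω →ₘ[μ] ℝ) x) ≤ ENNReal.ofReal (‖U‖ ^ 2) := by
  have hcont : Tendsto (fun c : ℝ => ENNReal.ofReal (c ^ 2)) (𝓝[>] ‖U‖)
      (𝓝 (ENNReal.ofReal (‖U‖ ^ 2))) :=
    (ENNReal.continuous_ofReal.comp (continuous_pow 2)).continuousWithinAt
  refine ge_of_tendsto hcont ?_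
  filter_upwards [self_mem_nhdsWithin,
    eventually_nhdsWithin_of_eventually_nhds (eventually_le_nhds h)] with c hc hc1
  exact LPhi.modular_le_sq hc hc1

theorem LPhi.integrable_cosh {p : PosDensity μ} {U : LPhi p} (h : ‖U‖ < 1) :
    Integrable (fun x => Real.cosh ((U : Ω →ₘ[μ] ℝ) x) - 1) p.prob := by
  refine ⟨((Real.measurable_cosh.comp_aemeasurable
    (p.aemeasurable_prob _)).sub_const 1).aestronglyMeasurable, ?_⟩
  rw [hasFiniteIntegral_iff_ofReal (Eventually.of_forall fun x => by simp)]
  exact (LPhi.modular_le_norm_sq h).trans_lt ENNReal.ofReal_lt_top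

theorem LPhi.integral_cosh_le {p : PosDensity μ} {U : LPhi p} (h : ‖U‖ < 1) :
    ∫ x, (Real.cosh ((U : Ω →ₘ[μ] ℝ) x) - 1) ∂p.prob ≤ ‖U‖ ^ 2 := by
  rw [integral_eq_lintegral_of_nonneg_ae (Eventually.of_forall fun x => by simp)
    (LPhi.integrable_cosh h).aestronglyMeasurable]
  exact ENNReal.toReal_le_of_le_ofReal (by positivity) (LPhi.modular_le_norm_sq h)

/-- The quantitative link between chart and L¹. When u = s_p(q) depends on τ with u − τV = o(τ),
each of the three terms on the right is o(τ). -/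
theorem integral_abs_sub_sub_le {p q : PosDensity μ} (h : logRatio p q ∈ LPhi p)
    (hu : ‖expChart p q‖ < 1) (V : BSpace p) (τ : ℝ) :
    ∫ x, |q.toFun x - p.toFun x - τ * (p.toFun x * BSpace.fn V x)| ∂μ ≤
      4 * ‖expChart p q‖ ^ 2 + 2 * ‖expChart p q - τ • V‖ +
        4 * ‖expChart p q‖ ^ 2 * (|τ| * ‖V‖) := by
  have := p.isProbabilityMeasure
  set u := expChart p q with hu_def
  have hcosh : Integrable (fun x => Real.cosh (BSpace.fn u x) - 1) p.prob := LPhi.integrable_cosh hu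
  have hcosh_le : ∫ x, (Real.cosh (BSpace.fn u x) - 1) ∂p.prob ≤ ‖u‖ ^ 2 := LPhi.integral_cosh_le hu
  have hexp : Integrable (fun x => Real.exp (BSpace.fn u x)) p.prob := (cgf_expChart h).1
  have hexp1 : Integrable (fun x => Real.exp (BSpace.fn u x) - 1) p.prob :=
    hexp.sub (integrable_const 1)
  -- Since E_p[u] = 0, the normalizing constant E_p[exp u] equals 1 + κ, and κ is of second order in
  -- u.
  set κ : ℝ := ∫ x, (Real.exp (BSpace.fn u x) - 1 - BSpace.fn u x) ∂p.prob with hκ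
  have hκ0 : 0 ≤ κ := integral_nonneg fun x => by
    simp only [Pi.zero_apply]
    linarith [Real.add_one_le_exp (BSpace.fn u x)]
  have hκ1 : κ ≤ 2 * ‖u‖ ^ 2 := by
    refine (integral_mono (hexp1.sub (BSpace.integrable_fn u))
      (hcosh.const_mul 2) fun x => (le_abs_self _).trans (abs_exp_sub_one_sub_le _)).trans ?_
    rw [integral_const_mul]
    linarith
  have hmgf : p.expect (fun x => Real.exp (BSpace.fn u x)) = 1 + κ := by
    have h0 : ∫ x, BSpace.fn u x ∂p.prob = 0 := u.2
    rw [hκ, integral_sub hexp1 (BSpace.integrable_fn u),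
      integral_sub hexp (integrable_const 1), h0, PosDensity.expect]
    simp
  have hV : Integrable (fun x => |BSpace.fn V x|) p.prob := (BSpace.integrable_fn V).abs
  have hW : Integrable (fun x => |BSpace.fn (u - τ • V) x|) p.prob :=
    (BSpace.integrable_fn (u - τ • V)).abs
  have hbound : ∀ᵐ x ∂μ, |q.toFun x - p.toFun x - τ * (p.toFun x * BSpace.fn V x)| ≤
      p.toFun x * (2 * (Real.cosh (BSpace.fn u x) - 1) + |BSpace.fn (u - τ • V) x| +
        κ * (1 + |τ| * |BSpace.fn V x|)) := by
    filter_upwards [toFun_eq_of_logRatio_mem h, p.pos, BSpace.fn_sub u (τ • V),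
      BSpace.fn_smul τ V] with x h1 hp h2 h3
    have h1κ : 0 < 1 + κ := by linarith
    rw [← hu_def, cgf, hmgf, Real.exp_sub, Real.exp_log h1κ] at h1
    have h4 : q.toFun x - p.toFun x - τ * (p.toFun x * BSpace.fn V x) = p.toFun x *
        (((Real.exp (BSpace.fn u x) - 1 - BSpace.fn u x) + (BSpace.fn u x - τ * BSpace.fn V x) -
          κ * (1 + τ * BSpace.fn V x)) / (1 + κ)) := by
      rw [h1]
      field_simp
      ring
    rw [h4, abs_mul, abs_of_pos hp, abs_div, abs_of_pos h1κ]
    refine mul_le_mul_of_nonneg_left ?_ hp.le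
    refine (div_le_self (abs_nonneg _) (by linarith)).trans ?_
    rw [h2, h3]
    have h5 : |κ * (1 + τ * BSpace.fn V x)| ≤ κ * (1 + |τ| * |BSpace.fn V x|) := by
      rw [abs_mul, abs_of_nonneg hκ0]
      refine mul_le_mul_of_nonneg_left ((abs_add_le _ _).trans ?_) hκ0
      rw [abs_one, abs_mul]
    refine (abs_sub _ _).trans (add_le_add ((abs_add_le _ _).trans
      (add_le_add (abs_exp_sub_one_sub_le _) le_rfl)) h5)
  have hint : Integrable (fun x => 2 * (Real.cosh (BSpace.fn u x) - 1) +
      |BSpace.fn (u - τ • V) x| + κ * (1 + |τ| * |BSpace.fn V x|)) p.prob :=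
    ((hcosh.const_mul 2).add hW).add (((integrable_const 1).add (hV.const_mul _)).const_mul κ)
  calc _ ≤ ∫ x, p.toFun x * (2 * (Real.cosh (BSpace.fn u x) - 1) + |BSpace.fn (u - τ • V) x| +
        κ * (1 + |τ| * |BSpace.fn V x|)) ∂μ :=
        integral_mono_of_nonneg (Eventually.of_forall fun x => abs_nonneg _)
          ((p.integrable_prob_iff _).1 hint) hbound
    _ = 2 * ∫ x, (Real.cosh (BSpace.fn u x) - 1) ∂p.prob +
          ∫ x, |BSpace.fn (u - τ • V) x| ∂p.prob +
            κ * (1 + |τ| * ∫ x, |BSpace.fn V x| ∂p.prob) := by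
        have hi1 : Integrable (fun x => 2 * (Real.cosh (BSpace.fn u x) - 1) +
            |BSpace.fn (u - τ • V) x|) p.prob := (hcosh.const_mul 2).add hW
        have hi2 : Integrable (fun x => κ * (1 + |τ| * |BSpace.fn V x|)) p.prob :=
          ((integrable_const 1).add (hV.const_mul _)).const_mul κ
        rw [← p.integral_prob, integral_add hi1 hi2, integral_add (hcosh.const_mul 2) hW, integral_const_mul, integral_const_mul,
          integral_add (integrable_const 1) (hV.const_mul _), integral_const_mul]
        simp
    _ ≤ 2 * ‖u‖ ^ 2 + 2 * ‖u - τ • V‖ + 2 * ‖u‖ ^ 2 * (1 + |τ| * (2 * ‖V‖)) := by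
        gcongr
        · exact LPhi.integral_abs_le ((u - τ • V : BSpace p) : LPhi p)
        · exact LPhi.integral_abs_le (V : LPhi p)
    _ = _ := by ring

/-- The curve of densities `c` is differentiable in `L¹` with derivative `D`. -/
def HasL1DerivWithinAt (c : ℝ → PosDensity μ) (D : Ω → ℝ) (I : Set ℝ) (t : ℝ) : Prop :=
  Integrable D μ ∧
    (fun s => ∫ x, |(c s).toFun x - (c t).toFun x - (s - t) * D x| ∂μ) =o[𝓝[I] t] fun s => s - t

theorem HasL1DerivWithinAt.congr_ae {c : ℝ → PosDensity μ} {D D' : Ω → ℝ} {I : Set ℝ} {t : ℝ}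
    (h : HasL1DerivWithinAt c D I t) (hD : D =ᵐ[μ] D') : HasL1DerivWithinAt c D' I t := by
  refine ⟨h.1.congr hD, h.2.congr_left fun s => integral_congr_ae ?_⟩
  filter_upwards [hD] with x hx
  rw [hx]

theorem HasL1DerivWithinAt.mono {c : ℝ → PosDensity μ} {D : Ω → ℝ} {I J : Set ℝ} {t : ℝ}
    (h : HasL1DerivWithinAt c D I t) (hJ : J ⊆ I) : HasL1DerivWithinAt c D J t :=
  ⟨h.1, h.2.mono (nhdsWithin_mono t hJ)⟩

theorem hasL1DerivWithinAt_of_expChart {c : ℝ → PosDensity μ} {I : Set ℝ} {t : ℝ}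
    {V : BSpace (c t)} (hc : ∀ᶠ s in 𝓝[I] t, ExpConnected (c t) (c s))
    (h : HasDerivWithinAt (fun s => expChart (c t) (c s)) V I t) :
    HasL1DerivWithinAt c (fun x => (c t).toFun x * BSpace.fn V x) I t := by
  refine ⟨((c t).integrable_prob_iff _).1 (BSpace.integrable_fn V), ?_⟩
  have h1 := hasDerivWithinAt_iff_isLittleO.1 h
  have h2 : (fun s => expChart (c t) (c s)) =O[𝓝[I] t] fun s => s - t := by
    have := h.hasFDerivWithinAt.isBigO_sub
    simpa only [expChart_self, sub_zero] using this
  simp only [expChart_self, sub_zero] at h1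
  have hto : Tendsto (fun s : ℝ => s - t) (𝓝[I] t) (𝓝 0) := by
    have : Tendsto (fun s : ℝ => s - t) (𝓝 t) (𝓝 (t - t)) := by
      exact tendsto_id.sub_const t
    rw [sub_self] at this
    exact this.mono_left nhdsWithin_le_nhds
  have h0 : Tendsto (fun s => ‖expChart (c t) (c s)‖) (𝓝[I] t) (𝓝 0) :=
    (h2.trans_tendsto hto).norm.trans (by simp)
  have hsq : (fun s : ℝ => ‖expChart (c t) (c s)‖ ^ 2) =o[𝓝[I] t] fun s => s - t := by
    simp only [pow_two]
    have h3 : (fun s : ℝ => ‖expChart (c t) (c s)‖) =o[𝓝[I] t] fun _ => (1 : ℝ) :=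
      (Asymptotics.isLittleO_one_iff ℝ).2 h0
    simpa using h3.mul_isBigO h2.norm_left
  have hthird : (fun s : ℝ => 4 * ‖expChart (c t) (c s)‖ ^ 2 * (|s - t| * ‖V‖))
      =o[𝓝[I] t] fun s => s - t := by
    have h3 : (fun s : ℝ => |s - t| * ‖V‖) =O[𝓝[I] t] fun _ => (1 : ℝ) := by
      have := (hto.abs.mul_const ‖V‖).isBigO_one ℝ
      exact this
    simpa using (hsq.const_mul_left 4).mul_isBigO h3
  have hsum := ((hsq.const_mul_left 4).add (h1.norm_left.const_mul_left 2)).add hthird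
  refine Asymptotics.IsBigO.trans_isLittleO (Asymptotics.IsBigO.of_bound 1 ?_) hsum
  filter_upwards [hc, h0.eventually_lt_const one_pos] with s hs hs1
  rw [one_mul, Real.norm_of_nonneg (integral_nonneg fun x => abs_nonneg _)]
  exact (integral_abs_sub_sub_le hs.1 hs1 V (s - t)).trans (le_abs_self _)

end MaximalFamily

/-! ### Identification of derivatives, and Jensen's inequality for the modular. -/

section Curves

variable {Ω : Type*} [MeasurableSpace Ω] {μ : Measure Ω}

theorem HasDerivWithinAt.expChart_transport {p q : PosDensity μ} {c : ℝ → PosDensity μ} {I : Set ℝ}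
    {t : ℝ} {V : BSpace p} (h : HasDerivWithinAt (fun s => expChart p (c s)) V I t)
    (hpq : ExpConnected p q) (hc : ∀ᶠ s in 𝓝[I] t, ExpConnected p (c s))
    (ht : ExpConnected p (c t)) :
    HasDerivWithinAt (fun s => expChart q (c s)) (BSpace.transport hpq.2 V) I t := by
  have h1 := ((BSpace.transport hpq.2).hasFDerivAt.comp_hasDerivWithinAt t h).sub_const
    (BSpace.transport hpq.2 (expChart p q))
  refine h1.congr_of_eventuallyEq ?_ (_root_.expChart_transport hpq ht)
  filter_upwards [hc] with s hs
  exact _root_.expChart_transport hpq hs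

/-- The difference quotients minus D tend to 0 in L¹ and pointwise to D' − D, so Fatou's lemma gives
∫|D' − D| = 0. A sequence of times is extracted because `hg` leaves an exceptional null set at each
time, and only countably many can be discarded. -/
theorem HasL1DerivWithinAt.ae_eq_of_hasDerivWithinAt {c : ℝ → PosDensity μ} {D D' : Ω → ℝ}
    {I : Set ℝ} {t : ℝ} [(𝓝[I \ {t}] t).NeBot] (h : HasL1DerivWithinAt c D I t) (ht : t ∈ I)
    {g : ℝ → Ω → ℝ} (hg : ∀ s ∈ I, (c s).toFun =ᵐ[μ] g s)
    (hD' : ∀ x, HasDerivWithinAt (fun s => g s x) (D' x) I t) : D =ᵐ[μ] D' := by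
  obtain ⟨u, hu⟩ := exists_seq_tendsto (𝓝[I \ {t}] t)
  have hI : ∀ᶠ k in atTop, u k ∈ I \ {t} := hu.eventually self_mem_nhdsWithin
  obtain ⟨N, hN⟩ := eventually_atTop.1 hI
  have hu' : Tendsto u atTop (𝓝[I] t) := hu.mono_right (nhdsWithin_mono t sdiff_subset)
  have hlo := h.2.comp_tendsto hu'
  have hlim : Tendsto (fun k => (u k - t)⁻¹ *
      ∫ x, |(c (u k)).toFun x - (c t).toFun x - (u k - t) * D x| ∂μ) atTop (𝓝 0) := by
    have := hlo.tendsto_div_nhds_zero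
    simpa only [Function.comp_def, div_eq_inv_mul] using this
  have hlim2 := (ENNReal.continuous_ofReal.tendsto _).comp hlim.abs
  rw [abs_zero, ENNReal.ofReal_zero] at hlim2
  have hgN : ∀ᵐ x ∂μ, ∀ k, (c (u (k + N))).toFun x = g (u (k + N)) x :=
    ae_all_iff.2 fun k => hg _ (hN _ (Nat.le_add_left _ _)).1
  have hint : ∀ s, Integrable (fun x => (c s).toFun x - (c t).toFun x - (s - t) * D x) μ := fun s =>
    ((c s).integrable.sub (c t).integrable).sub (h.1.const_mul _)
  have hpt : ∀ᵐ x ∂μ, Tendsto (fun k => (u (k + N) - t)⁻¹ *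
      ((c (u (k + N))).toFun x - (c t).toFun x - (u (k + N) - t) * D x)) atTop
        (𝓝 (D' x - D x)) := by
    filter_upwards [hgN, hg t ht] with x hx hxt
    have h1 := (hasDerivWithinAt_iff_tendsto_slope.1 (hD' x)).comp hu
    have h2 := ((h1.comp (tendsto_add_atTop_nat N)).sub_const (D x))
    refine h2.congr fun k => ?_
    have hne : u (k + N) - t ≠ 0 := sub_ne_zero.2 (hN _ (Nat.le_add_left _ _)).2
    rw [Function.comp_apply, Function.comp_apply, slope_def_field, hx, hxt]
    field_simp
  have hzero : ∫⁻ x, ‖D' x - D x‖ₑ ∂μ = 0 := by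
    refine le_antisymm ?_ zero_le
    calc ∫⁻ x, ‖D' x - D x‖ₑ ∂μ = ∫⁻ x, liminf (fun k => ‖(u (k + N) - t)⁻¹ *
          ((c (u (k + N))).toFun x - (c t).toFun x - (u (k + N) - t) * D x)‖ₑ) atTop ∂μ := by
          refine lintegral_congr_ae ?_
          filter_upwards [hpt] with x hx
          exact hx.enorm.liminf_eq.symm
      _ ≤ liminf (fun k => ∫⁻ x, ‖(u (k + N) - t)⁻¹ *
          ((c (u (k + N))).toFun x - (c t).toFun x - (u (k + N) - t) * D x)‖ₑ ∂μ) atTop :=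
          lintegral_liminf_le' fun k => ((hint _).const_mul _).aestronglyMeasurable.enorm
      _ = 0 := by
          refine (Tendsto.liminf_eq ?_)
          refine (hlim2.comp (tendsto_add_atTop_nat N)).congr fun k => ?_
          rw [← ofReal_integral_norm_eq_lintegral_enorm ((hint _).const_mul _)]
          simp only [Function.comp_apply, norm_mul, Real.norm_eq_abs, integral_const_mul, abs_mul]
          rw [abs_of_nonneg (integral_nonneg fun x => abs_nonneg _)]
  have hm : AEMeasurable (fun x => D' x - D x) μ :=
    aemeasurable_of_tendsto_metrizable_ae atTop
      (fun k => ((hint (u (k + N))).const_mul (u (k + N) - t)⁻¹).aestronglyMeasurable.aemeasurable)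
      hpt
  rw [lintegral_eq_zero_iff' hm.enorm] at hzero
  filter_upwards [hzero] with x hx
  have : D' x - D x = 0 := enorm_eq_zero.1 hx
  linarith

/-- The norm bound gives E_p[exp(2|ℓ|)] ≤ 4 for ℓ = log(q/p), and one of the two exponents absorbs
the factor exp(ℓ) in q = p exp(ℓ). Smallness in L^Φ(p) alone therefore yields integrability under q.
-/
theorem expConnected_of_norm_logRatio_lt {p q : PosDensity μ} (h : logRatio p q ∈ LPhi p)
    (hn : ‖(⟨logRatio p q, h⟩ : LPhi p)‖ < 2⁻¹) : ExpConnected p q := by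
  refine ⟨h, (q.mem_LPhi_iff _).2 ⟨1, one_pos, ?_⟩⟩
  have h1 := LPhi.lintegral_exp_abs_le hn
  rw [inv_inv] at h1
  refine lt_of_le_of_lt ?_ (h1.trans_lt (by simp : (4 : ℝ≥0∞) < ∞))
  rw [q.lintegral_prob, p.lintegral_prob]
  refine lintegral_mono_ae ?_
  filter_upwards [exp_logRatio p q, p.pos, q.pos] with x hx hp hq
  rw [← ENNReal.ofReal_mul hq.le, ← ENNReal.ofReal_mul hp.le, hx, mul_assoc, ← Real.exp_add]
  refine ENNReal.ofReal_le_ofReal (mul_le_mul_of_nonneg_left (Real.exp_le_exp.2 ?_) hp.le)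
  linarith [le_abs_self (logRatio p q x)]

theorem PosDensity.modular_integral_le {T : Type*} [MeasurableSpace T] (ν : Measure T)
    [IsProbabilityMeasure ν] (p : PosDensity μ) {β : T → Ω → ℝ}
    (hβ : Measurable (Function.uncurry β)) (h : ∀ᵐ s ∂ν, p.modular (β s) ≤ 1) :
    p.modular (fun x => ∫ s, β s x ∂ν) ≤ 1 := by
  have := p.isProbabilityMeasure
  have hm : Measurable (Function.uncurry fun (x : Ω) (s : T) =>
      ENNReal.ofReal (Real.cosh (β s x) - 1)) := by
    have h1 : Measurable fun z : Ω × T => β z.2 z.1 := hβ.comp measurable_swap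
    exact ((Real.measurable_cosh.comp h1).sub_const 1).ennreal_ofReal
  calc p.modular (fun x => ∫ s, β s x ∂ν)
      ≤ ∫⁻ x, ∫⁻ s, ENNReal.ofReal (Real.cosh (β s x) - 1) ∂ν ∂p.prob := by
        refine lintegral_mono fun x => ?_
        -- An infinite inner integral makes the bound trivial. A finite one makes s ↦ `β s x`
        -- integrable, since |y| ≤ cosh y, and Jensen's inequality applies.
        by_cases hfin : ∫⁻ s, ENNReal.ofReal (Real.cosh (β s x) - 1) ∂ν = ∞
        · simp only [hfin, le_top]
        have hβx : Measurable fun s => β s x := hβ.comp measurable_prodMk_right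
        have hi : Integrable (fun s => Real.cosh (β s x) - 1) ν := by
          refine ⟨((Real.measurable_cosh.comp hβx).sub_const 1).aestronglyMeasurable, ?_⟩
          rw [hasFiniteIntegral_iff_ofReal (Eventually.of_forall fun s => by simp)]
          exact lt_top_iff_ne_top.2 hfin
        have hi2 : Integrable (fun s => β s x) ν := by
          refine (hi.add (integrable_const 1)).mono' hβx.aestronglyMeasurable
            (Eventually.of_forall fun s => ?_)
          simp only [Pi.add_apply, sub_add_cancel]
          exact abs_le_cosh _
        have hconv : ConvexOn ℝ univ fun y : ℝ => Real.cosh y - 1 :=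
          ⟨convex_univ, fun y _ z _ a b ha hb hab => by
            simpa only [smul_eq_mul] using cosh_convex_aux ha hb hab⟩
        have hJ := hconv.map_integral_le (μ := ν) (f := fun s => β s x)
          (by fun_prop) isClosed_univ (Eventually.of_forall fun _ => mem_univ _) hi2 hi
        rw [← ofReal_integral_eq_lintegral_ofReal hi (Eventually.of_forall fun s => by simp)]
        exact ENNReal.ofReal_le_ofReal hJ
    _ = ∫⁻ s, p.modular (β s) ∂ν := lintegral_lintegral_swap hm.aemeasurable
    _ ≤ ∫⁻ _, 1 ∂ν := lintegral_mono_ae h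
    _ = 1 := by simp

/-- Jensen's inequality for the uniform distribution on the interval. It bounds the Orlicz norm of a
pointwise time integral without any integral of functions valued in the Orlicz space. The case b < a
only changes a sign, and cosh is even. -/
theorem PosDensity.modular_intervalIntegral_le (p : PosDensity μ) {β : ℝ → Ω → ℝ}
    (hβ : Measurable (Function.uncurry β)) {a b c : ℝ} (hab : a ≠ b)
    (h : ∀ s ∈ uIoc a b, p.modular (fun x => c⁻¹ * β s x) ≤ 1) :
    p.modular (fun x => (c * |b - a|)⁻¹ * ∫ s in a..b, β s x) ≤ 1 := by
  set ν : Measure ℝ := (ENNReal.ofReal |b - a|)⁻¹ • volume.restrict (uIoc a b) with hν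
  have hpos : 0 < |b - a| := abs_pos.2 (sub_ne_zero.2 hab.symm)
  have hprob : IsProbabilityMeasure ν := ⟨by
    rw [hν, Measure.smul_apply, Measure.restrict_apply_univ, Real.volume_uIoc, smul_eq_mul]
    exact ENNReal.inv_mul_cancel (by simpa using sub_ne_zero.2 hab.symm) ENNReal.ofReal_ne_top⟩
  have h1 := p.modular_integral_le ν (β := fun s x => c⁻¹ * β s x) (hβ.const_mul _) (by
    refine Measure.ae_smul_measure ?_ _
    exact (ae_restrict_iff' measurableSet_uIoc).2 (Eventually.of_forall h))
  refine le_of_eq_of_le ?_ h1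
  unfold PosDensity.modular
  refine lintegral_congr fun x => ?_
  dsimp only
  rw [hν, integral_smul_measure, integral_const_mul, ENNReal.toReal_inv,
    ENNReal.toReal_ofReal hpos.le, intervalIntegral.intervalIntegral_eq_integral_uIoc, mul_inv]
  simp only [smul_eq_mul]
  split_ifs
  · rw [one_mul]; congr 3; ring
  · rw [← Real.cosh_neg]; congr 3; ring

end Curves

/-- Continuity and nonnegativity alone would allow g to vanish. But the integral of |D/g| bounds the
decrease of log g, and reaching zero would cost an infinite amount; so positivity at `t₀` spreads to
the whole interval and the fundamental theorem of calculus applies to log g. -/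
theorem log_sub_log_eq_intervalIntegral {g D : ℝ → ℝ} {a b t₀ : ℝ} (hg : ContinuousOn g (Icc a b))
    (h0 : ∀ s ∈ Icc a b, 0 ≤ g s) (hd : ∀ s ∈ Ioo a b, HasDerivAt g (D s) s)
    (hint : IntegrableOn (fun s => D s / g s) (Icc a b)) (ht₀ : t₀ ∈ Icc a b) (hpos : 0 < g t₀)
    {s : ℝ} (hs : s ∈ Icc a b) :
    0 < g s ∧ Real.log (g s) - Real.log (g t₀) = ∫ y in t₀..s, D y / g y := by
  have hIoo : ∀ {y₁ y₂ : ℝ}, y₁ ∈ Icc a b → y₂ ∈ Icc a b →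
      Ioo (min y₁ y₂) (max y₁ y₂) ⊆ Ioo a b := fun h₁ h₂ =>
    Ioo_subset_Ioo (le_min h₁.1 h₂.1) (max_le h₁.2 h₂.2)
  have huIcc : ∀ {y₁ y₂ : ℝ}, y₁ ∈ Icc a b → y₂ ∈ Icc a b → uIcc y₁ y₂ ⊆ Icc a b := fun h₁ h₂ =>
    ordConnected_Icc.uIcc_subset h₁ h₂
  -- An interior zero is a minimum of g, so D vanishes there too and the value D/0 = 0 does no harm.
  have hD0 : ∀ y ∈ Ioo a b, g y = 0 → D y = 0 := fun y hy hy0 => by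
    refine IsLocalMin.hasDerivAt_eq_zero ?_ (hd y hy)
    filter_upwards [Icc_mem_nhds hy.1 hy.2] with z hz
    rw [hy0]
    exact h0 z hz
  set C := ∫ y in Icc a b, |D y / g y| with hC
  have hlow : ∀ s ∈ Icc a b, 0 < g s := by
    intro s hs
    refine (mul_pos (Real.exp_pos (-C)) hpos).trans_le ?_
    -- The logarithm of g + ε is always defined, and its derivative is the score times g/(g + ε) ≤
    -- 1. Its variation is thus at most `C`, uniformly in ε.
    have hε : ∀ ε : ℝ, 0 < ε → Real.exp (-C) * (g t₀ + ε) ≤ g s + ε := by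
      intro ε hε
      have hgε : ∀ y ∈ Icc a b, 0 < g y + ε := fun y hy => by linarith [h0 y hy]
      have hI : IntegrableOn (fun y => D y / g y * (g y / (g y + ε))) (Icc a b) := by
        refine Integrable.mul_bdd (c := 1) hint ?_ ?_
        · exact (hg.div (hg.add continuousOn_const) fun y hy => (hgε y hy).ne').aestronglyMeasurable
            measurableSet_Icc
        · refine (ae_restrict_iff' measurableSet_Icc).2 (Eventually.of_forall fun y hy => ?_)
          have := h0 y hy
          rw [Real.norm_of_nonneg (by positivity), div_le_one (hgε y hy)]
          linarith
      have hFTC : ∫ y in t₀..s, D y / g y * (g y / (g y + ε)) =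
          Real.log (g s + ε) - Real.log (g t₀ + ε) := by
        refine intervalIntegral.integral_eq_sub_of_hasDeriv_right (f := fun y => Real.log (g y + ε))
          ?_ ?_ ?_
        · refine ContinuousOn.log ((hg.mono (huIcc ht₀ hs)).add continuousOn_const) fun y hy => ?_
          exact (hgε y (huIcc ht₀ hs hy)).ne'
        · intro y hy
          have hy' := hIoo ht₀ hs hy
          have hge := hgε y (Ioo_subset_Icc_self hy')
          have h1 := (((hd y hy').add_const ε).log hge.ne').hasDerivWithinAt (s := Ioi y)
          convert h1 using 1
          by_cases hy0 : g y = 0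
          · rw [hD0 y hy' hy0, hy0]; simp
          · field_simp
        · exact (hI.mono_set (huIcc ht₀ hs)).intervalIntegrable
      have hle : |∫ y in t₀..s, D y / g y * (g y / (g y + ε))| ≤ C := by
        rw [← Real.norm_eq_abs]
        refine (intervalIntegral.norm_integral_le_integral_norm_uIoc).trans ?_
        have hsub : uIoc t₀ s ⊆ Icc a b := uIoc_subset_uIcc.trans (huIcc ht₀ hs)
        refine (setIntegral_mono_on (hI.mono_set hsub).norm (hint.mono_set hsub).norm
          measurableSet_uIoc fun y hy => ?_).trans
            (setIntegral_mono_set hint.norm (Eventually.of_forall fun y => norm_nonneg _)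
              hsub.eventuallyLE)
        have hge := hgε y (hsub hy)
        have := h0 y (hsub hy)
        rw [norm_mul, Real.norm_of_nonneg (by positivity : 0 ≤ g y / (g y + ε))]
        exact mul_le_of_le_one_right (norm_nonneg _) ((div_le_one hge).2 (by linarith))
      rw [hFTC, abs_le] at hle
      have h2 : -C + Real.log (g t₀ + ε) ≤ Real.log (g s + ε) := by linarith
      have h3 := Real.exp_le_exp.2 h2
      rwa [Real.exp_add, Real.exp_log (by linarith), Real.exp_log (hgε s hs)] at h3
    have hl : Tendsto (fun ε : ℝ => Real.exp (-C) * (g t₀ + ε)) (𝓝[>] 0)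
        (𝓝 (Real.exp (-C) * (g t₀ + 0))) :=
      (Continuous.tendsto (by fun_prop) 0).mono_left nhdsWithin_le_nhds
    have hr : Tendsto (fun ε : ℝ => g s + ε) (𝓝[>] 0) (𝓝 (g s + 0)) :=
      (Continuous.tendsto (by fun_prop) 0).mono_left nhdsWithin_le_nhds
    have := le_of_tendsto_of_tendsto hl hr (by
      filter_upwards [self_mem_nhdsWithin] with ε h
      exact hε ε h)
    simpa using this
  refine ⟨hlow s hs, Eq.symm ?_⟩
  refine intervalIntegral.integral_eq_sub_of_hasDeriv_right (f := fun y => Real.log (g y))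
    ((hg.mono (huIcc ht₀ hs)).log fun y hy => (hlow y (huIcc ht₀ hs hy)).ne') (fun y hy => ?_)
    (hint.mono_set (huIcc ht₀ hs)).intervalIntegrable
  have hy' := hIoo ht₀ hs hy
  exact ((hd y hy').log (hlow y (Ioo_subset_Icc_self hy')).ne').hasDerivWithinAt

/-! ### Parts (i) and (ii) for the Fokker-Planck flow. -/

section Flow

variable {n m : ℕ}

theorem IsCk0.continuousOn_uncurry {F : Type*} [NormedAddCommGroup F] [NormedSpace ℝ F] {k : ℕ}
    {g : ℝ → EuclideanSpace ℝ (Fin n) → F} (hg : IsCk0 k g) :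
    ContinuousOn (fun z : ℝ × EuclideanSpace ℝ (Fin n) => g z.1 z.2) (Ici 0 ×ˢ univ) := by
  have h := hg.2 0 (Nat.zero_le k)
  have h2 := (continuousMultilinearCurryFin0 ℝ (EuclideanSpace ℝ (Fin n)) F).continuous.comp_continuousOn h
  exact h2.congr fun z hz => by simp [iteratedFDeriv_zero_eq_comp]

theorem IsCk0.continuousOn_time {F : Type*} [NormedAddCommGroup F] [NormedSpace ℝ F] {k : ℕ}
    {g : ℝ → EuclideanSpace ℝ (Fin n) → F} (hg : IsCk0 k g) (x : EuclideanSpace ℝ (Fin n)) :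
    ContinuousOn (fun s => g s x) (Ici 0) :=
  hg.continuousOn_uncurry.comp (f := fun s : ℝ => (s, x)) (by fun_prop) fun s hs => ⟨hs, mem_univ _⟩

/-- A continuous version of an almost everywhere positive density may still vanish on a null set;
nonnegativity is all that is available at every point. -/
theorem nonneg_of_ae_pos {q : PosDensity (volume : Measure (EuclideanSpace ℝ (Fin n)))}
    {g : EuclideanSpace ℝ (Fin n) → ℝ} (hg : Continuous g) (h : q.toFun =ᵐ[volume] g)
    (x : EuclideanSpace ℝ (Fin n)) : 0 ≤ g x := by
  have h1 : g =ᵐ[volume] fun x => |g x| := by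
    filter_upwards [h, q.pos] with x hx hp
    rw [← hx, abs_of_pos hp]
  have h2 := (Continuous.ae_eq_iff_eq volume hg hg.abs).1 h1
  rw [h2]
  exact abs_nonneg _

variable {f : ℝ → EuclideanSpace ℝ (Fin n) → EuclideanSpace ℝ (Fin n)}
  {σ : ℝ → EuclideanSpace ℝ (Fin n) → Matrix (Fin n) (Fin m) ℝ}
  {p : ℝ → EuclideanSpace ℝ (Fin n) → ℝ}
  {P : ℝ → PosDensity (volume : Measure (EuclideanSpace ℝ (Fin n)))}

theorem IsFokkerPlanckFlow.nonneg (hP : IsFokkerPlanckFlow f σ p P) {t : ℝ} (ht : 0 ≤ t)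
    (x : EuclideanSpace ℝ (Fin n)) : 0 ≤ p t x :=
  nonneg_of_ae_pos (hP.density_regular.1 t ht).continuous (hP.density t ht) x

theorem neBot_nhdsWithin_Ici_diff {t : ℝ} (ht : 0 ≤ t) : (𝓝[Ici 0 \ {t}] t).NeBot := by
  refine (inferInstance : (𝓝[>] t).NeBot).mono (nhdsWithin_mono t fun s hs => ?_)
  exact ⟨ht.trans (le_of_lt hs), ne_of_gt hs⟩

/-- Differentiability into the exponential manifold gives the velocity `L* p / p`. -/
theorem IsFokkerPlanckFlow.hasDerivWithinAt_expChart (hP : IsFokkerPlanckFlow f σ p P)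
    {r : PosDensity (volume : Measure (EuclideanSpace ℝ (Fin n)))} {t : ℝ} (ht : 0 ≤ t)
    (h : DifferentiableIntoAt (maxExp r) P (Ici 0) t) :
    ∃ V : BSpace (P t),
      BSpace.fn V =ᵐ[volume] forwardScore (f t) (diffusionMatrix σ t) (p t) ∧
      HasDerivWithinAt (fun s => expChart (P t) (P s)) V (Ici 0) t ∧
      HasL1DerivWithinAt P (forwardOp (f t) (diffusionMatrix σ t) (p t)) (Ici 0) t := by
  have htr : P t ∈ maxExp r := h.1.self_of_nhdsWithin ht
  have hV := (h.2 (P t) htr).hasDerivWithinAt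
  have hL1 := hasL1DerivWithinAt_of_expChart (h.1.mono fun s hs => expConnected_of_mem htr hs) hV
  have := neBot_nhdsWithin_Ici_diff ht
  have hae := hL1.ae_eq_of_hasDerivWithinAt ht (fun s hs => hP.density s hs) (hP.fokkerPlanck t ht)
  refine ⟨_, ?_, hV, hL1.congr_ae hae⟩
  filter_upwards [hae, (P t).pos, hP.density t ht] with x hx hp hd
  rw [forwardScore, ← hx, ← hd, mul_div_cancel_left₀ _ hp.ne']

/-- By the equation, L*p is the pointwise limit of forward difference quotients of p, which are
continuous in (s, x). The truncation `max s 0` supplies values at negative times. -/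
theorem IsFokkerPlanckFlow.measurable_forwardScore (hP : IsFokkerPlanckFlow f σ p P) :
    Measurable (Function.uncurry fun (s : ℝ) x =>
      forwardScore (f (max s 0)) (diffusionMatrix σ (max s 0)) (p (max s 0)) x) := by
  have hp : ∀ c : ℝ, 0 ≤ c →
      Continuous fun z : ℝ × EuclideanSpace ℝ (Fin n) => p (max z.1 0 + c) z.2 := fun c hc =>
    hP.density_regular.continuousOn_uncurry.comp_continuous
      (f := fun z : ℝ × EuclideanSpace ℝ (Fin n) => (max z.1 0 + c, z.2)) (by fun_prop)
      fun z => ⟨add_nonneg (le_max_right _ _) hc, mem_univ _⟩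
  have hp0 : Continuous fun z : ℝ × EuclideanSpace ℝ (Fin n) => p (max z.1 0) z.2 := by
    simpa only [add_zero] using hp 0 le_rfl
  have hD : Measurable fun z : ℝ × EuclideanSpace ℝ (Fin n) =>
      forwardOp (f (max z.1 0)) (diffusionMatrix σ (max z.1 0)) (p (max z.1 0)) z.2 := by
    refine measurable_of_tendsto_metrizable (f := fun (k : ℕ) (z : ℝ × EuclideanSpace ℝ (Fin n)) =>
      (1 / ((k : ℝ) + 1))⁻¹ * (p (max z.1 0 + 1 / ((k : ℝ) + 1)) z.2 - p (max z.1 0) z.2))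
      (fun k => ((hp (1 / ((k : ℝ) + 1)) (by positivity)).sub hp0).measurable.const_mul _) ?_
    rw [tendsto_pi_nhds]
    intro z
    have h1 := hasDerivWithinAt_iff_tendsto_slope.1
      (hP.fokkerPlanck (max z.1 0) (le_max_right _ _) z.2)
    have h2 : Tendsto (fun k : ℕ => max z.1 0 + 1 / ((k : ℝ) + 1)) atTop
        (𝓝[Ici 0 \ {max z.1 0}] (max z.1 0)) := by
      refine tendsto_nhdsWithin_iff.2 ⟨?_, Eventually.of_forall fun k => ⟨?_, ?_⟩⟩
      · simpa using (tendsto_one_div_add_atTop_nhds_zero_nat (𝕜 := ℝ)).const_add (max z.1 0)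
      · exact add_nonneg (le_max_right z.1 0) (by positivity : (0 : ℝ) ≤ 1 / ((k : ℝ) + 1))
      · have : (0 : ℝ) < 1 / ((k : ℝ) + 1) := by positivity
        simp only [mem_singleton_iff]
        linarith
    refine (h1.comp h2).congr fun k => ?_
    rw [Function.comp_apply, slope_def_field, add_sub_cancel_left]
    field_simp
  exact hD.div hp0.measurable

/-- On a time interval on which the scores `L* p / p` are bounded in `L^Φ`, the logarithm of the
density is the time integral of the score. -/
theorem IsFokkerPlanckFlow.logRatio_eq_intervalIntegral (hP : IsFokkerPlanckFlow f σ p P)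
    {a b t₀ M : ℝ} (ha : 0 ≤ a) (ht₀ : t₀ ∈ Icc a b)
    (hM : ∀ s ∈ Icc a b, (P t₀).modular
      (fun x => M⁻¹ * forwardScore (f s) (diffusionMatrix σ s) (p s) x) ≤ 1) (hM0 : 0 < M)
    {t : ℝ} (ht : t ∈ Icc a b) :
    ∀ᵐ x ∂(volume : Measure (EuclideanSpace ℝ (Fin n))),
      IntervalIntegrable (fun s =>
        forwardScore (f (max s 0)) (diffusionMatrix σ (max s 0)) (p (max s 0)) x) volume t₀ t ∧
      logRatio (P t₀) (P t) x =
        ∫ s in t₀..t, forwardScore (f (max s 0)) (diffusionMatrix σ (max s 0)) (p (max s 0)) x := by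
  have := (P t₀).isProbabilityMeasure
  set β : ℝ → EuclideanSpace ℝ (Fin n) → ℝ := fun s x =>
    forwardScore (f (max s 0)) (diffusionMatrix σ (max s 0)) (p (max s 0)) x with hβ
  have hβm : Measurable (Function.uncurry β) := hP.measurable_forwardScore
  have hβs : ∀ s ∈ Icc a b, ∀ x, β s x = forwardScore (f s) (diffusionMatrix σ s) (p s) x :=
    fun s hs x => by simp only [hβ, max_eq_left (ha.trans hs.1)]
  have hint : ∀ᵐ x ∂(volume : Measure (EuclideanSpace ℝ (Fin n))),
      IntegrableOn (fun s => β s x) (Icc a b) := by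
    refine (P t₀).absolutelyContinuous_prob.ae_le ?_
    have hm2 : Measurable (Function.uncurry fun (x : EuclideanSpace ℝ (Fin n)) (s : ℝ) =>
        ‖β s x‖ₑ) := (hβm.comp measurable_swap).enorm
    -- By Tonelli and |y| ≤ cosh y, the uniform modular bound makes the score integrable in (s, x),
    -- hence integrable in time for almost every x.
    have hfin : ∫⁻ x, (∫⁻ s in Icc a b, ‖β s x‖ₑ) ∂(P t₀).prob < ∞ := by
      rw [lintegral_lintegral_swap hm2.aemeasurable]
      calc ∫⁻ s in Icc a b, ∫⁻ x, ‖β s x‖ₑ ∂(P t₀).prob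
          ≤ ∫⁻ _ in Icc a b, ENNReal.ofReal M * 2 := by
            refine setLIntegral_mono measurable_const fun s hs => ?_
            calc ∫⁻ x, ‖β s x‖ₑ ∂(P t₀).prob
                ≤ ∫⁻ x, ENNReal.ofReal M *
                    (ENNReal.ofReal (Real.cosh (M⁻¹ * β s x) - 1) + 1) ∂(P t₀).prob := by
                  refine lintegral_mono fun x => ?_
                  rw [← ENNReal.ofReal_one, ← ENNReal.ofReal_add (by simp) zero_le_one,
                    ← ENNReal.ofReal_mul hM0.le, sub_add_cancel, ← ofReal_norm]
                  refine ENNReal.ofReal_le_ofReal ?_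
                  have h1 := abs_le_cosh (M⁻¹ * β s x)
                  rwa [abs_mul, abs_of_pos (inv_pos.2 hM0), inv_mul_le_iff₀ hM0] at h1
              _ = ENNReal.ofReal M * ((P t₀).modular (fun x => M⁻¹ * β s x) + 1) := by
                  rw [lintegral_const_mul' _ _ ENNReal.ofReal_ne_top,
                    lintegral_add_right _ measurable_const]
                  simp [PosDensity.modular]
              _ ≤ ENNReal.ofReal M * (1 + 1) := by
                  gcongr
                  simpa only [hβs s hs] using hM s hs
              _ = ENNReal.ofReal M * 2 := by norm_num
        _ < ∞ := by
            rw [setLIntegral_const]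
            exact ENNReal.mul_lt_top (ENNReal.mul_lt_top ENNReal.ofReal_lt_top (by simp))
              (by simp)
    filter_upwards [ae_lt_top hm2.lintegral_prod_right hfin.ne] with x hx
    exact ⟨(hβm.comp measurable_prodMk_right).aestronglyMeasurable, hx⟩
  filter_upwards [hint, coeFn_logRatio (P t₀) (P t), hP.density t₀ (ha.trans ht₀.1),
    hP.density t (ha.trans ht.1), (P t₀).pos] with x hx hlog hd0 hd hpos
  have hI : IntegrableOn (fun s => forwardOp (f s) (diffusionMatrix σ s) (p s) x / p s x)
      (Icc a b) := hx.congr_fun (fun s hs => hβs s hs x) measurableSet_Icc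
  have h1 := log_sub_log_eq_intervalIntegral (g := fun s => p s x)
    ((hP.density_regular.continuousOn_time x).mono (Icc_subset_Ici_iff (ht₀.1.trans ht₀.2)|>.2 ha))
    (fun s hs => hP.nonneg (ha.trans hs.1) x)
    (fun s hs => (hP.fokkerPlanck s (ha.trans hs.1.le) x).hasDerivAt
      (Ici_mem_nhds (ha.trans_lt hs.1))) hI ht₀ (by rwa [← hd0]) ht
  refine ⟨(hx.mono_set (ordConnected_Icc.uIcc_subset ht₀ ht)).intervalIntegrable, ?_⟩
  rw [hlog, hd0, hd, h1.2]
  refine intervalIntegral.integral_congr fun s hs => ?_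
  have hs' := ordConnected_Icc.uIcc_subset ht₀ ht hs
  exact (hβs s hs' x).symm

/-- Continuity of the scores into `L^Φ` gives differentiability into the exponential manifold. -/
theorem IsFokkerPlanckFlow.differentiableIntoAt (hP : IsFokkerPlanckFlow f σ p P)
    {r : PosDensity (volume : Measure (EuclideanSpace ℝ (Fin n)))} {t₀ : ℝ} (ht₀ : 0 ≤ t₀)
    (hr : P t₀ ∈ maxExp r)
    (hα : ContinuousIntoLPhiAt r (fun t => forwardScore (f t) (diffusionMatrix σ t) (p t))
      (Ici 0) t₀) :
    DifferentiableIntoAt (maxExp r) P (Ici 0) t₀ := by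
  obtain ⟨A₀, hA₀, hA₀c⟩ := hα
  have hconn := mem_maxExp_iff.1 hr
  set A : ℝ → LPhi (P t₀) := fun t => LPhi.inclusion hconn.2 (A₀ t) with hAdef
  have hAα : ∀ᶠ t in 𝓝[Ici 0] t₀, ⇑(A t : EuclideanSpace ℝ (Fin n) →ₘ[volume] ℝ) =ᵐ[volume]
      forwardScore (f t) (diffusionMatrix σ t) (p t) := by
    filter_upwards [hA₀] with t ht
    rw [hAdef, LPhi.coe_inclusion]
    exact ht
  have hAc : ContinuousWithinAt A (Ici 0) t₀ :=
    (LPhi.inclusion hconn.2).continuous.continuousAt.comp_continuousWithinAt hA₀c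
  set β : ℝ → EuclideanSpace ℝ (Fin n) → ℝ := fun s x =>
    forwardScore (f (max s 0)) (diffusionMatrix σ (max s 0)) (p (max s 0)) x with hβ
  have hβm : Measurable (Function.uncurry β) := hP.measurable_forwardScore
  have hβA : ∀ s, 0 ≤ s → ⇑(A s : EuclideanSpace ℝ (Fin n) →ₘ[volume] ℝ) =ᵐ[volume]
      forwardScore (f s) (diffusionMatrix σ s) (p s) →
      ⇑(A s : EuclideanSpace ℝ (Fin n) →ₘ[volume] ℝ) =ᵐ[volume] β s := fun s hs h => by
    simp only [hβ, max_eq_left hs]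
    exact h
  set M := ‖A t₀‖ + 1 with hMdef
  have hM0 : 0 < M := by positivity
  have hev : ∀ᶠ t in 𝓝[Ici 0] t₀,
      ⇑(A t : EuclideanSpace ℝ (Fin n) →ₘ[volume] ℝ) =ᵐ[volume]
      forwardScore (f t) (diffusionMatrix σ t) (p t) ∧ ‖A t‖ < M :=
    hAα.and (hAc.norm.eventually_lt_const (by linarith))
  obtain ⟨δ, hδ, hδM⟩ : ∃ δ > 0, ∀ t, 0 ≤ t → |t - t₀| ≤ δ →
      ⇑(A t : EuclideanSpace ℝ (Fin n) →ₘ[volume] ℝ) =ᵐ[volume]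
      forwardScore (f t) (diffusionMatrix σ t) (p t) ∧ ‖A t‖ < M := by
    obtain ⟨ε, hε, h⟩ := Metric.mem_nhdsWithin_iff.1 hev
    refine ⟨ε / 2, half_pos hε, fun t ht htδ => h ⟨?_, ht⟩⟩
    rw [Metric.mem_ball, Real.dist_eq]
    linarith
  set a := max (t₀ - δ) 0 with ha_def
  set b := t₀ + δ with hb_def
  have ha : 0 ≤ a := le_max_right _ _
  have hab : ∀ s, s ∈ Icc a b ↔ 0 ≤ s ∧ |s - t₀| ≤ δ := fun s => by
    rw [mem_Icc, ha_def, max_le_iff, abs_le]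
    constructor
    · rintro ⟨⟨h1, h2⟩, h3⟩; exact ⟨h2, by linarith, by linarith⟩
    · rintro ⟨h1, h2, h3⟩; exact ⟨⟨by linarith, h1⟩, by linarith⟩
  have ht₀ab : t₀ ∈ Icc a b := (hab t₀).2 ⟨ht₀, by simpa using hδ.le⟩
  have hlog : ∀ t ∈ Icc a b, ∀ᵐ x ∂(volume : Measure (EuclideanSpace ℝ (Fin n))),
      IntervalIntegrable (fun s => β s x) volume t₀ t ∧
      logRatio (P t₀) (P t) x = ∫ s in t₀..t, β s x := fun t ht => by
    refine hP.logRatio_eq_intervalIntegral ha ht₀ab (M := M) (fun s hs => ?_) hM0 ht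
    obtain ⟨h1, h2⟩ := (hab s).1 hs
    obtain ⟨h3, h4⟩ := hδM s h1 h2
    refine le_of_eq_of_le ((P t₀).modular_congr ?_) (LPhi.modular_inv_mul_le_one h4)
    filter_upwards [h3] with x hx
    rw [hx]
  -- Jensen's inequality for `β s - B` between `t₀` and t. It serves twice: `B = 0` bounds the log
  -- ratio itself, and `B = A t₀` bounds the remainder of its first-order expansion.
  have hmod : ∀ (B : LPhi (P t₀)) (ε : ℝ) (t : ℝ), t ∈ Icc a b → t ≠ t₀ →
      (∀ s ∈ uIcc t₀ t, ‖A s - B‖ < ε) →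
      (P t₀).modular (fun x => (ε * |t - t₀|)⁻¹ * (logRatio (P t₀) (P t) x -
        (t - t₀) * (B : EuclideanSpace ℝ (Fin n) →ₘ[volume] ℝ) x)) ≤ 1 := by
    intro B ε t ht hne hs
    refine le_of_eq_of_le ((P t₀).modular_congr ?_)
      ((P t₀).modular_intervalIntegral_le (c := ε) (β := fun s x => β s x -
        (B : EuclideanSpace ℝ (Fin n) →ₘ[volume] ℝ) x)
        (hβm.sub ((AEEqFun.measurable _).comp measurable_snd)) hne.symm fun s hsu => ?_)
    · filter_upwards [hlog t ht] with x hx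
      rw [intervalIntegral.integral_sub hx.1 intervalIntegrable_const, hx.2,
        intervalIntegral.integral_const, smul_eq_mul]
    · have hs1 := uIoc_subset_uIcc hsu
      obtain ⟨h1, h2⟩ := (hab s).1 (ordConnected_Icc.uIcc_subset ht₀ab ht hs1)
      refine le_of_eq_of_le ((P t₀).modular_congr ?_) (LPhi.modular_inv_mul_le_one (hs s hs1))
      filter_upwards [hβA s h1 (hδM s h1 h2).1,
        AEEqFun.coeFn_sub (A s : EuclideanSpace ℝ (Fin n) →ₘ[volume] ℝ) B] with x hx hx2
      rw [Submodule.coe_sub, hx2, Pi.sub_apply, hx]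
  have hnear : ∀ {t s : ℝ}, t ∈ Icc a b → s ∈ uIcc t₀ t → 0 ≤ s ∧ |s - t₀| ≤ |t - t₀| :=
    fun {t s} ht hs => ⟨((hab s).1 (ordConnected_Icc.uIcc_subset ht₀ab ht hs)).1,
      abs_sub_left_of_mem_uIcc hs⟩
  have hmem : ∀ t ∈ Icc a b, ∃ h : logRatio (P t₀) (P t) ∈ LPhi (P t₀),
      ‖(⟨logRatio (P t₀) (P t), h⟩ : LPhi (P t₀))‖ ≤ M * |t - t₀| := by
    intro t ht
    rcases eq_or_ne t t₀ with rfl | hne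
    · refine ⟨by rw [logRatio_self]; exact zero_mem _, ?_⟩
      rw [sub_self, abs_zero, mul_zero, norm_le_zero_iff]
      exact Subtype.ext (logRatio_self _)
    have h1 := hmod 0 M t ht hne fun s hs => by
      obtain ⟨h2, h3⟩ := hnear ht hs
      rw [sub_zero]
      exact (hδM s h2 (h3.trans ((hab t).1 ht).2)).2
    have hpos : 0 < M * |t - t₀| := mul_pos hM0 (abs_pos.2 (sub_ne_zero.2 hne))
    have h2 : (P t₀).modular (fun x => (M * |t - t₀|)⁻¹ * logRatio (P t₀) (P t) x) ≤ 1 := by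
      refine le_of_eq_of_le ((P t₀).modular_congr ?_) h1
      filter_upwards [AEEqFun.coeFn_zero (α := EuclideanSpace ℝ (Fin n)) (μ := volume)
        (β := ℝ)] with x hx
      rw [Submodule.coe_zero, hx, Pi.zero_apply, mul_zero, sub_zero]
    refine ⟨⟨_, inv_pos.2 hpos, h2.trans_lt ENNReal.one_lt_top⟩, ?_⟩
    exact LPhi.norm_le_of_modular_le_one hpos h2
  have hwin : ∀ η : ℝ, 0 < η → ∀ᶠ t in 𝓝[Ici 0] t₀, t ∈ Icc a b ∧ |t - t₀| < η := by
    intro η hη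
    filter_upwards [self_mem_nhdsWithin, nhdsWithin_le_nhds (Metric.ball_mem_nhds t₀ hη),
      nhdsWithin_le_nhds (Metric.ball_mem_nhds t₀ hδ)] with t h1 h2 h3
    rw [Metric.mem_ball, Real.dist_eq] at h2 h3
    exact ⟨(hab t).2 ⟨h1, h3.le⟩, h2⟩
  have hexp : ∀ᶠ t in 𝓝[Ici 0] t₀, ExpConnected (P t₀) (P t) := by
    -- On this window the log ratio has norm below 1/2, as `expConnected_of_norm_logRatio_lt`
    -- requires.
    filter_upwards [hwin (2⁻¹ / M) (by positivity)] with t ht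
    obtain ⟨h, hn⟩ := hmem t ht.1
    refine expConnected_of_norm_logRatio_lt h (hn.trans_lt ?_)
    rw [mul_comm, ← lt_div_iff₀ hM0]
    exact ht.2
  have hderiv : HasDerivWithinAt (fun t => expChart (P t₀) (P t)) (LPhi.centerL (P t₀) (A t₀))
      (Ici 0) t₀ := by
    classical
    rw [hasDerivWithinAt_iff_isLittleO]
    simp only [expChart_self, sub_zero]
    -- Centering is linear and bounded, so the remainder may be estimated on the uncentered log
    -- ratios.
    have hbig : (fun t => expChart (P t₀) (P t) - (t - t₀) • LPhi.centerL (P t₀) (A t₀))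
        =O[𝓝[Ici 0] t₀] fun t => if h : logRatio (P t₀) (P t) ∈ LPhi (P t₀) then
          (⟨logRatio (P t₀) (P t), h⟩ : LPhi (P t₀)) - (t - t₀) • A t₀ else 0 := by
      refine Asymptotics.IsBigO.of_bound ‖LPhi.centerL (P t₀)‖ ?_
      filter_upwards [hexp] with t ht
      rw [dif_pos ht.1, expChart_eq ht.1, ← map_smul, ← map_sub]
      exact ContinuousLinearMap.le_opNorm _ _
    refine hbig.trans_isLittleO (Asymptotics.isLittleO_iff.2 fun ε hε => ?_)
    obtain ⟨η, hη, hball⟩ := Metric.mem_nhdsWithin_iff.1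
      (hAc (Metric.ball_mem_nhds (A t₀) hε))
    filter_upwards [hexp, hwin η hη] with t ht hw
    rw [dif_pos ht.1, Real.norm_eq_abs]
    rcases eq_or_ne t t₀ with rfl | hne
    · rw [sub_self, zero_smul, sub_zero, abs_zero, mul_zero, norm_le_zero_iff]
      exact Subtype.ext (logRatio_self _)
    have hpos : 0 < ε * |t - t₀| := mul_pos hε (abs_pos.2 (sub_ne_zero.2 hne))
    refine LPhi.norm_le_of_modular_le_one hpos (le_of_eq_of_le ((P t₀).modular_congr ?_)
      (hmod (A t₀) ε t hw.1 hne fun s hs => ?_))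
    · filter_upwards [AEEqFun.coeFn_sub (logRatio (P t₀) (P t)) ((t - t₀) •
        (A t₀ : EuclideanSpace ℝ (Fin n) →ₘ[volume] ℝ)), AEEqFun.coeFn_smul (t - t₀)
        (A t₀ : EuclideanSpace ℝ (Fin n) →ₘ[volume] ℝ)] with x h1 h2
      rw [Submodule.coe_sub, Submodule.coe_smul, h1, Pi.sub_apply, h2, Pi.smul_apply, smul_eq_mul]
    · obtain ⟨h2, h3⟩ := hnear hw.1 hs
      have h4 : s ∈ Metric.ball t₀ η ∩ Ici 0 := ⟨by
        rw [Metric.mem_ball, Real.dist_eq]; exact h3.trans_lt hw.2, h2⟩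
      have h5 := hball h4
      rw [mem_preimage, Metric.mem_ball, dist_eq_norm] at h5
      exact h5
  refine ⟨hexp.mono fun t ht => mem_maxExp_of_expConnected hr ht, fun q hq => ?_⟩
  exact (hderiv.expChart_transport (expConnected_of_mem hr hq) hexp
    (ExpConnected.refl _)).differentiableWithinAt

end Flow

/-! ### Minimum principle and adjointness for the second-order operators. -/

section SecondOrder

variable {n m : ℕ}

theorem contDiff_pderivAt {g : EuclideanSpace ℝ (Fin n) → ℝ} {k l : ℕ∞} (hg : ContDiff ℝ l g)
    (hkl : k + 1 ≤ l) (i : Fin n) : ContDiff ℝ k (pderivAt i g) :=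
  (hg.fderiv_right (m := k) (by exact_mod_cast hkl)).clm_apply contDiff_const

theorem continuous_pderivAt {g : EuclideanSpace ℝ (Fin n) → ℝ} (hg : ContDiff ℝ 1 g) (i : Fin n) :
    Continuous (pderivAt i g) :=
  (hg.continuous_fderiv one_ne_zero).clm_apply continuous_const

theorem contDiff_one_pderivAt {g : EuclideanSpace ℝ (Fin n) → ℝ} (hg : ContDiff ℝ 2 g)
    (i : Fin n) : ContDiff ℝ 1 (pderivAt i g) :=
  contDiff_pderivAt (k := 1) (l := 2) hg (by norm_num) i

theorem pderivAt_add {g h : EuclideanSpace ℝ (Fin n) → ℝ} {x : EuclideanSpace ℝ (Fin n)}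
    (hg : DifferentiableAt ℝ g x) (hh : DifferentiableAt ℝ h x) (i : Fin n) :
    pderivAt i (fun y => g y + h y) x = pderivAt i g x + pderivAt i h x := by
  rw [pderivAt, fderiv_fun_add hg hh]
  rfl

theorem pderivAt_const_mul {g : EuclideanSpace ℝ (Fin n) → ℝ} {x : EuclideanSpace ℝ (Fin n)}
    (hg : DifferentiableAt ℝ g x) (c : ℝ) (i : Fin n) :
    pderivAt i (fun y => c * g y) x = c * pderivAt i g x := by
  rw [pderivAt, fderiv_const_mul hg]
  rfl

theorem pderivAt_mul {g h : EuclideanSpace ℝ (Fin n) → ℝ} {x : EuclideanSpace ℝ (Fin n)}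
    (hg : DifferentiableAt ℝ g x) (hh : DifferentiableAt ℝ h x) (i : Fin n) :
    pderivAt i (fun y => g y * h y) x = g x * pderivAt i h x + h x * pderivAt i g x := by
  rw [pderivAt, fderiv_fun_mul hg hh]
  rfl

theorem sum_mul_pderivAt (g : EuclideanSpace ℝ (Fin n) → ℝ) (x v : EuclideanSpace ℝ (Fin n)) :
    ∑ i, v i * pderivAt i g x = fderiv ℝ g x v := by
  have hv : v = ∑ i, v i • EuclideanSpace.single i (1 : ℝ) := by
    have := (EuclideanSpace.basisFun (Fin n) ℝ).sum_repr v
    simpa using this.symm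
  conv_rhs => rw [hv, map_sum]
  simp [pderivAt]

/-- A negative second derivative would make the point a local maximum as well, so h would be
constant nearby and its second derivative zero. -/
theorem nonneg_deriv_deriv_of_isLocalMin {h : ℝ → ℝ} {x : ℝ} (hc : ContinuousAt h x)
    (hmin : IsLocalMin h x) : 0 ≤ deriv (deriv h) x := by
  by_contra! hneg
  have hmax := isLocalMax_of_deriv_deriv_neg hneg hmin.deriv_eq_zero hc
  have hconst : h =ᶠ[𝓝 x] fun _ => h x := by
    filter_upwards [hmin, hmax] with y h1 h2
    exact le_antisymm h2 h1
  rw [hconst.deriv.deriv_eq] at hneg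
  simp at hneg

theorem sum_mul_mul_pderivAt_nonneg {g : EuclideanSpace ℝ (Fin n) → ℝ} (hg : ContDiff ℝ 2 g)
    {x : EuclideanSpace ℝ (Fin n)} (hmin : IsLocalMin g x) (v : EuclideanSpace ℝ (Fin n)) :
    0 ≤ ∑ i, ∑ j, v i * v j * pderivAt i (pderivAt j g) x := by
  have hline : ∀ τ : ℝ, HasDerivAt (fun τ : ℝ => x + τ • v) v τ := fun τ => by
    simpa using ((hasDerivAt_id τ).smul_const v).const_add x
  have hd1 : deriv (fun τ : ℝ => g (x + τ • v)) = fun τ => ∑ j, v j * pderivAt j g (x + τ • v) := by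
    funext τ
    rw [sum_mul_pderivAt]
    exact (((hg.differentiable two_ne_zero).differentiableAt.hasFDerivAt).comp_hasDerivAt τ
      (hline τ)).deriv
  have hd2 : deriv (deriv (fun τ : ℝ => g (x + τ • v))) 0 =
      ∑ i, ∑ j, v i * v j * pderivAt i (pderivAt j g) x := by
    rw [hd1]
    have h1 : ∀ j ∈ Finset.univ, HasDerivAt (fun τ : ℝ => v j * pderivAt j g (x + τ • v))
        (v j * ∑ i, v i * pderivAt i (pderivAt j g) x) 0 := fun j _ => by
      rw [sum_mul_pderivAt]
      have h2 := (((contDiff_one_pderivAt hg j).differentiable one_ne_zero).differentiableAt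
        (x := x + (0 : ℝ) • v)).hasFDerivAt.comp_hasDerivAt 0 (hline 0)
      rw [zero_smul, add_zero] at h2
      exact h2.const_mul _
    rw [(HasDerivAt.fun_sum h1).deriv, Finset.sum_comm]
    refine Finset.sum_congr rfl fun j _ => ?_
    rw [Finset.mul_sum]
    refine Finset.sum_congr rfl fun i _ => ?_
    ring
  rw [← hd2]
  have hc : Continuous fun τ : ℝ => x + τ • v := by fun_prop
  refine nonneg_deriv_deriv_of_isLocalMin (hg.continuous.comp hc).continuousAt ?_
  have h3 : Tendsto (fun τ : ℝ => x + τ • v) (𝓝 0) (𝓝 x) := by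
    simpa using hc.tendsto 0
  filter_upwards [h3.eventually hmin] with τ hτ
  simpa using hτ

/-- The factorization ss' turns the contraction into a sum of second derivatives along the columns
of s. -/
theorem sum_matrix_mul_pderivAt_nonneg {g : EuclideanSpace ℝ (Fin n) → ℝ} (hg : ContDiff ℝ 2 g)
    {x : EuclideanSpace ℝ (Fin n)} (hmin : IsLocalMin g x) (s : Matrix (Fin n) (Fin m) ℝ) :
    0 ≤ ∑ i, ∑ j, (s * s.transpose) i j * pderivAt i (pderivAt j g) x := by
  have h : ∑ i, ∑ j, (s * s.transpose) i j * pderivAt i (pderivAt j g) x =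
      ∑ k, ∑ i, ∑ j, s i k * s j k * pderivAt i (pderivAt j g) x := by
    rw [eq_comm, Finset.sum_comm]
    refine Finset.sum_congr rfl fun i _ => ?_
    rw [Finset.sum_comm]
    refine Finset.sum_congr rfl fun j _ => ?_
    rw [Matrix.mul_apply, Finset.sum_mul]
    rfl
  rw [h]
  exact Finset.sum_nonneg fun k _ => by
    simpa using sum_mul_mul_pderivAt_nonneg hg hmin (WithLp.toLp 2 fun i => s i k)

/-- The generator `L g = ∑ᵢ bᵢ ∂ᵢ g + 1/2 ∑ᵢⱼ aᵢⱼ ∂ᵢ ∂ⱼ g`, the formal adjoint of `forwardOp`. -/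
def backwardOp (b : EuclideanSpace ℝ (Fin n) → EuclideanSpace ℝ (Fin n))
    (a : EuclideanSpace ℝ (Fin n) → Matrix (Fin n) (Fin n) ℝ)
    (g : EuclideanSpace ℝ (Fin n) → ℝ) (x : EuclideanSpace ℝ (Fin n)) : ℝ :=
  ∑ i, b x i * pderivAt i g x + 1 / 2 * ∑ i, ∑ j, a x i j * pderivAt i (pderivAt j g) x

variable {b : EuclideanSpace ℝ (Fin n) → EuclideanSpace ℝ (Fin n)}
  {a : EuclideanSpace ℝ (Fin n) → Matrix (Fin n) (Fin n) ℝ}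

theorem pderivAt_eq_zero_of_isLocalMin {g : EuclideanSpace ℝ (Fin n) → ℝ}
    {x : EuclideanSpace ℝ (Fin n)} (hmin : IsLocalMin g x) (i : Fin n) : pderivAt i g x = 0 := by
  rw [pderivAt, hmin.fderiv_eq_zero]
  rfl

theorem backwardOp_nonneg_of_isLocalMin {g : EuclideanSpace ℝ (Fin n) → ℝ} (hg : ContDiff ℝ 2 g)
    {x : EuclideanSpace ℝ (Fin n)} (hmin : IsLocalMin g x) {s : Matrix (Fin n) (Fin m) ℝ}
    (hs : a x = s * s.transpose) : 0 ≤ backwardOp b a g x := by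
  have h := sum_matrix_mul_pderivAt_nonneg hg hmin s
  simp only [backwardOp, pderivAt_eq_zero_of_isLocalMin hmin, mul_zero, Finset.sum_const_zero,
    zero_add, hs]
  linarith

theorem backwardOp_add {g h : EuclideanSpace ℝ (Fin n) → ℝ} (hg : ContDiff ℝ 2 g)
    (hh : ContDiff ℝ 2 h) (x : EuclideanSpace ℝ (Fin n)) :
    backwardOp b a (fun y => g y + h y) x = backwardOp b a g x + backwardOp b a h x := by
  have h1 : ∀ i, pderivAt i (fun y => g y + h y) = fun y => pderivAt i g y + pderivAt i h y :=
    fun i => funext fun y => pderivAt_add (hg.differentiable two_ne_zero).differentiableAt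
      (hh.differentiable two_ne_zero).differentiableAt i
  have h2 : ∀ i j, pderivAt i (pderivAt j (fun y => g y + h y)) x =
      pderivAt i (pderivAt j g) x + pderivAt i (pderivAt j h) x := fun i j => by
    rw [h1]
    exact pderivAt_add ((contDiff_one_pderivAt hg j).differentiable one_ne_zero).differentiableAt
      ((contDiff_one_pderivAt hh j).differentiable one_ne_zero).differentiableAt i
  simp only [backwardOp, h2]
  simp only [h1, mul_add, Finset.sum_add_distrib]
  ring

theorem backwardOp_const_mul {g : EuclideanSpace ℝ (Fin n) → ℝ} (hg : ContDiff ℝ 2 g) (c : ℝ)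
    (x : EuclideanSpace ℝ (Fin n)) :
    backwardOp b a (fun y => c * g y) x = c * backwardOp b a g x := by
  have h1 : ∀ i, pderivAt i (fun y => c * g y) = fun y => c * pderivAt i g y :=
    fun i => funext fun y => pderivAt_const_mul (hg.differentiable two_ne_zero).differentiableAt c i
  have h2 : ∀ i j, pderivAt i (pderivAt j (fun y => c * g y)) x =
      c * pderivAt i (pderivAt j g) x := fun i j => by
    rw [h1]
    exact pderivAt_const_mul
      ((contDiff_one_pderivAt hg j).differentiable one_ne_zero).differentiableAt c i
  simp only [backwardOp, h2]
  simp only [h1, mul_left_comm _ c, ← Finset.mul_sum]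
  ring

theorem forwardOp_add (hb : ContDiff ℝ 1 b) (ha : ∀ i j, ContDiff ℝ 2 fun y => a y i j)
    {g h : EuclideanSpace ℝ (Fin n) → ℝ} (hg : ContDiff ℝ 2 g)
    (hh : ContDiff ℝ 2 h) (x : EuclideanSpace ℝ (Fin n)) :
    forwardOp b a (fun y => g y + h y) x = forwardOp b a g x + forwardOp b a h x := by
  have hbi : ∀ i, ContDiff ℝ 1 fun y => b y i := fun i => (contDiff_euclidean.1 hb) i
  have h1 : ∀ i, pderivAt i (fun y => b y i * (g y + h y)) x =
      pderivAt i (fun y => b y i * g y) x + pderivAt i (fun y => b y i * h y) x := fun i => by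
    simp only [mul_add]
    exact pderivAt_add
      (((hbi i).mul (hg.of_le one_le_two)).differentiable one_ne_zero).differentiableAt
      (((hbi i).mul (hh.of_le one_le_two)).differentiable one_ne_zero).differentiableAt i
  have h2 : ∀ i j, pderivAt i (pderivAt j (fun y => a y i j * (g y + h y))) x =
      pderivAt i (pderivAt j (fun y => a y i j * g y)) x +
        pderivAt i (pderivAt j (fun y => a y i j * h y)) x := fun i j => by
    have h3 : pderivAt j (fun y => a y i j * (g y + h y)) = fun y =>
        pderivAt j (fun y => a y i j * g y) y + pderivAt j (fun y => a y i j * h y) y := by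
      funext y
      simp only [mul_add]
      exact pderivAt_add (((ha i j).mul hg).differentiable two_ne_zero).differentiableAt
        (((ha i j).mul hh).differentiable two_ne_zero).differentiableAt j
    rw [h3]
    exact pderivAt_add
      ((contDiff_one_pderivAt ((ha i j).mul hg) j).differentiable one_ne_zero).differentiableAt
      ((contDiff_one_pderivAt ((ha i j).mul hh) j).differentiable one_ne_zero).differentiableAt i
  simp only [forwardOp, h1, h2, Finset.sum_add_distrib]
  ring

theorem forwardOp_const_mul (hb : ContDiff ℝ 1 b) (ha : ∀ i j, ContDiff ℝ 2 fun y => a y i j)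
    {g : EuclideanSpace ℝ (Fin n) → ℝ} (hg : ContDiff ℝ 2 g) (c : ℝ)
    (x : EuclideanSpace ℝ (Fin n)) :
    forwardOp b a (fun y => c * g y) x = c * forwardOp b a g x := by
  have hbi : ∀ i, ContDiff ℝ 1 fun y => b y i := fun i => (contDiff_euclidean.1 hb) i
  have h1 : ∀ i, pderivAt i (fun y => b y i * (c * g y)) x =
      c * pderivAt i (fun y => b y i * g y) x := fun i => by
    simp only [mul_left_comm _ c]
    exact pderivAt_const_mul
      (((hbi i).mul (hg.of_le one_le_two)).differentiable one_ne_zero).differentiableAt c i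
  have h2 : ∀ i j, pderivAt i (pderivAt j (fun y => a y i j * (c * g y))) x =
      c * pderivAt i (pderivAt j (fun y => a y i j * g y)) x := fun i j => by
    have h3 : pderivAt j (fun y => a y i j * (c * g y)) = fun y =>
        c * pderivAt j (fun y => a y i j * g y) y := by
      funext y
      simp only [mul_left_comm _ c]
      exact pderivAt_const_mul (((ha i j).mul hg).differentiable two_ne_zero).differentiableAt c j
    rw [h3]
    exact pderivAt_const_mul
      ((contDiff_one_pderivAt ((ha i j).mul hg) j).differentiable one_ne_zero).differentiableAt c i
  simp only [forwardOp, h1, h2, ← Finset.mul_sum]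
  ring

theorem continuous_forwardOp (hb : ContDiff ℝ 1 b) (ha : ∀ i j, ContDiff ℝ 2 fun y => a y i j)
    {g : EuclideanSpace ℝ (Fin n) → ℝ} (hg : ContDiff ℝ 2 g) : Continuous (forwardOp b a g) := by
  have hbi : ∀ i, ContDiff ℝ 1 fun y => b y i := fun i => (contDiff_euclidean.1 hb) i
  unfold forwardOp
  refine (continuous_finsetSum _ fun i _ =>
    continuous_pderivAt ((hbi i).mul (hg.of_le one_le_two)) i).neg.add
    (continuous_const.mul (continuous_finsetSum _ fun i _ => continuous_finsetSum _ fun j _ =>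
      continuous_pderivAt (contDiff_one_pderivAt ((ha i j).mul hg) j) i))

theorem continuous_backwardOp (hb : Continuous b) (ha : ∀ i j, Continuous fun y => a y i j)
    {g : EuclideanSpace ℝ (Fin n) → ℝ} (hg : ContDiff ℝ 2 g) : Continuous (backwardOp b a g) := by
  unfold backwardOp
  refine (continuous_finsetSum _ fun i _ => Continuous.mul (by fun_prop)
    (continuous_pderivAt (hg.of_le one_le_two) i)).add
    (continuous_const.mul (continuous_finsetSum _ fun i _ => continuous_finsetSum _ fun j _ =>
      (ha i j).mul (continuous_pderivAt (contDiff_one_pderivAt hg j) i)))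

/-- The minimum principle for the forward operator. -/
theorem forwardOp_nonneg_of_isLocalMin (hb : ContDiff ℝ 1 b)
    (ha : ∀ i j, ContDiff ℝ 2 fun y => a y i j) {g : EuclideanSpace ℝ (Fin n) → ℝ}
    (hg : ContDiff ℝ 2 g) {x : EuclideanSpace ℝ (Fin n)} (hmin : IsLocalMin g x) (h0 : g x = 0)
    {s : Matrix (Fin n) (Fin m) ℝ} (hs : a x = s * s.transpose) : 0 ≤ forwardOp b a g x := by
  have hbi : ∀ i, ContDiff ℝ 1 fun y => b y i := fun i => (contDiff_euclidean.1 hb) i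
  have hgd : ∀ y, DifferentiableAt ℝ g y := fun y =>
    (hg.differentiable two_ne_zero).differentiableAt
  have hpd : ∀ j y, DifferentiableAt ℝ (pderivAt j g) y := fun j y =>
    ((contDiff_one_pderivAt hg j).differentiable one_ne_zero).differentiableAt
  -- Both g and its gradient vanish at x, so every Leibniz term that differentiates a coefficient
  -- drops out, and only a_ij ∂_i∂_j g survives.
  have hz := pderivAt_eq_zero_of_isLocalMin hmin
  have h1 : ∀ i, pderivAt i (fun y => b y i * g y) x = 0 := fun i => by
    rw [pderivAt_mul (((hbi i).differentiable one_ne_zero).differentiableAt) (hgd x), hz, h0]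
    ring
  have h2 : ∀ i j, pderivAt i (pderivAt j (fun y => a y i j * g y)) x =
      a x i j * pderivAt i (pderivAt j g) x := fun i j => by
    have had : ∀ y, DifferentiableAt ℝ (fun y => a y i j) y := fun y =>
      ((ha i j).differentiable two_ne_zero).differentiableAt
    have hapd : ∀ y, DifferentiableAt ℝ (pderivAt j fun y => a y i j) y := fun y =>
      ((contDiff_one_pderivAt (ha i j) j).differentiable one_ne_zero).differentiableAt
    have h3 : pderivAt j (fun y => a y i j * g y) = fun y =>
        a y i j * pderivAt j g y + g y * pderivAt j (fun y => a y i j) y :=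
      funext fun y => pderivAt_mul (had y) (hgd y) j
    rw [h3, pderivAt_add ((had x).fun_mul (hpd j x)) ((hgd x).fun_mul (hapd x)),
      pderivAt_mul (had x) (hpd j x), pderivAt_mul (hgd x) (hapd x), hz, hz, h0]
    ring
  have h := sum_matrix_mul_pderivAt_nonneg hg hmin s
  simp only [forwardOp, h1, h2, Finset.sum_const_zero, neg_zero, zero_add, hs]
  linarith

theorem integral_mul_pderivAt {u v : EuclideanSpace ℝ (Fin n) → ℝ} (hu : ContDiff ℝ 1 u)
    (hv : ContDiff ℝ 1 v) (hc : HasCompactSupport u) (i : Fin n) :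
    ∫ x, u x * pderivAt i v x = -∫ x, pderivAt i u x * v x := by
  have hcd : HasCompactSupport (pderivAt i u) := hc.fderiv_apply (𝕜 := ℝ) _
  exact integral_mul_fderiv_eq_neg_fderiv_mul_of_integrable
    (((continuous_pderivAt hu i).mul hv.continuous).integrable_of_hasCompactSupport hcd.mul_right)
    ((hu.continuous.mul (continuous_pderivAt hv i)).integrable_of_hasCompactSupport hc.mul_right)
    ((hu.continuous.mul hv.continuous).integrable_of_hasCompactSupport hc.mul_right)
    (fun x _ => (hu.differentiable one_ne_zero).differentiableAt)
    (fun x _ => (hv.differentiable one_ne_zero).differentiableAt)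

theorem HasCompactSupport.pderivAt {u : EuclideanSpace ℝ (Fin n) → ℝ} (hc : HasCompactSupport u)
    (i : Fin n) : HasCompactSupport (_root_.pderivAt i u) := hc.fderiv_apply (𝕜 := ℝ) _

theorem backwardOp_eq_zero_of_notMem_tsupport {φ : EuclideanSpace ℝ (Fin n) → ℝ}
    {x : EuclideanSpace ℝ (Fin n)} (hx : x ∉ tsupport φ) : backwardOp b a φ x = 0 := by
  have h1 : ∀ i, pderivAt i φ x = 0 := fun i =>
    image_eq_zero_of_notMem_tsupport fun h => hx (tsupport_fderiv_apply_subset ℝ _ h)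
  have h2 : ∀ i j, pderivAt i (pderivAt j φ) x = 0 := fun i j =>
    image_eq_zero_of_notMem_tsupport fun h =>
      hx (tsupport_fderiv_apply_subset ℝ _ (tsupport_fderiv_apply_subset ℝ _ h))
  simp [backwardOp, h1, h2]

theorem HasCompactSupport.backwardOp {φ : EuclideanSpace ℝ (Fin n) → ℝ}
    (hc : HasCompactSupport φ) : HasCompactSupport (_root_.backwardOp b a φ) :=
  HasCompactSupport.intro hc fun _ hx => backwardOp_eq_zero_of_notMem_tsupport hx

/-- The forward and the backward operator are formally adjoint. -/
theorem integral_mul_forwardOp (hb : ContDiff ℝ 1 b) (ha : ∀ i j, ContDiff ℝ 2 fun y => a y i j)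
    {φ g : EuclideanSpace ℝ (Fin n) → ℝ} (hφ : ContDiff ℝ 2 φ) (hc : HasCompactSupport φ)
    (hg : ContDiff ℝ 2 g) :
    ∫ x, φ x * forwardOp b a g x = ∫ x, g x * backwardOp b a φ x := by
  have hbi : ∀ i, ContDiff ℝ 1 fun y => b y i := fun i => (contDiff_euclidean.1 hb) i
  have hbg : ∀ i, ContDiff ℝ 1 fun y => b y i * g y := fun i => (hbi i).mul (hg.of_le one_le_two)
  have hag : ∀ i j, ContDiff ℝ 2 fun y => a y i j * g y := fun i j => (ha i j).mul hg
  have hφ1 : ContDiff ℝ 1 φ := hφ.of_le one_le_two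
  have e1 : ∀ i, ∫ x, φ x * pderivAt i (fun y => b y i * g y) x =
      -∫ x, g x * (b x i * pderivAt i φ x) := fun i => by
    rw [integral_mul_pderivAt hφ1 (hbg i) hc]
    congr 1
    refine integral_congr_ae (Eventually.of_forall fun x => ?_)
    simp only
    ring
  have e2 : ∀ i j, ∫ x, φ x * pderivAt i (pderivAt j fun y => a y i j * g y) x =
      ∫ x, g x * (a x i j * pderivAt j (pderivAt i φ) x) := fun i j => by
    rw [integral_mul_pderivAt hφ1 (contDiff_one_pderivAt (hag i j) j) hc,
      integral_mul_pderivAt (contDiff_one_pderivAt hφ i) ((hag i j).of_le one_le_two)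
        (hc.pderivAt i), neg_neg]
    refine integral_congr_ae (Eventually.of_forall fun x => ?_)
    simp only
    ring
  have i1 : ∀ i, Integrable fun x => φ x * pderivAt i (fun y => b y i * g y) x := fun i =>
    (hφ.continuous.mul (continuous_pderivAt (hbg i) i)).integrable_of_hasCompactSupport hc.mul_right
  have i2 : ∀ i j, Integrable fun x => φ x * pderivAt i (pderivAt j fun y => a y i j * g y) x :=
    fun i j => (hφ.continuous.mul (continuous_pderivAt (contDiff_one_pderivAt (hag i j) j)
      i)).integrable_of_hasCompactSupport hc.mul_right
  have i3 : ∀ i, Integrable fun x => g x * (b x i * pderivAt i φ x) := fun i =>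
    (hg.continuous.mul ((hbi i).continuous.mul
      (continuous_pderivAt hφ1 i))).integrable_of_hasCompactSupport (hc.pderivAt i).mul_left.mul_left
  have i4 : ∀ i j, Integrable fun x => g x * (a x i j * pderivAt i (pderivAt j φ) x) := fun i j =>
    (hg.continuous.mul ((ha i j).continuous.mul (continuous_pderivAt (contDiff_one_pderivAt hφ j)
      i))).integrable_of_hasCompactSupport ((hc.pderivAt j).pderivAt i).mul_left.mul_left
  -- Two integrations by parts return the second derivatives of φ in the opposite order.
  have hsymm : ∀ i j x, pderivAt j (pderivAt i φ) x = pderivAt i (pderivAt j φ) x := fun i j x => by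
    have hs : IsSymmSndFDerivAt ℝ φ x := hφ.contDiffAt.isSymmSndFDerivAt (by simp)
    have hd : DifferentiableAt ℝ (fderiv ℝ φ) x :=
      ((hφ.fderiv_right (m := 1) le_rfl).differentiable one_ne_zero).differentiableAt
    have hp : ∀ k l, pderivAt l (pderivAt k φ) x =
        fderiv ℝ (fderiv ℝ φ) x (EuclideanSpace.single l 1) (EuclideanSpace.single k 1) :=
      fun k l => by
        change fderiv ℝ (fun y => fderiv ℝ φ y (EuclideanSpace.single k 1)) x _ = _
        rw [fderiv_clm_apply hd (differentiableAt_const _)]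
        simp
    rw [hp, hp]
    exact hs _ _
  calc ∫ x, φ x * forwardOp b a g x
      = ∫ x, (-(∑ i, φ x * pderivAt i (fun y => b y i * g y) x) +
          1 / 2 * ∑ i, ∑ j, φ x * pderivAt i (pderivAt j fun y => a y i j * g y) x) := by
        refine integral_congr_ae (Eventually.of_forall fun x => ?_)
        simp only [forwardOp, ← Finset.mul_sum]
        ring
    _ = ∑ i, (∫ x, g x * (b x i * pderivAt i φ x)) +
          1 / 2 * ∑ i, ∑ j, ∫ x, g x * (a x i j * pderivAt i (pderivAt j φ) x) := by
        rw [integral_add, integral_neg, integral_const_mul, integral_finsetSum _ fun i _ => i1 i,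
          integral_finsetSum]
        · simp only [e1, Finset.sum_neg_distrib, neg_neg]
          congr 2
          refine Finset.sum_congr rfl fun i _ => ?_
          rw [integral_finsetSum _ fun j _ => i2 i j]
          refine Finset.sum_congr rfl fun j _ => ?_
          rw [e2]
          simp only [hsymm]
        · exact fun i _ => integrable_finsetSum _ fun j _ => i2 i j
        · exact (integrable_finsetSum _ fun i _ => i1 i).neg
        · exact (integrable_finsetSum _ fun i _ =>
            integrable_finsetSum _ fun j _ => i2 i j).const_mul _
    _ = ∫ x, (∑ i, g x * (b x i * pderivAt i φ x) +
          1 / 2 * ∑ i, ∑ j, g x * (a x i j * pderivAt i (pderivAt j φ) x)) := by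
        rw [integral_add, integral_const_mul, integral_finsetSum _ fun i _ => i3 i,
          integral_finsetSum]
        · congr 2
          refine Finset.sum_congr rfl fun i _ => ?_
          rw [integral_finsetSum _ fun j _ => i4 i j]
        · exact fun i _ => integrable_finsetSum _ fun j _ => i4 i j
        · exact integrable_finsetSum _ fun i _ => i3 i
        · exact (integrable_finsetSum _ fun i _ =>
            integrable_finsetSum _ fun j _ => i4 i j).const_mul _
    _ = _ := by
        refine integral_congr_ae (Eventually.of_forall fun x => ?_)
        simp only [backwardOp, ← Finset.mul_sum]
        ring

end SecondOrder

/-! ### The logarithmic cutoff and the one-sided growth condition. -/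

section Cutoff

variable {n m : ℕ}

theorem hasDerivAt_posPart_pow (k : ℕ) (y : ℝ) :
    HasDerivAt (fun y : ℝ => (max y 0) ^ (k + 2)) ((k + 2) * (max y 0) ^ (k + 1)) y := by
  rcases lt_trichotomy y 0 with hy | rfl | hy
  · have h : (fun y : ℝ => (max y 0) ^ (k + 2)) =ᶠ[𝓝 y] fun _ => 0 := by
      filter_upwards [eventually_lt_nhds hy] with z hz
      rw [max_eq_right hz.le]
      simp
    rw [max_eq_right hy.le]
    simpa using (hasDerivAt_const y (0 : ℝ)).congr_of_eventuallyEq h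
  · rw [hasDerivAt_iff_isLittleO]
    simp only [max_self, ne_eq, Nat.add_eq_zero_iff, OfNat.ofNat_ne_zero, and_false,
      not_false_eq_true, zero_pow, one_ne_zero, mul_zero, smul_zero, sub_zero]
    refine Asymptotics.IsBigO.trans_isLittleO (g := fun y : ℝ => y ^ (k + 2))
      (Asymptotics.IsBigO.of_bound 1 (Eventually.of_forall fun y => ?_)) ?_
    · rw [one_mul, norm_pow, norm_pow, Real.norm_eq_abs, Real.norm_eq_abs]
      refine pow_le_pow_left₀ (abs_nonneg _) ?_ _
      rw [abs_of_nonneg (le_max_right y 0)]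
      exact max_le (le_abs_self y) (abs_nonneg y)
    · simpa using Asymptotics.isLittleO_pow_pow (𝕜 := ℝ) (show 1 < k + 2 by omega)
  · have h : (fun y : ℝ => (max y 0) ^ (k + 2)) =ᶠ[𝓝 y] fun y => y ^ (k + 2) := by
      filter_upwards [eventually_gt_nhds hy] with z hz
      rw [max_eq_left (le_of_lt hz)]
    rw [max_eq_left hy.le]
    have := (hasDerivAt_pow (k + 2) y).congr_of_eventuallyEq h
    simpa using this

/-- Three is the least integer power of the positive part that is C², which fixes the exponent in
`logCutoff`. -/
theorem contDiff_posPart_cube : ContDiff ℝ 2 fun y : ℝ => (max y 0) ^ 3 := by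
  have h1 : deriv (fun y : ℝ => (max y 0) ^ 3) = fun y => 3 * (max y 0) ^ 2 := by
    funext y
    rw [(hasDerivAt_posPart_pow 1 y).deriv]
    norm_num
  have h2 : deriv (fun y : ℝ => (max y 0) ^ 2) = fun y => 2 * max y 0 := by
    funext y
    rw [(hasDerivAt_posPart_pow 0 y).deriv]
    norm_num
  have hC1 : ContDiff ℝ 1 fun y : ℝ => (max y 0) ^ 2 := by
    rw [contDiff_one_iff_deriv, h2]
    exact ⟨fun y => (hasDerivAt_posPart_pow 0 y).differentiableAt, by fun_prop⟩
  rw [show (2 : WithTop ℕ∞) = 1 + 1 by norm_num, contDiff_succ_iff_deriv]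
  refine ⟨fun y => (hasDerivAt_posPart_pow 1 y).differentiableAt, by simp, ?_⟩
  rw [h1]
  exact contDiff_const.mul hC1

theorem posPart_cube_tangent_le (y y₀ : ℝ) :
    (max y₀ 0) ^ 3 + 3 * (max y₀ 0) ^ 2 * (y - y₀) ≤ (max y 0) ^ 3 := by
  have hA : 0 ≤ max y 0 := le_max_right _ _
  have hyA : y ≤ max y 0 := le_max_left _ _
  rcases le_total y₀ 0 with h | h
  · rw [max_eq_right h]
    simp only [ne_eq, OfNat.ofNat_ne_zero, not_false_eq_true, zero_pow, mul_zero, zero_mul,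
      add_zero]
    positivity
  · rw [max_eq_left h]
    have h1 : 3 * y₀ ^ 2 * (y - y₀) ≤ 3 * y₀ ^ 2 * (max y 0 - y₀) := by gcongr
    nlinarith [mul_nonneg (sq_nonneg (max y 0 - y₀)) (by positivity : 0 ≤ max y 0 + 2 * y₀)]

/-- A `C²` cutoff function which varies slowly with respect to `1 + ‖x‖²`. -/
def logCutoff (δ : ℝ) (x : EuclideanSpace ℝ (Fin n)) : ℝ :=
  (max (1 - δ * Real.log (1 + ‖x‖ ^ 2)) 0) ^ 3

theorem logCutoff_nonneg (δ : ℝ) (x : EuclideanSpace ℝ (Fin n)) : 0 ≤ logCutoff δ x :=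
  pow_nonneg (le_max_right _ _) 3

theorem logCutoff_le_one {δ : ℝ} (hδ : 0 ≤ δ) (x : EuclideanSpace ℝ (Fin n)) :
    logCutoff δ x ≤ 1 := by
  have h : 0 ≤ Real.log (1 + ‖x‖ ^ 2) := Real.log_nonneg (by nlinarith [sq_nonneg ‖x‖])
  refine pow_le_one₀ (le_max_right _ _) (max_le ?_ zero_le_one)
  nlinarith [mul_nonneg hδ h]

theorem contDiff_logCutoff (δ : ℝ) :
    ContDiff ℝ 2 (logCutoff δ : EuclideanSpace ℝ (Fin n) → ℝ) := by
  refine contDiff_posPart_cube.comp (contDiff_const.sub (contDiff_const.mul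
    (ContDiff.log (contDiff_const.add (contDiff_norm_sq ℝ)) fun x => ?_)))
  positivity

theorem hasCompactSupport_logCutoff {δ : ℝ} (hδ : 0 < δ) :
    HasCompactSupport (logCutoff δ : EuclideanSpace ℝ (Fin n) → ℝ) := by
  refine HasCompactSupport.intro
    (isCompact_closedBall (0 : EuclideanSpace ℝ (Fin n)) (Real.exp (1 / δ))) fun x hx => ?_
  rw [Metric.mem_closedBall, dist_zero_right, not_le] at hx
  have h1 : Real.exp (1 / δ) ≤ 1 + ‖x‖ ^ 2 := by nlinarith [Real.exp_pos (1 / δ)]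
  have h2 : 1 / δ ≤ Real.log (1 + ‖x‖ ^ 2) := (Real.le_log_iff_exp_le (by positivity)).2 h1
  rw [div_le_iff₀ hδ] at h2
  rw [logCutoff, max_eq_right (by linarith)]
  simp

theorem tendsto_logCutoff (x : EuclideanSpace ℝ (Fin n)) :
    Tendsto (fun δ : ℝ => logCutoff δ x) (𝓝[>] 0) (𝓝 1) := by
  have h : Continuous fun δ : ℝ => logCutoff δ x := by unfold logCutoff; fun_prop
  have h2 := h.tendsto 0
  rw [show logCutoff 0 x = 1 by simp [logCutoff]] at h2
  exact h2.mono_left nhdsWithin_le_nhds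

variable {b : EuclideanSpace ℝ (Fin n) → EuclideanSpace ℝ (Fin n)}
  {a : EuclideanSpace ℝ (Fin n) → Matrix (Fin n) (Fin n) ℝ}

theorem pderivAt_one_add_norm_sq (i : Fin n) :
    pderivAt i (fun y : EuclideanSpace ℝ (Fin n) => 1 + ‖y‖ ^ 2) = fun y => 2 * y i := by
  funext y
  rw [pderivAt, fderiv_const_add, fderiv_norm_sq_apply]
  simp [EuclideanSpace.inner_single_right]

/-- Turns the growth hypothesis into LV ≤ KV for the function V = 1 + ‖x‖². -/
theorem backwardOp_one_add_norm_sq (x : EuclideanSpace ℝ (Fin n)) :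
    backwardOp b a (fun y => 1 + ‖y‖ ^ 2) x = 2 * inner ℝ x (b x) + (a x).trace := by
  have h2 : ∀ i j, pderivAt i (fun y : EuclideanSpace ℝ (Fin n) => 2 * y j) x =
      if j = i then 2 else 0 := fun i j => by
    have hd : HasFDerivAt (fun y : EuclideanSpace ℝ (Fin n) => 2 * y j)
        ((2 : ℝ) • (EuclideanSpace.proj j : EuclideanSpace ℝ (Fin n) →L[ℝ] ℝ)) x :=
      ((EuclideanSpace.proj j : EuclideanSpace ℝ (Fin n) →L[ℝ] ℝ).hasFDerivAt).const_mul 2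
    rw [pderivAt, hd.fderiv]
    simp
  simp only [backwardOp, pderivAt_one_add_norm_sq, h2]
  simp only [mul_ite, mul_zero, Finset.sum_ite_eq', Finset.mem_univ, if_true, Matrix.trace,
    Matrix.diag, PiLp.inner_apply, Finset.mul_sum]
  congr 1
  · refine Finset.sum_congr rfl fun i _ => ?_
    simp
    ring
  · refine Finset.sum_congr rfl fun i _ => ?_
    ring

/-- The cutoff is convex as a function of V = 1 + ‖x‖², so it lies above its tangent in V. Adding
cV, with −c the slope of that tangent, produces a minimum at x, whence L(cutoff) ≥ −c LV ≥ −cKV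
there. No second derivative of the cutoff is computed, and only an upper bound on LV is used. -/
theorem neg_le_backwardOp_logCutoff {s : EuclideanSpace ℝ (Fin n) → Matrix (Fin n) (Fin m) ℝ}
    (hs : ∀ x, a x = s x * (s x).transpose) {K δ : ℝ} (hK : 0 ≤ K) (hδ : 0 ≤ δ)
    (hgrowth : ∀ x, 2 * inner ℝ x (b x) + (a x).trace ≤ K * (1 + ‖x‖ ^ 2))
    (x : EuclideanSpace ℝ (Fin n)) : -(3 * K * δ) ≤ backwardOp b a (logCutoff δ) x := by
  set V₀ := 1 + ‖x‖ ^ 2 with hV₀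
  set B := max (1 - δ * Real.log V₀) 0 with hB
  have hV₀pos : 0 < V₀ := by positivity
  have hB0 : 0 ≤ B := le_max_right _ _
  have hB1 : B ≤ 1 := by
    have h : 0 ≤ Real.log V₀ := Real.log_nonneg (by rw [hV₀]; nlinarith [sq_nonneg ‖x‖])
    exact max_le (by nlinarith [mul_nonneg hδ h]) zero_le_one
  -- Minus the derivative of (1 − δ log V)₊³ at `V₀`; then cKV₀ = 3KδB² is bounded uniformly in x.
  set c := 3 * B ^ 2 * δ / V₀ with hc
  have hc0 : 0 ≤ c := by positivity
  have hV : ContDiff ℝ 2 fun y : EuclideanSpace ℝ (Fin n) => 1 + ‖y‖ ^ 2 :=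
    contDiff_const.add (contDiff_norm_sq ℝ)
  have hmin : IsLocalMin (fun y => logCutoff δ y + c * (1 + ‖y‖ ^ 2)) x := by
    refine Eventually.of_forall fun y => ?_
    have h1 := posPart_cube_tangent_le (1 - δ * Real.log (1 + ‖y‖ ^ 2)) (1 - δ * Real.log V₀)
    have hy : 0 < 1 + ‖y‖ ^ 2 := by positivity
    have h2 : Real.log (1 + ‖y‖ ^ 2) - Real.log V₀ ≤ (1 + ‖y‖ ^ 2 - V₀) / V₀ := by
      rw [← Real.log_div hy.ne' hV₀pos.ne']
      refine (Real.log_le_sub_one_of_pos (by positivity)).trans (le_of_eq ?_)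
      field_simp
    have h3 : 3 * B ^ 2 * δ * (Real.log (1 + ‖y‖ ^ 2) - Real.log V₀) ≤
        3 * B ^ 2 * δ * ((1 + ‖y‖ ^ 2 - V₀) / V₀) := by gcongr
    have h4 : 3 * B ^ 2 * δ * ((1 + ‖y‖ ^ 2 - V₀) / V₀) = c * (1 + ‖y‖ ^ 2) - c * V₀ := by
      rw [hc]; ring
    simp only [logCutoff]
    rw [← hV₀, ← hB] at *
    nlinarith
  have h := backwardOp_nonneg_of_isLocalMin (b := b) ((contDiff_logCutoff δ).add
    (contDiff_const.mul hV)) hmin (hs x)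
  rw [backwardOp_add (contDiff_logCutoff δ) (contDiff_const.mul hV), backwardOp_const_mul hV,
    backwardOp_one_add_norm_sq] at h
  have h5 : c * (2 * inner ℝ x (b x) + (a x).trace) ≤ c * (K * V₀) :=
    mul_le_mul_of_nonneg_left (hgrowth x) hc0
  have h6 : c * (K * V₀) = 3 * K * δ * B ^ 2 := by
    rw [hc]; field_simp
  have h7 : 3 * K * δ * B ^ 2 ≤ 3 * K * δ :=
    mul_le_of_le_one_right (by positivity) (pow_le_one₀ hB0 hB1)
  linarith

end Cutoff

/-! ### The concave functional yz/(y+z) under the forward operator. -/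

section HarmonicMean

variable {n m : ℕ}

/-- The supporting linear functions of the concave function `y z / (y + z)`. -/
theorem mul_div_add_le {y z l : ℝ} (hy : 0 ≤ y) (hz : 0 ≤ z) :
    y * z / (y + z) ≤ l ^ 2 * y + (1 - l) ^ 2 * z := by
  rcases (add_nonneg hy hz).eq_or_lt with h | h
  · rw [← h, div_zero]; positivity
  · rw [div_le_iff₀ h]
    nlinarith [sq_nonneg (l * y - (1 - l) * z)]

/-- Equality case of `mul_div_add_le`: for l = z/(y+z) the weights l² and (1−l)² are the partial
derivatives of yz/(y+z). -/
theorem mul_div_add_eq (y z : ℝ) (h : y + z ≠ 0) :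
    y * z / (y + z) = (z / (y + z)) ^ 2 * y + (1 - z / (y + z)) ^ 2 * z := by
  field_simp
  ring

variable {b : EuclideanSpace ℝ (Fin n) → EuclideanSpace ℝ (Fin n)}
  {a : EuclideanSpace ℝ (Fin n) → Matrix (Fin n) (Fin n) ℝ}

/-- With l frozen at x, l²p + (1−l)²q − pq/(p+q) is nonnegative and vanishes at x. The minimum
principle applied to it gives the claim by linearity of L*. Homogeneity of degree one matters: the
supporting function has no constant term. -/
theorem forwardOp_mul_div_add_le (hb : ContDiff ℝ 1 b) (ha : ∀ i j, ContDiff ℝ 2 fun y => a y i j)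
    {p q : EuclideanSpace ℝ (Fin n) → ℝ} (hp : ContDiff ℝ 2 p) (hq : ContDiff ℝ 2 q)
    (hp0 : ∀ x, 0 < p x) (hq0 : ∀ x, 0 < q x) {x : EuclideanSpace ℝ (Fin n)}
    {s : Matrix (Fin n) (Fin m) ℝ} (hs : a x = s * s.transpose) :
    forwardOp b a (fun y => p y * q y / (p y + q y)) x ≤
      (q x / (p x + q x)) ^ 2 * forwardOp b a p x +
        (1 - q x / (p x + q x)) ^ 2 * forwardOp b a q x := by
  set l := q x / (p x + q x) with hl
  have hG : ContDiff ℝ 2 fun y => p y * q y / (p y + q y) :=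
    (hp.mul hq).div (hp.add hq) fun y => (add_pos (hp0 y) (hq0 y)).ne'
  have h1 : ContDiff ℝ 2 fun y => l ^ 2 * p y := contDiff_const.mul hp
  have h2 : ContDiff ℝ 2 fun y => (1 - l) ^ 2 * q y := contDiff_const.mul hq
  have h3 : ContDiff ℝ 2 fun y => -1 * (p y * q y / (p y + q y)) := contDiff_const.mul hG
  have h12 : ContDiff ℝ 2 fun y => l ^ 2 * p y + (1 - l) ^ 2 * q y := h1.add h2
  have hx0 : l ^ 2 * p x + (1 - l) ^ 2 * q x + -1 * (p x * q x / (p x + q x)) = 0 := by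
    rw [mul_div_add_eq _ _ (add_pos (hp0 x) (hq0 x)).ne', ← hl]
    ring
  have h := forwardOp_nonneg_of_isLocalMin hb ha (h12.add h3) (x := x)
    (Eventually.of_forall fun y => by
      have := mul_div_add_le (l := l) (hp0 y).le (hq0 y).le
      dsimp only
      rw [hx0]
      linarith) hx0 hs
  rw [forwardOp_add hb ha h12 h3, forwardOp_add hb ha h1 h2, forwardOp_const_mul hb ha hp,
    forwardOp_const_mul hb ha hq, forwardOp_const_mul hb ha hG] at h
  linarith

/-- The dissipation inequality: `L* (p q / (p + q))` is dominated by the derivative of `p q / (p + q)`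
in the direction `(L* p, L* q)`, in the weak sense and without positivity of `p` and `q`. -/
theorem integral_mul_div_add_mul_backwardOp_le (hb : ContDiff ℝ 1 b)
    (ha : ∀ i j, ContDiff ℝ 2 fun y => a y i j)
    {s : EuclideanSpace ℝ (Fin n) → Matrix (Fin n) (Fin m) ℝ}
    (hs : ∀ x, a x = s x * (s x).transpose)
    {p q φ : EuclideanSpace ℝ (Fin n) → ℝ} (hp : ContDiff ℝ 2 p) (hq : ContDiff ℝ 2 q)
    (hp0 : ∀ x, 0 ≤ p x) (hq0 : ∀ x, 0 ≤ q x) (hpq : ∀ᵐ x, 0 < p x + q x)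
    (hφ : ContDiff ℝ 2 φ) (hφc : HasCompactSupport φ) (hφ0 : ∀ x, 0 ≤ φ x) :
    ∫ x, p x * q x / (p x + q x) * backwardOp b a φ x ≤
      ∫ x, φ x * ((q x / (p x + q x)) ^ 2 * forwardOp b a p x +
        (1 - q x / (p x + q x)) ^ 2 * forwardOp b a q x) := by
  -- The densities are shifted by ε > 0 to become positive everywhere. The forward operator has a
  -- zeroth-order part, so each shift contributes ε L*1; dominated convergence removes it as ε → 0.
  set c : EuclideanSpace ℝ (Fin n) → ℝ := forwardOp b a fun _ => 1 with hc
  have hcc : Continuous c := continuous_forwardOp hb ha contDiff_const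
  have hLp : Continuous (forwardOp b a p) := continuous_forwardOp hb ha hp
  have hLq : Continuous (forwardOp b a q) := continuous_forwardOp hb ha hq
  have hLφ : Continuous (backwardOp b a φ) :=
    continuous_backwardOp hb.continuous (fun i j => (ha i j).continuous) hφ
  have hadd : ∀ g : EuclideanSpace ℝ (Fin n) → ℝ, ContDiff ℝ 2 g → ∀ ε x,
      forwardOp b a (fun y => g y + ε) x = forwardOp b a g x + ε * c x := fun g hg ε x => by
    have h := forwardOp_add hb ha hg (h := fun _ => ε * 1) contDiff_const x
    rw [forwardOp_const_mul hb ha contDiff_const] at h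
    simpa only [mul_one] using h
  have hl01 : ∀ (y z : ℝ), 0 ≤ y → 0 ≤ z → 0 ≤ z / (y + z) ∧ z / (y + z) ≤ 1 := fun y z hy hz =>
    ⟨by positivity, div_le_one_of_le₀ (by linarith) (by linarith)⟩
  have hG : ∀ ε : ℝ, 0 < ε → ContDiff ℝ 2 fun y => (p y + ε) * (q y + ε) / (p y + ε + (q y + ε)) :=
    fun ε hε => ((hp.add contDiff_const).mul (hq.add contDiff_const)).div
      ((hp.add contDiff_const).add (hq.add contDiff_const)) fun y => by
        have := hp0 y; have := hq0 y; positivity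
  have hineq : ∀ ε : ℝ, 0 < ε →
      ∫ x, (p x + ε) * (q x + ε) / (p x + ε + (q x + ε)) * backwardOp b a φ x ≤
      ∫ x, φ x * (((q x + ε) / (p x + ε + (q x + ε))) ^ 2 * (forwardOp b a p x + ε * c x) +
        (1 - (q x + ε) / (p x + ε + (q x + ε))) ^ 2 * (forwardOp b a q x + ε * c x)) := by
    intro ε hε
    have hden : ∀ x, p x + ε + (q x + ε) ≠ 0 := fun x => by
      have := hp0 x; have := hq0 x; positivity
    have hlc : Continuous fun x => (q x + ε) / (p x + ε + (q x + ε)) :=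
      (hq.continuous.add continuous_const).div
        ((hp.continuous.add continuous_const).add (hq.continuous.add continuous_const)) hden
    rw [← integral_mul_forwardOp hb ha hφ hφc (hG ε hε)]
    refine integral_mono ?_ ?_ fun x => mul_le_mul_of_nonneg_left ?_ (hφ0 x)
    · exact (hφ.continuous.mul
        (continuous_forwardOp hb ha (hG ε hε))).integrable_of_hasCompactSupport hφc.mul_right
    · exact Continuous.integrable_of_hasCompactSupport (by fun_prop) hφc.mul_right
    · have h := forwardOp_mul_div_add_le hb ha (p := fun y => p y + ε) (q := fun y => q y + ε)
        (hp.add contDiff_const) (hq.add contDiff_const) (fun y => by have := hp0 y; positivity)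
        (fun y => by have := hq0 y; positivity) (hs x)
      rwa [hadd p hp, hadd q hq] at h
  refine le_of_tendsto_of_tendsto
    (f := fun ε : ℝ => ∫ x, (p x + ε) * (q x + ε) / (p x + ε + (q x + ε)) * backwardOp b a φ x)
    (g := fun ε : ℝ =>
      ∫ x, φ x * (((q x + ε) / (p x + ε + (q x + ε))) ^ 2 * (forwardOp b a p x + ε * c x) +
        (1 - (q x + ε) / (p x + ε + (q x + ε))) ^ 2 * (forwardOp b a q x + ε * c x)))
    (b := 𝓝[>] 0) ?_ ?_ ?_
  · refine tendsto_integral_filter_of_dominated_convergence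
      (fun x => (p x + q x + 2) * |backwardOp b a φ x|) ?_ ?_ ?_ ?_
    · filter_upwards [self_mem_nhdsWithin] with ε hε
      exact ((hG ε hε).continuous.mul hLφ).aestronglyMeasurable
    · filter_upwards [self_mem_nhdsWithin, nhdsWithin_le_nhds (eventually_le_nhds one_pos)]
        with ε hε hε1
      have hε' : 0 < ε := hε
      refine Eventually.of_forall fun x => ?_
      have h1 := hp0 x
      have h2 := hq0 x
      rw [norm_mul, Real.norm_eq_abs, Real.norm_eq_abs]
      refine mul_le_mul_of_nonneg_right ?_ (abs_nonneg _)
      rw [abs_of_nonneg (by positivity), div_le_iff₀ (by positivity)]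
      nlinarith [mul_nonneg h1 h2, mul_nonneg h1 h1, mul_nonneg h2 h2]
    · exact Continuous.integrable_of_hasCompactSupport (by fun_prop)
        (HasCompactSupport.mul_left hφc.backwardOp.abs)
    · filter_upwards [hpq] with x hx
      have h : ContinuousAt (fun ε : ℝ =>
          (p x + ε) * (q x + ε) / (p x + ε + (q x + ε)) * backwardOp b a φ x) 0 := by
        refine ContinuousAt.mul (ContinuousAt.div (by fun_prop) (by fun_prop) ?_) (by fun_prop)
        simpa using hx.ne'
      have h2 := h.tendsto
      simp only [add_zero] at h2
      exact h2.mono_left nhdsWithin_le_nhds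
  · refine tendsto_integral_filter_of_dominated_convergence
      (fun x => |φ x| * (|forwardOp b a p x| + |c x| + (|forwardOp b a q x| + |c x|))) ?_ ?_ ?_ ?_
    · filter_upwards [self_mem_nhdsWithin] with ε hε
      have hε' : 0 < ε := hε
      have hden : ∀ x, p x + ε + (q x + ε) ≠ 0 := fun x => by
        have := hp0 x; have := hq0 x; positivity
      have hlc : Continuous fun x => (q x + ε) / (p x + ε + (q x + ε)) :=
        (hq.continuous.add continuous_const).div
          ((hp.continuous.add continuous_const).add (hq.continuous.add continuous_const)) hden
      exact Continuous.aestronglyMeasurable (by fun_prop)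
    · filter_upwards [self_mem_nhdsWithin, nhdsWithin_le_nhds (eventually_le_nhds one_pos)]
        with ε hε hε1
      have hε' : 0 < ε := hε
      refine Eventually.of_forall fun x => ?_
      obtain ⟨h1, h2⟩ := hl01 (p x + ε) (q x + ε) (by linarith [hp0 x]) (by linarith [hq0 x])
      set l := (q x + ε) / (p x + ε + (q x + ε))
      have hterm : ∀ y k : ℝ, 0 ≤ k → k ≤ 1 → |k ^ 2 * (y + ε * c x)| ≤ |y| + |c x| := by
        intro y k hk hk1
        rw [abs_mul, abs_of_nonneg (by positivity)]
        refine (mul_le_of_le_one_left (abs_nonneg _) (pow_le_one₀ hk hk1)).trans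
          ((abs_add_le _ _).trans (add_le_add le_rfl ?_))
        rw [abs_mul, abs_of_pos hε']
        exact mul_le_of_le_one_left (abs_nonneg _) hε1
      rw [norm_mul, Real.norm_eq_abs, Real.norm_eq_abs]
      exact mul_le_mul_of_nonneg_left ((abs_add_le _ _).trans (add_le_add (hterm _ _ h1 h2)
        (hterm _ _ (by linarith) (by linarith)))) (abs_nonneg _)
    · exact Continuous.integrable_of_hasCompactSupport (by fun_prop)
        (HasCompactSupport.mul_right hφc.abs)
    · filter_upwards [hpq] with x hx
      have h0 : ContinuousAt (fun ε : ℝ => (q x + ε) / (p x + ε + (q x + ε))) 0 := by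
        refine ContinuousAt.div (by fun_prop) (by fun_prop) ?_
        simpa using hx.ne'
      have h : ContinuousAt (fun ε : ℝ =>
          φ x * (((q x + ε) / (p x + ε + (q x + ε))) ^ 2 * (forwardOp b a p x + ε * c x) +
        (1 - (q x + ε) / (p x + ε + (q x + ε))) ^ 2 * (forwardOp b a q x + ε * c x))) 0 := by
        fun_prop
      have h2 := h.tendsto
      simp only [add_zero, zero_mul] at h2
      exact h2.mono_left nhdsWithin_le_nhds
  · filter_upwards [self_mem_nhdsWithin] with ε hε
    exact hineq ε hε

end HarmonicMean

/-! ### L¹-differentiable curves of densities and the functional ∫ cd/(c+d). -/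

section L1Curves

variable {Ω : Type*} [MeasurableSpace Ω] {μ : Measure Ω} {c d : ℝ → PosDensity μ} {D : Ω → ℝ}
  {I : Set ℝ} {t : ℝ}

theorem HasL1DerivWithinAt.hasDerivWithinAt_integral (h : HasL1DerivWithinAt c D I t) {w : Ω → ℝ}
    (hw : AEStronglyMeasurable w μ) {C : ℝ} (hC : ∀ x, |w x| ≤ C) :
    HasDerivWithinAt (fun s => ∫ x, w x * (c s).toFun x ∂μ) (∫ x, w x * D x ∂μ) I t := by
  have hi : ∀ {g : Ω → ℝ}, Integrable g μ → Integrable (fun x => w x * g x) μ := fun hg =>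
    hg.bdd_mul (c := C) hw (Eventually.of_forall hC)
  rw [hasDerivWithinAt_iff_isLittleO]
  refine Asymptotics.IsBigO.trans_isLittleO (Asymptotics.IsBigO.of_bound C ?_) h.2
  refine Eventually.of_forall fun s => ?_
  have hint : Integrable (fun x => (c s).toFun x - (c t).toFun x - (s - t) * D x) μ :=
    ((c s).integrable.sub (c t).integrable).sub (h.1.const_mul _)
  have hi2 : Integrable (fun x => w x * (c s).toFun x - w x * (c t).toFun x) μ :=
    (hi (c s).integrable).sub (hi (c t).integrable)
  rw [Real.norm_of_nonneg (integral_nonneg fun x => abs_nonneg _), smul_eq_mul,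
    ← integral_const_mul, ← integral_sub (hi (c s).integrable) (hi (c t).integrable),
    ← integral_sub hi2 ((hi h.1).const_mul _),
    ← integral_const_mul]
  refine (norm_integral_le_integral_norm _).trans (integral_mono_of_nonneg
    (Eventually.of_forall fun x => norm_nonneg _) (hint.abs.const_mul C)
    (Eventually.of_forall fun x => ?_))
  dsimp only
  rw [show w x * (c s).toFun x - w x * (c t).toFun x - (s - t) * (w x * D x) =
    w x * ((c s).toFun x - (c t).toFun x - (s - t) * D x) by ring, norm_mul]
  exact mul_le_mul_of_nonneg_right (hC x) (norm_nonneg _)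

theorem HasL1DerivWithinAt.tendsto_integral_abs_sub (h : HasL1DerivWithinAt c D I t) :
    Tendsto (fun s => ∫ x, |(c s).toFun x - (c t).toFun x| ∂μ) (𝓝[I] t) (𝓝 0) := by
  have hst : Tendsto (fun s : ℝ => s - t) (𝓝[I] t) (𝓝 0) := by
    have : Tendsto (fun s : ℝ => s - t) (𝓝 t) (𝓝 (t - t)) := tendsto_id.sub_const t
    rw [sub_self] at this
    exact this.mono_left nhdsWithin_le_nhds
  have h1 := h.2.isBigO.trans_tendsto hst
  have h2 : Tendsto (fun s : ℝ => |s - t| * ∫ x, |D x| ∂μ) (𝓝[I] t) (𝓝 0) := by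
    simpa using hst.abs.mul_const (∫ x, |D x| ∂μ)
  have h3 := h1.add h2
  rw [add_zero] at h3
  refine squeeze_zero (fun s => integral_nonneg fun x => abs_nonneg _) (fun s => ?_) h3
  have hint : Integrable (fun x => (c s).toFun x - (c t).toFun x - (s - t) * D x) μ :=
    ((c s).integrable.sub (c t).integrable).sub (h.1.const_mul _)
  rw [← integral_const_mul, ← integral_add hint.abs (h.1.abs.const_mul _)]
  refine integral_mono ((c s).integrable.sub (c t).integrable).abs
    (hint.abs.add (h.1.abs.const_mul _)) fun x => ?_
  dsimp only
  rw [← abs_mul]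
  refine le_trans (le_of_eq ?_) (abs_add_le _ _)
  congr 1
  ring

theorem PosDensity.aestronglyMeasurable_mul_div_add (p q : PosDensity μ) :
    AEStronglyMeasurable (fun x => p.toFun x * q.toFun x / (p.toFun x + q.toFun x)) μ :=
  ((p.aemeasurable.mul q.aemeasurable).div
    (p.aemeasurable.add q.aemeasurable)).aestronglyMeasurable

theorem PosDensity.integrable_mul_div_add (p q : PosDensity μ) :
    Integrable (fun x => p.toFun x * q.toFun x / (p.toFun x + q.toFun x)) μ := by
  refine p.integrable.mono' (p.aestronglyMeasurable_mul_div_add q) ?_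
  filter_upwards [p.pos, q.pos] with x hp hq
  rw [Real.norm_of_nonneg (by positivity), div_le_iff₀ (by positivity)]
  nlinarith [mul_pos hp hq, mul_pos hp hp]

/-- From (y+z)/4 − yz/(y+z) = (y−z)²/(4(y+z)): the functional never exceeds 1/2, and equality forces
the densities to agree. -/
theorem PosDensity.eq_of_half_le_integral (p q : PosDensity μ)
    (h : 1 / 2 ≤ ∫ x, p.toFun x * q.toFun x / (p.toFun x + q.toFun x) ∂μ) : p = q := by
  have hi : Integrable (fun x => (p.toFun x + q.toFun x) / 4 -
      p.toFun x * q.toFun x / (p.toFun x + q.toFun x)) μ :=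
    ((p.integrable.add q.integrable).div_const 4).sub (p.integrable_mul_div_add q)
  have heq : ∀ᵐ x ∂μ, (p.toFun x + q.toFun x) / 4 -
      p.toFun x * q.toFun x / (p.toFun x + q.toFun x) =
      (p.toFun x - q.toFun x) ^ 2 / (4 * (p.toFun x + q.toFun x)) := by
    filter_upwards [p.pos, q.pos] with x hp hq
    field_simp
    ring
  have hnn : 0 ≤ᵐ[μ] fun x => (p.toFun x + q.toFun x) / 4 -
      p.toFun x * q.toFun x / (p.toFun x + q.toFun x) := by
    filter_upwards [heq, p.pos, q.pos] with x hx hp hq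
    rw [hx, Pi.zero_apply]
    positivity
  have h0 : ∫ x, ((p.toFun x + q.toFun x) / 4 -
      p.toFun x * q.toFun x / (p.toFun x + q.toFun x)) ∂μ = 0 := by
    refine le_antisymm ?_ (integral_nonneg_of_ae hnn)
    have hi2 : Integrable (fun x => (p.toFun x + q.toFun x) / 4) μ :=
      (p.integrable.add q.integrable).div_const 4
    rw [integral_sub hi2 (p.integrable_mul_div_add q),
      integral_div, integral_add p.integrable q.integrable, p.integral_eq_one, q.integral_eq_one]
    linarith
  refine PosDensity.ext_ae ?_
  filter_upwards [(integral_eq_zero_iff_of_nonneg_ae hnn hi).1 h0, heq, p.pos, q.pos]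
    with x hx hx2 hp hq
  rw [hx2, Pi.zero_apply, div_eq_zero_iff] at hx
  rcases hx with hx | hx
  · have := pow_eq_zero_iff (two_ne_zero) |>.1 hx
    linarith
  · exact absurd hx (by positivity)

/-- The supporting coefficients l² and (1−l)² lie in [0,1]. -/
theorem abs_mul_div_add_sub_le {y z y' z' : ℝ} (hy : 0 < y) (hz : 0 < z) (hy' : 0 < y')
    (hz' : 0 < z') :
    |y' * z' / (y' + z') - y * z / (y + z)| ≤ |y' - y| + |z' - z| := by
  have key : ∀ {y z y' z' : ℝ}, 0 < y → 0 < z → 0 < y' → 0 < z' →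
      y' * z' / (y' + z') - y * z / (y + z) ≤ |y' - y| + |z' - z| := by
    intro y z y' z' hy hz hy' hz'
    have h1 := mul_div_add_le (l := z / (y + z)) hy'.le hz'.le
    rw [mul_div_add_eq y z (by positivity)]
    set l := z / (y + z) with hl
    have hl0 : 0 ≤ l := by positivity
    have hl1 : l ≤ 1 := div_le_one_of_le₀ (by linarith) (by positivity)
    have h2 : l ^ 2 * (y' - y) ≤ |y' - y| :=
      (mul_le_mul_of_nonneg_left (le_abs_self _) (by positivity)).trans
        (mul_le_of_le_one_left (abs_nonneg _) (pow_le_one₀ hl0 hl1))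
    have h3 : (1 - l) ^ 2 * (z' - z) ≤ |z' - z| :=
      (mul_le_mul_of_nonneg_left (le_abs_self _) (by positivity)).trans
        (mul_le_of_le_one_left (abs_nonneg _) (pow_le_one₀ (by linarith) (by linarith)))
    linarith
  refine abs_sub_le_iff.2 ⟨key hy hz hy' hz', ?_⟩
  have := key hy' hz' hy hz
  rwa [abs_sub_comm y, abs_sub_comm z] at this

/-- The weighted mean of `c d / (c + d)` is continuous along curves which are continuous in
`L¹`. -/
theorem continuousWithinAt_integral_mul_div_add {w : Ω → ℝ} (hw : AEStronglyMeasurable w μ)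
    (hw1 : ∀ x, |w x| ≤ 1)
    (hc : Tendsto (fun s => ∫ x, |(c s).toFun x - (c t).toFun x| ∂μ) (𝓝[I] t) (𝓝 0))
    (hd : Tendsto (fun s => ∫ x, |(d s).toFun x - (d t).toFun x| ∂μ) (𝓝[I] t) (𝓝 0)) :
    ContinuousWithinAt (fun s => ∫ x, w x *
      ((c s).toFun x * (d s).toFun x / ((c s).toFun x + (d s).toFun x)) ∂μ) I t := by
  have hcd := hc.add hd
  rw [add_zero] at hcd
  refine tendsto_iff_norm_sub_tendsto_zero.2 (squeeze_zero (fun s => norm_nonneg _)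
    (fun s => ?_) hcd)
  have hi : ∀ s, Integrable (fun x => w x *
      ((c s).toFun x * (d s).toFun x / ((c s).toFun x + (d s).toFun x))) μ := fun s =>
    ((c s).integrable_mul_div_add (d s)).bdd_mul (c := 1) hw (Eventually.of_forall hw1)
  have h1 : Integrable (fun x => |(c s).toFun x - (c t).toFun x|) μ :=
    ((c s).integrable.sub (c t).integrable).abs
  have h2 : Integrable (fun x => |(d s).toFun x - (d t).toFun x|) μ :=
    ((d s).integrable.sub (d t).integrable).abs
  rw [← integral_sub (hi s) (hi t), ← integral_add h1 h2]
  refine (norm_integral_le_integral_norm _).trans (integral_mono_of_nonneg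
    (Eventually.of_forall fun x => norm_nonneg _) (h1.add h2) ?_)
  filter_upwards [(c s).pos, (c t).pos, (d s).pos, (d t).pos] with x p1 p2 p3 p4
  rw [← mul_sub, norm_mul]
  exact (mul_le_of_le_one_left (norm_nonneg _) (hw1 x)).trans
    (abs_mul_div_add_sub_le p2 p4 p1 p3)

end L1Curves

/-! ### Uniqueness for the Fokker-Planck equation. -/

section Uniqueness

variable {n m : ℕ}

/-- Uniqueness for the Fokker-Planck equation in the class of `L¹`-differentiable curves of positive
densities with `C²` versions, under the one-sided growth condition on the coefficients. -/
theorem eq_of_hasL1DerivWithinAt_forwardOp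
    {b : ℝ → EuclideanSpace ℝ (Fin n) → EuclideanSpace ℝ (Fin n)}
    {s : ℝ → EuclideanSpace ℝ (Fin n) → Matrix (Fin n) (Fin m) ℝ} {K t₁ T : ℝ} (hK : 0 ≤ K)
    (hT : t₁ ≤ T) (hb : ∀ t ∈ Icc t₁ T, ContDiff ℝ 1 (b t))
    (ha : ∀ t ∈ Icc t₁ T, ∀ i j, ContDiff ℝ 2 fun y => diffusionMatrix s t y i j)
    (hgrowth : ∀ t ∈ Icc t₁ T, ∀ x,
      2 * inner ℝ x (b t x) + (diffusionMatrix s t x).trace ≤ K * (1 + ‖x‖ ^ 2))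
    {c d : ℝ → PosDensity (volume : Measure (EuclideanSpace ℝ (Fin n)))}
    (hc : ∀ t ∈ Icc t₁ T, ∃ g, ContDiff ℝ 2 g ∧ (c t).toFun =ᵐ[volume] g ∧
      HasL1DerivWithinAt c (forwardOp (b t) (diffusionMatrix s t) g) (Icc t₁ T) t)
    (hd : ∀ t ∈ Icc t₁ T, ∃ g, ContDiff ℝ 2 g ∧ (d t).toFun =ᵐ[volume] g ∧
      HasL1DerivWithinAt d (forwardOp (b t) (diffusionMatrix s t) g) (Icc t₁ T) t)
    (h0 : c t₁ = d t₁) : c T = d T := by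
  set ψ : ℝ → ℝ → ℝ := fun δ t => ∫ x, logCutoff δ x *
    ((c t).toFun x * (d t).toFun x / ((c t).toFun x + (d t).toFun x)) with hψ
  have hφm : ∀ δ, AEStronglyMeasurable (logCutoff δ : EuclideanSpace ℝ (Fin n) → ℝ) volume :=
    fun δ => (contDiff_logCutoff δ).continuous.aestronglyMeasurable
  have hφ1 : ∀ δ : ℝ, 0 < δ → ∀ x : EuclideanSpace ℝ (Fin n), |logCutoff δ x| ≤ 1 :=
    fun δ hδ x => by
      rw [abs_of_nonneg (logCutoff_nonneg δ x)]
      exact logCutoff_le_one hδ.le x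
  -- Monotonicity in time, up to the cost 3Kδ per unit of time caused by the cutoff.
  have hkey : ∀ δ : ℝ, 0 < δ → ψ δ t₁ ≤ ψ δ T + 3 * K * δ * (T - t₁) := by
    intro δ hδ
    have hcont : ContinuousOn (ψ δ) (Icc t₁ T) := fun t ht => by
      obtain ⟨g, -, -, hg⟩ := hc t ht
      obtain ⟨g', -, -, hg'⟩ := hd t ht
      exact continuousWithinAt_integral_mul_div_add (hφm δ) (hφ1 δ hδ)
        hg.tendsto_integral_abs_sub hg'.tendsto_integral_abs_sub
    have hmaps : MapsTo (fun y : ℝ => T - y) (Icc 0 (T - t₁)) (Icc t₁ T) := fun y hy =>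
      ⟨by linarith [hy.2], by linarith [hy.1]⟩
    -- Time is reversed because a function touching ψ from above controls the decrease of ψ over
    -- time only through earlier times.
    have hmono := image_le_of_liminf_slope_right_le_deriv_boundary
      (f := fun y => ψ δ (T - y)) (a := 0) (b := T - t₁)
      (B := fun y => ψ δ T + 3 * K * δ * y) (B' := fun _ => 3 * K * δ)
      (hcont.comp (by fun_prop) hmaps) (by simp) (by fun_prop)
      (fun y _ => by
        simpa using (((hasDerivAt_id y).const_mul (3 * K * δ)).const_add (ψ δ T)).hasDerivWithinAt)
      (fun y hy r hr => ?_) ⟨sub_nonneg.2 hT, le_rfl⟩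
    · simpa using hmono
    refine Eventually.frequently ?_
    have ht : T - y ∈ Icc t₁ T := hmaps (Ico_subset_Icc_self hy)
    set t := T - y with ht_def
    obtain ⟨g, hg2, hge, hgD⟩ := hc t ht
    obtain ⟨h, hh2, hhe, hhD⟩ := hd t ht
    have hg0 := nonneg_of_ae_pos hg2.continuous hge
    have hh0 := nonneg_of_ae_pos hh2.continuous hhe
    set l : EuclideanSpace ℝ (Fin n) → ℝ := fun x => h x / (g x + h x) with hl
    have hl0 : ∀ x, 0 ≤ l x := fun x => div_nonneg (hh0 x) (add_nonneg (hg0 x) (hh0 x))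
    have hl1 : ∀ x, l x ≤ 1 := fun x =>
      div_le_one_of_le₀ (by linarith [hg0 x]) (add_nonneg (hg0 x) (hh0 x))
    have hlm : Measurable l :=
      hh2.continuous.measurable.div (hg2.continuous.add hh2.continuous).measurable
    have hφmeas : Measurable (logCutoff δ : EuclideanSpace ℝ (Fin n) → ℝ) :=
      (contDiff_logCutoff δ).continuous.measurable
    set w₁ : EuclideanSpace ℝ (Fin n) → ℝ := fun x => logCutoff δ x * l x ^ 2 with hw₁
    set w₂ : EuclideanSpace ℝ (Fin n) → ℝ := fun x => logCutoff δ x * (1 - l x) ^ 2 with hw₂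
    have hw₁m : AEStronglyMeasurable w₁ volume :=
      (hφmeas.mul (hlm.pow_const 2)).aestronglyMeasurable
    have hw₂m : AEStronglyMeasurable w₂ volume :=
      (hφmeas.mul ((measurable_const.sub hlm).pow_const 2)).aestronglyMeasurable
    have hw₁1 : ∀ x, |w₁ x| ≤ 1 := fun x => by
      rw [hw₁, abs_mul, abs_of_nonneg (sq_nonneg (l x))]
      exact mul_le_one₀ (hφ1 δ hδ x) (sq_nonneg _) (pow_le_one₀ (hl0 x) (hl1 x))
    have hw₂1 : ∀ x, |w₂ x| ≤ 1 := fun x => by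
      rw [hw₂, abs_mul, abs_of_nonneg (sq_nonneg (1 - l x))]
      exact mul_le_one₀ (hφ1 δ hδ x) (sq_nonneg _)
        (pow_le_one₀ (by linarith [hl1 x]) (by linarith [hl0 x]))
    have hbdd : ∀ {w u : EuclideanSpace ℝ (Fin n) → ℝ}, AEStronglyMeasurable w volume →
        (∀ x, |w x| ≤ 1) → Integrable u → Integrable fun x => w x * u x :=
      fun hw hw1 hu => hu.bdd_mul (c := 1) hw (Eventually.of_forall hw1)
    have hi₁ : ∀ z, Integrable fun x => w₁ x * (c z).toFun x := fun z =>
      hbdd hw₁m hw₁1 (c z).integrable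
    have hi₂ : ∀ z, Integrable fun x => w₂ x * (d z).toFun x := fun z =>
      hbdd hw₂m hw₂1 (d z).integrable
    -- Freezing l at time t yields a functional linear in the two densities with bounded weights,
    -- hence differentiable in time. It dominates ψ and agrees with it at t, so its derivative
    -- bounds the slopes of ψ.
    set F : ℝ → ℝ := fun z => (∫ x, w₁ x * (c z).toFun x) + ∫ x, w₂ x * (d z).toFun x with hF
    have hFi : ∀ z, F z = ∫ x, (w₁ x * (c z).toFun x + w₂ x * (d z).toFun x) := fun z =>
      (integral_add (hi₁ z) (hi₂ z)).symm
    have hFd : HasDerivWithinAt F ((∫ x, w₁ x * forwardOp (b t) (diffusionMatrix s t) g x) +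
        ∫ x, w₂ x * forwardOp (b t) (diffusionMatrix s t) h x) (Icc t₁ T) t :=
      (hgD.hasDerivWithinAt_integral hw₁m hw₁1).add (hhD.hasDerivWithinAt_integral hw₂m hw₂1)
    have hghpos : ∀ᵐ x, 0 < g x + h x := by
      filter_upwards [hge, hhe, (c t).pos, (d t).pos] with x h1 h2 h3 h4
      rw [← h1, ← h2]
      positivity
    have hD : -(3 * K * δ) ≤ (∫ x, w₁ x * forwardOp (b t) (diffusionMatrix s t) g x) +
        ∫ x, w₂ x * forwardOp (b t) (diffusionMatrix s t) h x := by
      have hFT := integral_mul_div_add_mul_backwardOp_le (hb t ht) (ha t ht)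
        (s := s t) (fun x => rfl) hg2 hh2 hg0 hh0 hghpos (contDiff_logCutoff δ)
        (hasCompactSupport_logCutoff hδ) (logCutoff_nonneg δ)
      rw [← integral_add (hbdd hw₁m hw₁1 hgD.1) (hbdd hw₂m hw₂1 hhD.1)]
      refine le_trans ?_ (hFT.trans (le_of_eq (integral_congr_ae (Eventually.of_forall fun x => ?_))))
      · have hGi : Integrable fun x => g x * h x / (g x + h x) := by
          refine ((c t).integrable_mul_div_add (d t)).congr ?_
          filter_upwards [hge, hhe] with x h1 h2
          rw [h1, h2]
        have hG1 : ∫ x, g x * h x / (g x + h x) ≤ 1 := by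
          rw [← (c t).integral_eq_one]
          refine integral_mono_ae hGi (c t).integrable ?_
          filter_upwards [hge, hghpos] with x h1 h2
          rw [h1, div_le_iff₀ h2]
          nlinarith [hg0 x, hh0 x, mul_nonneg (hg0 x) (hh0 x), mul_nonneg (hg0 x) (hg0 x)]
        have hcL := continuous_backwardOp (hb t ht).continuous
          (fun i j => (ha t ht i j).continuous) (contDiff_logCutoff (n := n) δ)
        obtain ⟨C, hC⟩ := ((hasCompactSupport_logCutoff hδ).backwardOp (b := b t)
          (a := diffusionMatrix s t)).exists_bound_of_continuous hcL
        -- The function gh/(g+h) has total mass at most 1, so the pointwise bound −3Kδ survives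
        -- integration.
        calc -(3 * K * δ) ≤ -(3 * K * δ) * ∫ x, g x * h x / (g x + h x) := by
              have : 0 ≤ 3 * K * δ := by positivity
              nlinarith
          _ = ∫ x, g x * h x / (g x + h x) * -(3 * K * δ) := by
              rw [integral_mul_const, mul_comm]
          _ ≤ _ := by
              refine integral_mono (hGi.mul_const _)
                (hGi.mul_bdd hcL.aestronglyMeasurable (Eventually.of_forall hC)) fun x => ?_
              exact mul_le_mul_of_nonneg_left
                (neg_le_backwardOp_logCutoff (s := s t) (fun x => rfl) hK hδ.le (hgrowth t ht) x)
                (div_nonneg (mul_nonneg (hg0 x) (hh0 x)) (add_nonneg (hg0 x) (hh0 x)))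
      · simp only [hw₁, hw₂, hl]
        ring
    have hFt : F t = ψ δ t := by
      rw [hFi]
      refine integral_congr_ae ?_
      filter_upwards [hge, hhe, hghpos] with x h1 h2 h3
      rw [h1, h2, mul_div_add_eq _ _ h3.ne']
      simp only [hw₁, hw₂, hl]
      ring
    have hFz : ∀ z, ψ δ z ≤ F z := fun z => by
      rw [hFi]
      refine integral_mono_ae (hbdd (hφm δ) (hφ1 δ hδ) ((c z).integrable_mul_div_add (d z)))
        ((hi₁ z).add (hi₂ z)) ?_
      filter_upwards [(c z).pos, (d z).pos] with x h1 h2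
      refine (mul_le_mul_of_nonneg_left (mul_div_add_le (l := l x) h1.le h2.le)
        (logCutoff_nonneg δ x)).trans (le_of_eq ?_)
      simp only [hw₁, hw₂]
      ring
    have hto : Tendsto (fun z : ℝ => T - z) (𝓝[>] y) (𝓝[Icc t₁ T \ {t}] t) := by
      refine tendsto_nhdsWithin_iff.2 ⟨?_, ?_⟩
      · exact (Continuous.tendsto (by fun_prop) y).mono_left nhdsWithin_le_nhds
      · filter_upwards [self_mem_nhdsWithin, nhdsWithin_le_nhds (eventually_le_nhds hy.2)]
          with z hz hz2
        have hz' : y < z := hz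
        refine ⟨hmaps ⟨hy.1.trans hz'.le, hz2⟩, ?_⟩
        simp only [mem_singleton_iff, ht_def]
        linarith
    have hslope := (hasDerivWithinAt_iff_tendsto_slope.1 hFd).comp hto
    filter_upwards [hslope.eventually_const_lt (show -r < _ by linarith), self_mem_nhdsWithin]
      with z hz hyz
    have hyz' : 0 < z - y := sub_pos.2 hyz
    rw [Function.comp_apply, slope_def_field, hFt,
      show T - z - t = -(z - y) by rw [ht_def]; ring, div_neg, neg_lt_neg_iff] at hz
    refine lt_of_le_of_lt ?_ hz
    rw [slope_def_field]
    exact div_le_div_of_nonneg_right (sub_le_sub_right (hFz _) _) hyz'.le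
  have hlim : ∀ t, Tendsto (fun δ => ψ δ t) (𝓝[>] 0)
      (𝓝 (∫ x, (c t).toFun x * (d t).toFun x / ((c t).toFun x + (d t).toFun x))) := by
    intro t
    have hGi := (c t).integrable_mul_div_add (d t)
    refine tendsto_integral_filter_of_dominated_convergence _
      (Eventually.of_forall fun δ => (hφm δ).mul hGi.aestronglyMeasurable) ?_ hGi.norm ?_
    · filter_upwards [self_mem_nhdsWithin] with δ hδ
      refine Eventually.of_forall fun x => ?_
      rw [norm_mul]
      exact mul_le_of_le_one_left (norm_nonneg _) (hφ1 δ hδ x)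
    · refine Eventually.of_forall fun x => ?_
      simpa using (tendsto_logCutoff x).mul_const
        ((c t).toFun x * (d t).toFun x / ((c t).toFun x + (d t).toFun x))
  have hlast : Tendsto (fun δ : ℝ => 3 * K * δ * (T - t₁)) (𝓝[>] 0) (𝓝 0) := by
    have h : Continuous fun δ : ℝ => 3 * K * δ * (T - t₁) := by fun_prop
    have h2 := h.tendsto 0
    simp only [mul_zero, zero_mul] at h2
    exact h2.mono_left nhdsWithin_le_nhds
  have hfin := le_of_tendsto_of_tendsto (hlim t₁) ((hlim T).add hlast) (by
    filter_upwards [self_mem_nhdsWithin] with δ hδ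
    exact hkey δ hδ)
  rw [add_zero] at hfin
  -- At `t₁` the curves agree and c·c/(c+c) = c/2 has integral 1/2, already the maximal value.
  refine PosDensity.eq_of_half_le_integral _ _ (le_trans (le_of_eq ?_) hfin)
  rw [← h0, ← (c t₁).integral_eq_one, ← integral_div]
  refine integral_congr_ae ?_
  filter_upwards [(c t₁).pos] with x hx
  field_simp
  norm_num

end Uniqueness

/-! ### Exponentially weighted pairings with bounded functions. -/

section Pairing

variable {Ω : Type*} [MeasurableSpace Ω] {μ : Measure Ω} {p : PosDensity μ}

/-- The exponent a + d/4 + w/4 is a convex combination of 2a, d and w, so it is at most their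
maximum. This takes the place of a Hölder inequality with three factors. -/
theorem exp_mul_mul_le {a d w : ℝ} (hw : 0 ≤ w) :
    Real.exp a * (d * w) ≤ 16 * (Real.exp (2 * a) + Real.exp d + Real.exp w) := by
  have h1 : d ≤ 4 * Real.exp (d / 4) := by linarith [Real.add_one_le_exp (d / 4)]
  have h2 : w ≤ 4 * Real.exp (w / 4) := by linarith [Real.add_one_le_exp (w / 4)]
  calc Real.exp a * (d * w) ≤ Real.exp a * ((4 * Real.exp (d / 4)) * (4 * Real.exp (w / 4))) := by
        gcongr
    _ = 16 * Real.exp (a + d / 4 + w / 4) := by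
        rw [Real.exp_add, Real.exp_add]; ring
    _ ≤ 16 * (Real.exp (2 * a) + Real.exp d + Real.exp w) := by
        have p1 := Real.exp_pos (2 * a)
        have p2 := Real.exp_pos d
        have p3 := Real.exp_pos w
        have key : Real.exp (a + d / 4 + w / 4) ≤ Real.exp (2 * a) + Real.exp d + Real.exp w := by
          rcases le_total (2 * a) d with h | h
          · rcases le_total d w with h' | h'
            · have := Real.exp_le_exp.2 (show a + d / 4 + w / 4 ≤ w by linarith)
              linarith
            · have := Real.exp_le_exp.2 (show a + d / 4 + w / 4 ≤ d by linarith)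
              linarith
          · rcases le_total (2 * a) w with h' | h'
            · have := Real.exp_le_exp.2 (show a + d / 4 + w / 4 ≤ w by linarith)
              linarith
            · have := Real.exp_le_exp.2 (show a + d / 4 + w / 4 ≤ 2 * a by linarith)
              linarith
        linarith

theorem abs_exp_sub_exp_le (y z : ℝ) :
    |Real.exp y - Real.exp z| ≤ Real.exp |y| * |y - z| + Real.exp |z| * |y - z| := by
  have key : ∀ y z : ℝ, Real.exp y - Real.exp z ≤ Real.exp |y| * |y - z| := fun y z => by
    have h1 : Real.exp y * (1 + (z - y)) ≤ Real.exp z := by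
      calc Real.exp y * (1 + (z - y)) ≤ Real.exp y * Real.exp (z - y) := by
            gcongr
            linarith [Real.add_one_le_exp (z - y)]
        _ = Real.exp z := by rw [← Real.exp_add]; congr 1; ring
    have h2 := (mul_le_mul_of_nonneg_left (le_abs_self (y - z)) (Real.exp_pos y).le).trans
      (mul_le_mul_of_nonneg_right (Real.exp_le_exp.2 (le_abs_self y)) (abs_nonneg (y - z)))
    linarith
  have h1 := key y z
  have h2 := key z y
  rw [abs_sub_comm z y] at h2
  have h3 : 0 ≤ Real.exp |y| * |y - z| := by positivity
  have h4 : 0 ≤ Real.exp |z| * |y - z| := by positivity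
  exact abs_sub_le_iff.2 ⟨by linarith, by linarith⟩

theorem LPhi.integral_exp_abs_le {U : LPhi p} {c : ℝ} (h : ‖U‖ < c) :
    Integrable (fun x => Real.exp (c⁻¹ * |(U : Ω →ₘ[μ] ℝ) x|)) p.prob ∧
      ∫ x, Real.exp (c⁻¹ * |(U : Ω →ₘ[μ] ℝ) x|) ∂p.prob ≤ 4 := by
  have hc : 0 < c := (norm_nonneg U).trans_lt h
  have h1 := LPhi.lintegral_exp_abs_le h
  have hm : AEMeasurable (fun x => c⁻¹ * |(U : Ω →ₘ[μ] ℝ) x|) μ :=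
    (continuous_abs.measurable.comp_aemeasurable
      (U : Ω →ₘ[μ] ℝ).aestronglyMeasurable.aemeasurable).const_mul _
  have hi : Integrable (fun x => Real.exp (c⁻¹ * |(U : Ω →ₘ[μ] ℝ) x|)) p.prob := by
    refine PosDensity.integrable_of_lintegral_exp hm (lt_of_le_of_lt ?_ (h1.trans_lt (by simp)))
    refine le_of_eq (lintegral_congr fun x => ?_)
    rw [abs_of_nonneg (by positivity : 0 ≤ c⁻¹ * |(U : Ω →ₘ[μ] ℝ) x|)]
  refine ⟨hi, ?_⟩
  rw [integral_eq_lintegral_of_nonneg_ae (Eventually.of_forall fun x => (Real.exp_pos _).le)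
    hi.aestronglyMeasurable]
  exact ENNReal.toReal_le_of_le_ofReal (by norm_num) (by simpa using h1)

/-- The radius 1/2 for u gives E[exp(2|u|)] ≤ 4. Rescaling D and W by constants just above their
norms gives two more bounds 4, and 192 = 16·(4 + 4 + 4). -/
theorem LPhi.integrable_exp_mul_mul {u : LPhi p} (hu : ‖u‖ < 2⁻¹) (D W : LPhi p) :
    Integrable (fun x => Real.exp |(u : Ω →ₘ[μ] ℝ) x| *
      (|(D : Ω →ₘ[μ] ℝ) x| * |(W : Ω →ₘ[μ] ℝ) x|)) p.prob ∧
    ∫ x, Real.exp |(u : Ω →ₘ[μ] ℝ) x| * (|(D : Ω →ₘ[μ] ℝ) x| * |(W : Ω →ₘ[μ] ℝ) x|) ∂p.prob ≤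
      192 * (‖D‖ * ‖W‖) := by
  obtain ⟨hui, hu4⟩ := LPhi.integral_exp_abs_le hu
  rw [inv_inv] at hui hu4
  have hm : AEStronglyMeasurable (fun x => Real.exp |(u : Ω →ₘ[μ] ℝ) x| *
      (|(D : Ω →ₘ[μ] ℝ) x| * |(W : Ω →ₘ[μ] ℝ) x|)) p.prob := by
    have ha : ∀ U : Ω →ₘ[μ] ℝ, AEMeasurable (fun x => |U x|) p.prob := fun U =>
      continuous_abs.measurable.comp_aemeasurable (p.aemeasurable_prob U)
    exact ((Real.measurable_exp.comp_aemeasurable (ha _)).mul ((ha _).mul (ha _))).aestronglyMeasurable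
  have key : ∀ c c' : ℝ, ‖D‖ < c → ‖W‖ < c' →
      Integrable (fun x => Real.exp |(u : Ω →ₘ[μ] ℝ) x| *
        (|(D : Ω →ₘ[μ] ℝ) x| * |(W : Ω →ₘ[μ] ℝ) x|)) p.prob ∧
      ∫ x, Real.exp |(u : Ω →ₘ[μ] ℝ) x| * (|(D : Ω →ₘ[μ] ℝ) x| * |(W : Ω →ₘ[μ] ℝ) x|) ∂p.prob ≤
        192 * (c * c') := by
    intro c c' hc hc'
    have hc0 : 0 < c := (norm_nonneg D).trans_lt hc
    have hc0' : 0 < c' := (norm_nonneg W).trans_lt hc'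
    obtain ⟨hDi, hD4⟩ := LPhi.integral_exp_abs_le hc
    obtain ⟨hWi, hW4⟩ := LPhi.integral_exp_abs_le hc'
    have hsum := ((hui.add hDi).add hWi).const_mul (c * c' * 16)
    have hle : ∀ x, Real.exp |(u : Ω →ₘ[μ] ℝ) x| *
        (|(D : Ω →ₘ[μ] ℝ) x| * |(W : Ω →ₘ[μ] ℝ) x|) ≤ c * c' * 16 *
        (Real.exp (2 * |(u : Ω →ₘ[μ] ℝ) x|) + Real.exp (c⁻¹ * |(D : Ω →ₘ[μ] ℝ) x|) +
          Real.exp (c'⁻¹ * |(W : Ω →ₘ[μ] ℝ) x|)) := fun x => by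
      have h1 := exp_mul_mul_le (a := |(u : Ω →ₘ[μ] ℝ) x|) (d := c⁻¹ * |(D : Ω →ₘ[μ] ℝ) x|)
        (w := c'⁻¹ * |(W : Ω →ₘ[μ] ℝ) x|) (by positivity)
      have h2 := mul_le_mul_of_nonneg_left h1 (mul_pos hc0 hc0').le
      refine (le_of_eq ?_).trans (h2.trans (le_of_eq ?_))
      · field_simp
      · ring
    have hi := hsum.mono' hm (Eventually.of_forall fun x => by
      rw [Real.norm_of_nonneg (by positivity)]
      exact hle x)
    refine ⟨hi, (integral_mono hi hsum hle).trans ?_⟩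
    have hi2 : Integrable (fun x => Real.exp (2 * |(u : Ω →ₘ[μ] ℝ) x|) +
      Real.exp (c⁻¹ * |(D : Ω →ₘ[μ] ℝ) x|)) p.prob := hui.add hDi
    simp only [Pi.add_apply]
    rw [integral_const_mul, integral_add hi2 hWi, integral_add hui hDi]
    have : 0 < c * c' := mul_pos hc0 hc0'
    nlinarith
  refine ⟨(key (‖D‖ + 1) (‖W‖ + 1) (by linarith) (by linarith)).1, ?_⟩
  have hcont : Tendsto (fun ε : ℝ => 192 * ((‖D‖ + ε) * (‖W‖ + ε))) (𝓝[>] 0)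
      (𝓝 (192 * ((‖D‖ + 0) * (‖W‖ + 0)))) :=
    (Continuous.tendsto (by fun_prop) 0).mono_left nhdsWithin_le_nhds
  rw [add_zero, add_zero] at hcont
  refine ge_of_tendsto hcont ?_
  filter_upwards [self_mem_nhdsWithin] with ε hε
  have hε' : (0 : ℝ) < ε := hε
  exact (key (‖D‖ + ε) (‖W‖ + ε) (by linarith) (by linarith)).2

/-- The pairing `E_p[φ exp(u) W]`. -/
def LPhi.pairing (φ : Ω → ℝ) (u W : LPhi p) : ℝ :=
  ∫ x, φ x * (Real.exp ((u : Ω →ₘ[μ] ℝ) x) * (W : Ω →ₘ[μ] ℝ) x) ∂p.prob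

theorem LPhi.coeFn_const_one (p : PosDensity μ) :
    ⇑(LPhi.const p 1 : Ω →ₘ[μ] ℝ) =ᵐ[p.prob] fun _ => 1 :=
  p.prob_absolutelyContinuous.ae_le (AEEqFun.coeFn_const (μ := μ) Ω (1 : ℝ))

theorem LPhi.integrable_exp_mul {u : LPhi p} (hu : ‖u‖ < 2⁻¹) (W : LPhi p) :
    Integrable (fun x => Real.exp |(u : Ω →ₘ[μ] ℝ) x| * |(W : Ω →ₘ[μ] ℝ) x|) p.prob ∧
    ∫ x, Real.exp |(u : Ω →ₘ[μ] ℝ) x| * |(W : Ω →ₘ[μ] ℝ) x| ∂p.prob ≤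
      192 * (‖LPhi.const p 1‖ * ‖W‖) := by
  have h := LPhi.integrable_exp_mul_mul hu (LPhi.const p 1) W
  have hae : (fun x => Real.exp |(u : Ω →ₘ[μ] ℝ) x| *
      (|(LPhi.const p 1 : Ω →ₘ[μ] ℝ) x| * |(W : Ω →ₘ[μ] ℝ) x|)) =ᵐ[p.prob]
      fun x => Real.exp |(u : Ω →ₘ[μ] ℝ) x| * |(W : Ω →ₘ[μ] ℝ) x| := by
    filter_upwards [LPhi.coeFn_const_one p] with x hx
    rw [hx, abs_one, one_mul]
  exact ⟨h.1.congr hae, (integral_congr_ae hae).symm.trans_le h.2⟩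

variable {φ : Ω → ℝ} {M : ℝ}

theorem LPhi.integrable_pairing (hφm : AEStronglyMeasurable φ p.prob) (hφ : ∀ x, |φ x| ≤ M)
    {u : LPhi p} (hu : ‖u‖ < 2⁻¹) (W : LPhi p) :
    Integrable (fun x => φ x * (Real.exp ((u : Ω →ₘ[μ] ℝ) x) * (W : Ω →ₘ[μ] ℝ) x)) p.prob := by
  refine Integrable.bdd_mul (c := M) ?_ hφm (Eventually.of_forall hφ)
  refine (LPhi.integrable_exp_mul hu W).1.mono' ((Real.measurable_exp.comp_aemeasurable
    (p.aemeasurable_prob _)).mul (p.aemeasurable_prob _)).aestronglyMeasurable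
    (Eventually.of_forall fun x => ?_)
  rw [norm_mul, Real.norm_of_nonneg (Real.exp_pos _).le]
  exact mul_le_mul_of_nonneg_right (Real.exp_le_exp.2 (le_abs_self _)) (norm_nonneg _)

theorem LPhi.abs_pairing_le (hM : 0 ≤ M) (hφ : ∀ x, |φ x| ≤ M)
    {u : LPhi p} (hu : ‖u‖ < 2⁻¹) (W : LPhi p) :
    |LPhi.pairing φ u W| ≤ 192 * ‖LPhi.const p 1‖ * M * ‖W‖ := by
  obtain ⟨hi, hle⟩ := LPhi.integrable_exp_mul hu W
  rw [← Real.norm_eq_abs]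
  refine (norm_integral_le_integral_norm _).trans ?_
  refine (integral_mono_of_nonneg (Eventually.of_forall fun x => norm_nonneg _) (hi.const_mul M)
    (Eventually.of_forall fun x => ?_)).trans ?_
  · dsimp only
    rw [norm_mul, norm_mul, Real.norm_of_nonneg (Real.exp_pos _).le]
    refine mul_le_mul (hφ x) (mul_le_mul_of_nonneg_right (Real.exp_le_exp.2 (le_abs_self _))
      (norm_nonneg _)) (by positivity) hM
  · rw [integral_const_mul]
    nlinarith

theorem LPhi.abs_pairing_sub_le (hM : 0 ≤ M) (hφm : AEStronglyMeasurable φ p.prob)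
    (hφ : ∀ x, |φ x| ≤ M) {u u' : LPhi p} (hu : ‖u‖ < 2⁻¹) (hu' : ‖u'‖ < 2⁻¹) (W : LPhi p) :
    |LPhi.pairing φ u W - LPhi.pairing φ u' W| ≤ 384 * M * ‖u - u'‖ * ‖W‖ := by
  obtain ⟨hi, hle⟩ := LPhi.integrable_exp_mul_mul hu (u - u') W
  obtain ⟨hi', hle'⟩ := LPhi.integrable_exp_mul_mul hu' (u - u') W
  rw [LPhi.pairing, LPhi.pairing, ← integral_sub (LPhi.integrable_pairing hφm hφ hu W)
    (LPhi.integrable_pairing hφm hφ hu' W)]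
  rw [← Real.norm_eq_abs]
  refine (norm_integral_le_integral_norm _).trans ?_
  refine (integral_mono_of_nonneg (Eventually.of_forall fun x => norm_nonneg _)
    ((hi.add hi').const_mul M) ?_).trans ?_
  · filter_upwards [p.prob_absolutelyContinuous.ae_le
      (AEEqFun.coeFn_sub (u : Ω →ₘ[μ] ℝ) (u' : Ω →ₘ[μ] ℝ))] with x hx
    simp only [Pi.add_apply]
    rw [Submodule.coe_sub, hx, Pi.sub_apply, ← mul_sub, ← sub_mul, norm_mul, norm_mul]
    refine mul_le_mul (hφ x) ?_ (by positivity) hM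
    have := mul_le_mul_of_nonneg_right (abs_exp_sub_exp_le ((u : Ω →ₘ[μ] ℝ) x)
      ((u' : Ω →ₘ[μ] ℝ) x)) (abs_nonneg ((W : Ω →ₘ[μ] ℝ) x))
    simp only [Real.norm_eq_abs]
    linarith
  · simp only [Pi.add_apply]
    rw [integral_const_mul, integral_add hi hi']
    nlinarith

theorem LPhi.pairing_sub (hφm : AEStronglyMeasurable φ p.prob) (hφ : ∀ x, |φ x| ≤ M)
    {u : LPhi p} (hu : ‖u‖ < 2⁻¹) (W W' : LPhi p) :
    LPhi.pairing φ u (W - W') = LPhi.pairing φ u W - LPhi.pairing φ u W' := by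
  rw [LPhi.pairing, LPhi.pairing, LPhi.pairing,
    ← integral_sub (LPhi.integrable_pairing hφm hφ hu W) (LPhi.integrable_pairing hφm hφ hu W')]
  refine integral_congr_ae ?_
  filter_upwards [p.prob_absolutelyContinuous.ae_le
      (AEEqFun.coeFn_sub (W : Ω →ₘ[μ] ℝ) (W' : Ω →ₘ[μ] ℝ))] with x hx
  rw [Submodule.coe_sub, hx, Pi.sub_apply]
  ring

end Pairing

/-! ### Weak equation for the score in a parametrization of the submanifold. -/

section ParamScore

/-- Stability of solutions of equations T z x = R z. The lower bound 2c at z₀ survives with constant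
c on a ball where T varies by at most c, and it then controls the difference of solutions belonging
to different parameters. -/
theorem antilipschitz_perturb {X Y Z : Type*} [NormedAddCommGroup X] [NormedAddCommGroup Y]
    [NormedAddCommGroup Z] {T : Z → X → Y} {c C ρ : ℝ} (hC : 0 ≤ C) {z₀ : Z}
    (hsub : ∀ z ∈ Metric.closedBall z₀ ρ, ∀ x x', T z (x - x') = T z x - T z x')
    (hlow : ∀ x, 2 * c * ‖x‖ ≤ ‖T z₀ x‖) (hρ : 0 ≤ ρ) (hCρ : C * ρ ≤ c)
    (hT : ∀ z ∈ Metric.closedBall z₀ ρ, ∀ z' ∈ Metric.closedBall z₀ ρ, ∀ x,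
      ‖T z x - T z' x‖ ≤ C * ‖z - z'‖ * ‖x‖)
    {z z' : Z} (hz : z ∈ Metric.closedBall z₀ ρ) (hz' : z' ∈ Metric.closedBall z₀ ρ) (x x' : X) :
    c * ‖x - x'‖ ≤ ‖T z x - T z' x'‖ + C * ‖z - z'‖ * ‖x'‖ := by
  have h0 : z₀ ∈ Metric.closedBall z₀ ρ := Metric.mem_closedBall_self hρ
  have h1 := hlow (x - x')
  have h2 : ‖T z₀ (x - x')‖ ≤ ‖T z (x - x')‖ + C * ‖z₀ - z‖ * ‖x - x'‖ := by
    have := norm_add_le (T z (x - x')) (T z₀ (x - x') - T z (x - x'))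
    rw [add_sub_cancel] at this
    linarith [hT z₀ h0 z hz (x - x')]
  have h3 : ‖T z (x - x')‖ ≤ ‖T z x - T z' x'‖ + C * ‖z - z'‖ * ‖x'‖ := by
    rw [hsub z hz]
    have := norm_sub_le (T z x - T z' x') (T z x' - T z' x')
    rw [sub_sub_sub_cancel_right] at this
    linarith [hT z hz z' hz' x']
  have h4 : C * ‖z₀ - z‖ * ‖x - x'‖ ≤ c * ‖x - x'‖ := by
    refine mul_le_mul_of_nonneg_right (le_trans ?_ hCρ) (norm_nonneg _)
    refine mul_le_mul_of_nonneg_left ?_ hC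
    rw [norm_sub_rev, ← dist_eq_norm]
    exact hz
  linarith

variable {n m : ℕ} {f : ℝ → EuclideanSpace ℝ (Fin n) → EuclideanSpace ℝ (Fin n)}
  {σ : ℝ → EuclideanSpace ℝ (Fin n) → Matrix (Fin n) (Fin m) ℝ}
  {N : Set (PosDensity (volume : Measure (EuclideanSpace ℝ (Fin n))))}
  {q₀ : PosDensity (volume : Measure (EuclideanSpace ℝ (Fin n)))}
  {Z : Type*} [NormedAddCommGroup Z] [NormedSpace ℝ Z] {γ : Z → BSpace q₀}

/-- In the parametrization `γ` of `N`, read in the chart at `q₀`, the vector field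
`q ↦ L_t* q / q` has the velocity `w` at the parameter `z`. -/
def IsParamScore (f : ℝ → EuclideanSpace ℝ (Fin n) → EuclideanSpace ℝ (Fin n))
    (σ : ℝ → EuclideanSpace ℝ (Fin n) → Matrix (Fin n) (Fin m) ℝ)
    (N : Set (PosDensity (volume : Measure (EuclideanSpace ℝ (Fin n)))))
    (γ : Z → BSpace q₀) (t : ℝ) (z w : Z) : Prop :=
  ∃ q ∈ N, expChart q₀ q = γ z ∧ ∃ V : BSpace q, IsForwardScore f σ t q V ∧
    BSpace.fn (fderiv ℝ γ z w) =ᵐ[volume] fun x => BSpace.fn V x - q₀.expect (BSpace.fn V)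

/-- With q = exp(u − k)q₀ the left side is exp(k) ∫ φ L*g, and adjointness moves the derivatives to
φ. The outcome depends on q only through u, without spatial derivatives of q, and so is regular in u
and t. -/
theorem pairing_score {b : EuclideanSpace ℝ (Fin n) → EuclideanSpace ℝ (Fin n)}
    {a : EuclideanSpace ℝ (Fin n) → Matrix (Fin n) (Fin n) ℝ} (hb : ContDiff ℝ 1 b)
    (ha : ∀ i j, ContDiff ℝ 2 fun y => a y i j) {φ g : EuclideanSpace ℝ (Fin n) → ℝ}
    (hφ : ContDiff ℝ 2 φ) (hc : HasCompactSupport φ) (hg : ContDiff ℝ 2 g)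
    {q : PosDensity (volume : Measure (EuclideanSpace ℝ (Fin n)))} (hq : logRatio q₀ q ∈ LPhi q₀)
    (hqg : q.toFun =ᵐ[volume] g) {W : LPhi q₀}
    (hW : (W : EuclideanSpace ℝ (Fin n) →ₘ[volume] ℝ) =ᵐ[volume] forwardScore b a g) :
    LPhi.pairing φ (expChart q₀ q : LPhi q₀) W =
      LPhi.pairing (backwardOp b a φ) (expChart q₀ q : LPhi q₀) (LPhi.const q₀ 1) := by
  have hexp := toFun_eq_of_logRatio_mem hq
  set k := cgf q₀ (expChart q₀ q)
  have h1 : LPhi.pairing φ (expChart q₀ q : LPhi q₀) W =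
      Real.exp k * ∫ x, φ x * forwardOp b a g x := by
    rw [LPhi.pairing, q₀.integral_prob, ← integral_const_mul]
    refine integral_congr_ae ?_
    filter_upwards [hexp, hqg, hW, q.pos] with x h1 h2 h3 h4
    have h5 : g x = Real.exp (BSpace.fn (expChart q₀ q) x - k) * q₀.toFun x := h2 ▸ h1
    have h6 : g x ≠ 0 := (h2 ▸ h4).ne'
    rw [Real.exp_sub] at h5
    have h7 : q₀.toFun x * Real.exp (BSpace.fn (expChart q₀ q) x) = Real.exp k * g x := by
      rw [h5]
      field_simp
    rw [h3, forwardScore, ← BSpace.fn_eq_coe]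
    calc _ = (q₀.toFun x * Real.exp (BSpace.fn (expChart q₀ q) x)) *
          (φ x * (forwardOp b a g x / g x)) := by ring
      _ = _ := by rw [h7]; field_simp
  have h2 : LPhi.pairing (backwardOp b a φ) (expChart q₀ q : LPhi q₀) (LPhi.const q₀ 1) =
      Real.exp k * ∫ x, g x * backwardOp b a φ x := by
    rw [LPhi.pairing, q₀.integral_prob, ← integral_const_mul]
    refine integral_congr_ae ?_
    filter_upwards [hexp, hqg, q₀.absolutelyContinuous_prob.ae_le (LPhi.coeFn_const_one q₀)]
      with x h1 h2 h3
    have h5 : g x = Real.exp (BSpace.fn (expChart q₀ q) x - k) * q₀.toFun x := h2 ▸ h1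
    rw [h3, h5, Real.exp_sub, ← BSpace.fn_eq_coe]
    field_simp
  rw [h1, h2, integral_mul_forwardOp hb ha hφ hc hg]

/-- The random variable `Dγ(z) w + e`, for `x = (w, e)`. -/
def affineScore (γ : Z → BSpace q₀) (z : Z) (x : Z × ℝ) : LPhi q₀ :=
  (fderiv ℝ γ z x.1 : LPhi q₀) + LPhi.const q₀ x.2

theorem affineScore_sub (z : Z) (x x' : Z × ℝ) :
    affineScore γ z (x - x') = affineScore γ z x - affineScore γ z x' := by
  simp only [affineScore, Prod.fst_sub, Prod.snd_sub, map_sub, ← LPhi.smul_const_one q₀ (_ - _),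
    ← LPhi.smul_const_one q₀ x.2, ← LPhi.smul_const_one q₀ x'.2, sub_smul, Submodule.coe_sub]
  abel

theorem norm_affineScore_le (z : Z) (x : Z × ℝ) :
    ‖affineScore γ z x‖ ≤ (‖fderiv ℝ γ z‖ + ‖LPhi.const q₀ 1‖) * ‖x‖ := by
  rw [affineScore, ← LPhi.smul_const_one, add_mul]
  refine (norm_add_le _ _).trans (add_le_add ?_ ?_)
  · exact ((fderiv ℝ γ z).le_opNorm x.1).trans
      (mul_le_mul_of_nonneg_left (norm_fst_le x) (norm_nonneg _))
  · rw [norm_smul, mul_comm]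
    exact mul_le_mul_of_nonneg_left (norm_snd_le x) (norm_nonneg _)

theorem norm_affineScore_sub_le (z z' : Z) (x : Z × ℝ) :
    ‖affineScore γ z x - affineScore γ z' x‖ ≤ ‖fderiv ℝ γ z - fderiv ℝ γ z'‖ * ‖x‖ := by
  rw [affineScore, affineScore, add_sub_add_right_eq_sub, ← Submodule.coe_sub,
    show fderiv ℝ γ z x.1 - fderiv ℝ γ z' x.1 = (fderiv ℝ γ z - fderiv ℝ γ z') x.1 from rfl]
  exact ((fderiv ℝ γ z - fderiv ℝ γ z').le_opNorm x.1).trans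
    (mul_le_mul_of_nonneg_left (norm_fst_le x) (norm_nonneg _))

/-- The vector Dγ(z)w is centered at q₀, so taking the expectation isolates the constant e;
injectivity of Dγ(z) then disposes of w. -/
theorem affineScore_eq_zero {z : Z} (hinj : Function.Injective (fderiv ℝ γ z)) {x : Z × ℝ}
    (h : affineScore γ z x = 0) : x = 0 := by
  have h1 := congrArg (fun U : LPhi q₀ => q₀.expect (U : EuclideanSpace ℝ (Fin n) →ₘ[volume] ℝ)) h
  have h2 := LPhi.expect_smul q₀ 0 0
  rw [zero_smul, zero_mul] at h2
  simp only [affineScore] at h1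
  rw [LPhi.expect_add, LPhi.expect_const, h2,
    show q₀.expect ((fderiv ℝ γ z x.1 : LPhi q₀) : EuclideanSpace ℝ (Fin n) →ₘ[volume] ℝ) = 0 from
      (fderiv ℝ γ z x.1).2, zero_add] at h1
  rw [affineScore, h1, ← LPhi.smul_const_one, zero_smul, add_zero] at h
  have h3 : fderiv ℝ γ z x.1 = 0 := Subtype.ext h
  exact Prod.ext (hinj (h3.trans (map_zero _).symm)) h1

theorem IsParamScore.exists_pairing {t : ℝ} (hb : ContDiff ℝ 1 (f t))
    (ha : ∀ i j, ContDiff ℝ 2 fun y => diffusionMatrix σ t y i j)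
    (hN : ∀ q ∈ N, ExpConnected q₀ q) {z w : Z} (h : IsParamScore f σ N γ t z w) :
    ∃ e : ℝ, ∀ φ : EuclideanSpace ℝ (Fin n) → ℝ, ContDiff ℝ 2 φ → HasCompactSupport φ →
      LPhi.pairing φ (γ z : LPhi q₀) (affineScore γ z (w, e)) =
        LPhi.pairing (backwardOp (f t) (diffusionMatrix σ t) φ) (γ z : LPhi q₀)
          (LPhi.const q₀ 1) := by
  obtain ⟨q, hq, hqγ, V, ⟨g, hg, hqg, hV⟩, hw⟩ := h
  -- Adding this constant undoes the centering, so `affineScore` becomes the uncentered score L*q/q.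
  refine ⟨q₀.expect (BSpace.fn V), fun φ hφ hc => ?_⟩
  rw [← hqγ]
  refine pairing_score hb ha hφ hc hg (hN q hq).1 hqg ?_
  filter_upwards [hV, hw, AEEqFun.coeFn_add
    ((fderiv ℝ γ z w : LPhi q₀) : EuclideanSpace ℝ (Fin n) →ₘ[volume] ℝ)
    (LPhi.const q₀ (q₀.expect (BSpace.fn V)) : EuclideanSpace ℝ (Fin n) →ₘ[volume] ℝ),
    AEEqFun.coeFn_const (μ := volume) (EuclideanSpace ℝ (Fin n)) (q₀.expect (BSpace.fn V))]
    with x h1 h2 h3 h4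
  rw [affineScore, Submodule.coe_add, h3, Pi.add_apply, LPhi.coe_const, h4, ← BSpace.fn_eq_coe, h2,
    ← h1, Function.const_apply, sub_add_cancel]

/-- Test functions separate the elements of `L^Φ`. -/
theorem exists_pairing_zero_ne_zero {W : LPhi q₀} (hW : W ≠ 0) :
    ∃ φ : EuclideanSpace ℝ (Fin n) → ℝ, ContDiff ℝ 2 φ ∧ HasCompactSupport φ ∧
      LPhi.pairing φ 0 W ≠ 0 := by
  by_contra! hcon
  refine hW (Subtype.ext (AEEqFun.ext ?_))
  have hint := (q₀.integrable_prob_iff _).1 (LPhi.integrable q₀ W)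
  have h0 := ae_eq_zero_of_integral_contDiff_smul_eq_zero hint.locallyIntegrable fun φ hφ hc => by
    have h1 := hcon φ (contDiff_infty.1 hφ 2) hc
    rw [LPhi.pairing, q₀.integral_prob] at h1
    rw [← h1]
    refine integral_congr_ae ?_
    filter_upwards [AEEqFun.coeFn_zero (α := EuclideanSpace ℝ (Fin n)) (μ := volume) (β := ℝ)]
      with x hx
    rw [Submodule.coe_zero, hx, Pi.zero_apply, Real.exp_zero, one_mul, smul_eq_mul]
    ring
  filter_upwards [h0, q₀.pos,
    AEEqFun.coeFn_zero (α := EuclideanSpace ℝ (Fin n)) (μ := volume) (β := ℝ)] with x h1 h2 h3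
  rw [Submodule.coe_zero, h3, Pi.zero_apply]
  exact (mul_eq_zero.1 h1).resolve_left h2.ne'

theorem continuousOn_backwardOp_uncurry (hf : IsCk0 1 f)
    (hσ : ∀ i j, IsCk0 2 fun t x => diffusionMatrix σ t x i j)
    {φ : EuclideanSpace ℝ (Fin n) → ℝ} (hφ : ContDiff ℝ 2 φ) :
    ContinuousOn (fun y : ℝ × EuclideanSpace ℝ (Fin n) =>
      backwardOp (f y.1) (diffusionMatrix σ y.1) φ y.2) (Ici 0 ×ˢ univ) := by
  unfold backwardOp
  refine (continuousOn_finsetSum _ fun i _ => ContinuousOn.mul ?_ ?_).add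
    (continuousOn_const.mul (continuousOn_finsetSum _ fun i _ =>
      continuousOn_finsetSum _ fun j _ => ContinuousOn.mul ?_ ?_))
  · exact (EuclideanSpace.proj i).continuous.comp_continuousOn hf.continuousOn_uncurry
  · exact ((continuous_pderivAt (hφ.of_le one_le_two) i).comp continuous_snd).continuousOn
  · exact (hσ i j).continuousOn_uncurry
  · exact ((continuous_pderivAt (contDiff_one_pderivAt hφ j) i).comp continuous_snd).continuousOn

/-- Off the support of φ the function L_tφ vanishes, so joint continuity on a compact set of (t, x)
gives a bound uniform in t. -/
theorem exists_abs_backwardOp_le (hf : IsCk0 1 f)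
    (hσ : ∀ i j, IsCk0 2 fun t x => diffusionMatrix σ t x i j)
    {φ : EuclideanSpace ℝ (Fin n) → ℝ} (hφ : ContDiff ℝ 2 φ) (hc : HasCompactSupport φ)
    {a b : ℝ} (ha : 0 ≤ a) :
    ∃ M : ℝ, 0 ≤ M ∧ ∀ t ∈ Icc a b, ∀ x, |backwardOp (f t) (diffusionMatrix σ t) φ x| ≤ M := by
  obtain ⟨M, hM⟩ := ((isCompact_Icc (a := a) (b := b)).prod hc).exists_bound_of_continuousOn
    ((continuousOn_backwardOp_uncurry hf hσ hφ).mono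
      (prod_mono (fun t ht => ha.trans ht.1) (subset_univ _)))
  refine ⟨max M 0, le_max_right _ _, fun t ht x => ?_⟩
  by_cases hx : x ∈ tsupport φ
  · exact (hM (t, x) ⟨ht, hx⟩).trans (le_max_left _ _)
  · rw [backwardOp_eq_zero_of_notMem_tsupport hx, abs_zero]
    exact le_max_right _ _

theorem continuousOn_pairing_backwardOp (hf : IsCk0 1 f)
    (hσ : ∀ i j, IsCk0 2 fun t x => diffusionMatrix σ t x i j)
    {φ : EuclideanSpace ℝ (Fin n) → ℝ} (hφ : ContDiff ℝ 2 φ) (hc : HasCompactSupport φ)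
    {a b : ℝ} (ha : 0 ≤ a) {u : LPhi q₀} (hu : ‖u‖ < 2⁻¹) (W : LPhi q₀) :
    ContinuousOn (fun t => LPhi.pairing (backwardOp (f t) (diffusionMatrix σ t) φ) u W)
      (Icc a b) := by
  obtain ⟨M, hM0, hM⟩ := exists_abs_backwardOp_le hf hσ hφ hc (b := b) ha
  have hm : ∀ t ∈ Icc a b, AEStronglyMeasurable (backwardOp (f t) (diffusionMatrix σ t) φ)
      q₀.prob := fun t ht => (continuous_backwardOp (hf.1 t (ha.trans ht.1)).continuous
    (fun i j => (hσ i j).1 t (ha.trans ht.1) |>.continuous) hφ).aestronglyMeasurable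
  refine continuousOn_of_dominated
    (bound := fun x => M * (Real.exp |(u : EuclideanSpace ℝ (Fin n) →ₘ[volume] ℝ) x| *
      |(W : EuclideanSpace ℝ (Fin n) →ₘ[volume] ℝ) x|))
    (fun t ht => (LPhi.integrable_pairing (hm t ht) (hM t ht) hu W).aestronglyMeasurable)
    (fun t ht => Eventually.of_forall fun x => ?_) ((LPhi.integrable_exp_mul hu W).1.const_mul M)
    (Eventually.of_forall fun x => ContinuousOn.mul ?_ continuousOn_const)
  · rw [norm_mul, norm_mul, Real.norm_of_nonneg (Real.exp_pos _).le]
    exact mul_le_mul (hM t ht x) (mul_le_mul_of_nonneg_right (Real.exp_le_exp.2 (le_abs_self _))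
      (norm_nonneg _)) (by positivity) hM0
  · exact (continuousOn_backwardOp_uncurry hf hσ hφ).comp
      (f := fun t : ℝ => (t, x)) (by fun_prop) fun t ht => ⟨ha.trans ht.1, mem_univ _⟩

end ParamScore

/-! ### Lipschitz regularity of the field in finite dimension. -/

section FiniteDimensionalField

variable {n m : ℕ} {f : ℝ → EuclideanSpace ℝ (Fin n) → EuclideanSpace ℝ (Fin n)}
  {σ : ℝ → EuclideanSpace ℝ (Fin n) → Matrix (Fin n) (Fin m) ℝ}
  {N : Set (PosDensity (volume : Measure (EuclideanSpace ℝ (Fin n))))}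
  {q₀ : PosDensity (volume : Measure (EuclideanSpace ℝ (Fin n)))}
  {Z : Type*} [NormedAddCommGroup Z] [NormedSpace ℝ Z] {γ : Z → BSpace q₀} {z₀ : Z}

/-- The twice continuously differentiable test functions. -/
abbrev CompactTest (n : ℕ) : Type :=
  {φ : EuclideanSpace ℝ (Fin n) → ℝ // ContDiff ℝ 2 φ ∧ HasCompactSupport φ}

theorem CompactTest.exists_abs_le (φ : CompactTest n) : ∃ M : ℝ, ∀ x, |φ.1 x| ≤ M :=
  φ.2.1.continuous.bounded_above_of_compact_support φ.2.2

theorem affineScore_smul (z : Z) (c : ℝ) (x : Z × ℝ) :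
    affineScore γ z (c • x) = c • affineScore γ z x := by
  simp only [affineScore, Prod.smul_fst, Prod.smul_snd, map_smul, smul_add, Submodule.coe_smul,
    ← LPhi.smul_const_one q₀ x.2, ← LPhi.smul_const_one q₀ (c * x.2), smul_smul, smul_eq_mul]

theorem LPhi.pairing_smul (φ : EuclideanSpace ℝ (Fin n) → ℝ) (c : ℝ) (u W : LPhi q₀) :
    LPhi.pairing φ u (c • W) = c * LPhi.pairing φ u W := by
  rw [LPhi.pairing, LPhi.pairing, ← integral_const_mul]
  refine integral_congr_ae ?_
  filter_upwards [q₀.prob_absolutelyContinuous.ae_le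
    (AEEqFun.coeFn_smul c (W : EuclideanSpace ℝ (Fin n) →ₘ[volume] ℝ))] with x hx
  rw [Submodule.coe_smul, hx, Pi.smul_apply, smul_eq_mul]
  ring

/-- The action on test functions of the random variable `Dγ(z) w + e`, weighted by `exp (γ z)`. -/
def affinePairing (γ : Z → BSpace q₀) (Φ : Finset (CompactTest n)) (z : Z) (x : Z × ℝ) : Φ → ℝ :=
  fun φ => LPhi.pairing φ.1.1 (γ z : LPhi q₀) (affineScore γ z x)

theorem affinePairing_sub {Φ : Finset (CompactTest n)} {z : Z} (hz : ‖γ z‖ < 2⁻¹)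
    (x x' : Z × ℝ) :
    affinePairing γ Φ z (x - x') = affinePairing γ Φ z x - affinePairing γ Φ z x' := by
  funext φ
  obtain ⟨M, hM⟩ := φ.1.exists_abs_le
  rw [affinePairing, affineScore_sub]
  exact LPhi.pairing_sub φ.1.2.1.continuous.aestronglyMeasurable hM hz _ _

theorem affinePairing_smul (Φ : Finset (CompactTest n)) (z : Z) (c : ℝ) (x : Z × ℝ) :
    affinePairing γ Φ z (c • x) = c • affinePairing γ Φ z x := by
  funext φ
  rw [affinePairing, affineScore_smul, LPhi.pairing_smul]
  rfl

theorem continuous_pairing_affineScore (φ : CompactTest n) {z : Z} (hz : ‖γ z‖ < 2⁻¹) :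
    Continuous fun x : Z × ℝ => LPhi.pairing φ.1 (γ z : LPhi q₀) (affineScore γ z x) := by
  obtain ⟨M, hM⟩ := φ.exists_abs_le
  have hM0 : 0 ≤ M := (abs_nonneg _).trans (hM 0)
  have hz' : ‖(γ z : LPhi q₀)‖ < 2⁻¹ := hz
  refine (LipschitzWith.of_dist_le_mul (K := Real.toNNReal
    (192 * ‖LPhi.const q₀ 1‖ * M * (‖fderiv ℝ γ z‖ + ‖LPhi.const q₀ 1‖))) fun x x' => ?_).continuous
  rw [Real.coe_toNNReal _ (by positivity), dist_eq_norm, dist_eq_norm,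
    ← LPhi.pairing_sub φ.2.1.continuous.aestronglyMeasurable hM hz', ← affineScore_sub,
    mul_assoc _ _ ‖x - x'‖]
  exact (LPhi.abs_pairing_le hM0 hM hz _).trans
    (mul_le_mul_of_nonneg_left (norm_affineScore_le z _) (by positivity))

/-- Each unit vector (w, e) is detected by some test function, on an open set of vectors.
Compactness of the unit sphere leaves finitely many test functions and a positive minimum, and
homogeneity extends the bound. -/
theorem exists_affinePairing_lower [FiniteDimensional ℝ Z] (h0 : γ z₀ = 0)
    (hinj : Function.Injective (fderiv ℝ γ z₀)) :
    ∃ (Φ : Finset (CompactTest n)) (c : ℝ), 0 < c ∧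
      ∀ x, 2 * c * ‖x‖ ≤ ‖affinePairing γ Φ z₀ x‖ := by
  have hz₀ : ‖γ z₀‖ < 2⁻¹ := by rw [h0, norm_zero]; norm_num
  have hcpt : IsCompact (Metric.sphere (0 : Z × ℝ) 1) := isCompact_sphere _ _
  obtain ⟨Φ, hΦ⟩ := hcpt.elim_finite_subcover
    (fun φ : CompactTest n =>
      {x : Z × ℝ | LPhi.pairing φ.1 (γ z₀ : LPhi q₀) (affineScore γ z₀ x) ≠ 0})
    (fun φ => isOpen_ne_fun (continuous_pairing_affineScore φ hz₀) continuous_const)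
    (fun x hx => by
      have hx0 : x ≠ 0 := ne_zero_of_mem_unit_sphere ⟨x, hx⟩
      obtain ⟨φ, hφ, hc, hne⟩ := exists_pairing_zero_ne_zero
        (fun h => hx0 (affineScore_eq_zero hinj h) : affineScore γ z₀ x ≠ 0)
      refine mem_iUnion.2 ⟨⟨φ, hφ, hc⟩, ?_⟩
      rwa [mem_ofPred_eq, h0, Submodule.coe_zero])
  have hcont : Continuous fun x => ‖affinePairing γ Φ z₀ x‖ :=
    (continuous_pi fun φ : Φ => continuous_pairing_affineScore φ.1 hz₀).norm
  obtain ⟨a, ha, hle⟩ := hcpt.exists_forall_le' (a := 0) hcont.continuousOn fun x hx => by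
    obtain ⟨φ, hφ, hne⟩ := mem_iUnion₂.1 (hΦ hx)
    rw [mem_ofPred_eq] at hne
    exact (abs_pos.2 hne).trans_le (norm_le_pi_norm (affinePairing γ Φ z₀ x) ⟨φ, hφ⟩)
  refine ⟨Φ, a / 2, by positivity, fun x => ?_⟩
  rw [mul_div_cancel₀ _ two_ne_zero]
  rcases eq_or_ne x 0 with rfl | hx
  · simp
  have h1 := hle (‖x‖⁻¹ • x) (by
    rw [mem_sphere_zero_iff_norm, norm_smul, norm_inv, norm_norm,
      inv_mul_cancel₀ (norm_ne_zero_iff.2 hx)])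
  rw [affinePairing_smul, norm_smul, norm_inv, norm_norm, ← div_eq_inv_mul,
    le_div_iff₀ (norm_pos_iff.2 hx)] at h1
  exact h1

/-- The parameter enters through exp(γ z) and through Dγ(z). The second derivative of γ is needed to
make Dγ Lipschitz. -/
theorem exists_norm_affinePairing_sub_le (hγ : ContDiffAt ℝ 2 γ z₀) (h0 : γ z₀ = 0)
    (Φ : Finset (CompactTest n)) :
    ∃ ρ C L : ℝ, 0 < ρ ∧ 0 ≤ C ∧ 0 ≤ L ∧ (∀ z ∈ Metric.closedBall z₀ ρ, ‖γ z‖ < 2⁻¹) ∧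
      (∀ z ∈ Metric.closedBall z₀ ρ, ∀ z' ∈ Metric.closedBall z₀ ρ, ‖γ z - γ z'‖ ≤ L * ‖z - z'‖) ∧
      ∀ z ∈ Metric.closedBall z₀ ρ, ∀ z' ∈ Metric.closedBall z₀ ρ, ∀ x,
        ‖affinePairing γ Φ z x - affinePairing γ Φ z' x‖ ≤ C * ‖z - z'‖ * ‖x‖ := by
  choose M hM using fun φ : CompactTest n => φ.exists_abs_le
  obtain ⟨M', hM'⟩ := Finite.exists_le fun φ : Φ => M φ.1
  set B := max M' 0 with hB
  have hB0 : 0 ≤ B := le_max_right _ _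
  have hφB : ∀ (φ : Φ) x, |φ.1.1 x| ≤ B := fun φ x =>
    (hM φ.1 x).trans ((hM' φ).trans (le_max_left _ _))
  obtain ⟨K₁, s₁, hs₁, hK₁⟩ := (hγ.of_le one_le_two).exists_lipschitzOnWith
  obtain ⟨K₂, s₂, hs₂, hK₂⟩ := (hγ.fderiv_right (m := 1) (by norm_num)).exists_lipschitzOnWith
  have hnorm : {z | ‖γ z‖ < 2⁻¹} ∈ 𝓝 z₀ := by
    refine hγ.continuousAt.norm.eventually_lt_const ?_
    simp only [h0, norm_zero]
    norm_num
  have hnorm' : {z | ‖fderiv ℝ γ z‖ < ‖fderiv ℝ γ z₀‖ + 1} ∈ 𝓝 z₀ :=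
    (hγ.fderiv_right (m := 1) (by norm_num)).continuousAt.norm.eventually_lt_const (by linarith)
  obtain ⟨ρ, hρ, hsub⟩ := Metric.nhds_basis_closedBall.mem_iff.1
    (inter_mem (inter_mem hs₁ hs₂) (inter_mem hnorm hnorm'))
  have hγL : ∀ z ∈ Metric.closedBall z₀ ρ, ∀ z' ∈ Metric.closedBall z₀ ρ,
      ‖γ z - γ z'‖ ≤ K₁ * ‖z - z'‖ := fun z hz z' hz' =>
    hK₁.norm_sub_le (hsub hz).1.1 (hsub hz').1.1
  set D := ‖fderiv ℝ γ z₀‖ + 1 + ‖LPhi.const q₀ 1‖ with hD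
  have hD0 : 0 ≤ D := by positivity
  refine ⟨ρ, 384 * B * K₁ * D + 192 * ‖LPhi.const q₀ 1‖ * B * K₂, K₁, hρ, by positivity,
    K₁.2, fun z hz => (hsub hz).2.1, hγL, fun z hz z' hz' x => ?_⟩
  refine (pi_norm_le_iff_of_nonneg (by positivity)).2 fun φ => ?_
  rw [Pi.sub_apply, affinePairing, affinePairing]
  have hm : AEStronglyMeasurable φ.1.1 q₀.prob := φ.1.2.1.continuous.aestronglyMeasurable
  have h1 := LPhi.abs_pairing_sub_le hB0 hm (hφB φ) (hsub hz).2.1 (hsub hz').2.1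
    (affineScore γ z x)
  have h2 := LPhi.abs_pairing_le hB0 (hφB φ) (hsub hz').2.1
    (affineScore γ z x - affineScore γ z' x)
  rw [LPhi.pairing_sub hm (hφB φ) (hsub hz').2.1] at h2
  have h3 : ‖affineScore γ z x‖ ≤ D * ‖x‖ := (norm_affineScore_le z x).trans <|
    mul_le_mul_of_nonneg_right (add_le_add_left (le_of_lt (hsub hz).2.2) _) (norm_nonneg _)
  have h4 : ‖affineScore γ z x - affineScore γ z' x‖ ≤ K₂ * ‖z - z'‖ * ‖x‖ :=
    (norm_affineScore_sub_le z z' x).trans <| mul_le_mul_of_nonneg_right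
      (hK₂.norm_sub_le (hsub hz).1.2 (hsub hz').1.2) (norm_nonneg _)
  have h5 : ‖(γ z : LPhi q₀) - (γ z' : LPhi q₀)‖ ≤ K₁ * ‖z - z'‖ := hγL z hz z' hz'
  rw [Real.norm_eq_abs]
  calc _ ≤ 384 * B * ‖(γ z : LPhi q₀) - (γ z' : LPhi q₀)‖ * ‖affineScore γ z x‖ +
        192 * ‖LPhi.const q₀ 1‖ * B * ‖affineScore γ z x - affineScore γ z' x‖ :=
        (abs_sub_le _ _ _).trans (add_le_add h1 h2)
    _ ≤ 384 * B * (K₁ * ‖z - z'‖) * (D * ‖x‖) +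
        192 * ‖LPhi.const q₀ 1‖ * B * (K₂ * ‖z - z'‖ * ‖x‖) := by gcongr
    _ = _ := by ring

/-- On a finite dimensional submanifold the vector field `q ↦ L_t* q / q` is locally Lipschitz and
continuous in time. -/
theorem exists_paramScore_regular [FiniteDimensional ℝ Z] (hf : IsCk0 1 f)
    (hσ : ∀ i j, IsCk0 2 fun t x => diffusionMatrix σ t x i j)
    (hN : ∀ q ∈ N, ExpConnected q₀ q) (hγ : ContDiffAt ℝ 2 γ z₀) (h0 : γ z₀ = 0)
    (hinj : Function.Injective (fderiv ℝ γ z₀)) {a b : ℝ} (ha : 0 ≤ a) :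
    ∃ ρ : ℝ, 0 < ρ ∧ ∃ K : ℝ≥0, ∀ ρ' ≤ ρ, ∀ G : ℝ → Z → Z,
      (∀ t ∈ Icc a b, ∀ z ∈ Metric.closedBall z₀ ρ', IsParamScore f σ N γ t z (G t z)) →
      (∀ t ∈ Icc a b, LipschitzOnWith K (G t) (Metric.closedBall z₀ ρ')) ∧
      ∀ z ∈ Metric.closedBall z₀ ρ', ContinuousOn (fun t => G t z) (Icc a b) := by
  obtain ⟨Φ, c, hc, hlow⟩ := exists_affinePairing_lower (n := n) h0 hinj
  obtain ⟨ρ₀, C, L, hρ₀, hC, hL, hsmall, hγL, hT⟩ := exists_norm_affinePairing_sub_le hγ h0 Φ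
  choose M hM0 hM using fun φ : CompactTest n =>
    exists_abs_backwardOp_le hf hσ φ.2.1 φ.2.2 (b := b) ha
  obtain ⟨M', hM'⟩ := Finite.exists_le fun φ : Φ => M φ.1
  set B := max M' 0 with hB
  have hB0 : 0 ≤ B := le_max_right _ _
  have hφB : ∀ (φ : Φ), ∀ t ∈ Icc a b, ∀ x,
      |backwardOp (f t) (diffusionMatrix σ t) φ.1.1 x| ≤ B := fun φ t ht x =>
    (hM φ.1 t ht x).trans ((hM' φ).trans (le_max_left _ _))
  set R : ℝ → Z → Φ → ℝ := fun t z φ =>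
    LPhi.pairing (backwardOp (f t) (diffusionMatrix σ t) φ.1.1) (γ z : LPhi q₀) (LPhi.const q₀ 1)
    with hR
  set A := 192 * ‖LPhi.const q₀ 1‖ * B * ‖LPhi.const q₀ 1‖ with hA
  have hA0 : 0 ≤ A := by positivity
  set A' := 384 * B * L * ‖LPhi.const q₀ 1‖ with hA'
  have hA0' : 0 ≤ A' := by positivity
  have hRle : ∀ t ∈ Icc a b, ∀ z ∈ Metric.closedBall z₀ ρ₀, ‖R t z‖ ≤ A := fun t ht z hz =>
    (pi_norm_le_iff_of_nonneg hA0).2 fun φ =>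
      LPhi.abs_pairing_le hB0 (hφB φ t ht) (hsmall z hz) _
  have hRsub : ∀ t ∈ Icc a b, ∀ z ∈ Metric.closedBall z₀ ρ₀, ∀ z' ∈ Metric.closedBall z₀ ρ₀,
      ‖R t z - R t z'‖ ≤ A' * ‖z - z'‖ := fun t ht z hz z' hz' => by
    refine (pi_norm_le_iff_of_nonneg (by positivity)).2 fun φ => ?_
    have hm : AEStronglyMeasurable (backwardOp (f t) (diffusionMatrix σ t) φ.1.1) q₀.prob :=
      (continuous_backwardOp (hf.1 t (ha.trans ht.1)).continuous
        (fun i j => (hσ i j).1 t (ha.trans ht.1) |>.continuous) φ.1.2.1).aestronglyMeasurable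
    have hs : ‖(γ z : LPhi q₀)‖ < 2⁻¹ := hsmall z hz
    have hs' : ‖(γ z' : LPhi q₀)‖ < 2⁻¹ := hsmall z' hz'
    refine (LPhi.abs_pairing_sub_le hB0 hm (hφB φ t ht) hs hs' _).trans ?_
    have h5 : ‖(γ z : LPhi q₀) - (γ z' : LPhi q₀)‖ ≤ L * ‖z - z'‖ := hγL z hz z' hz'
    calc _ ≤ 384 * B * (L * ‖z - z'‖) * ‖LPhi.const q₀ 1‖ := by gcongr
      _ = _ := by rw [hA']; ring
  have hRcont : ∀ z ∈ Metric.closedBall z₀ ρ₀, ContinuousOn (fun t => R t z) (Icc a b) :=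
    fun z hz => continuousOn_pi.2 fun φ =>
      continuousOn_pairing_backwardOp hf hσ φ.1.2.1 φ.1.2.2 ha (hsmall z hz) _
  -- Over this ball the pairing varies by at most c, half of the lower bound at z₀.
  set ρ := min ρ₀ (c / (C + 1)) with hρ
  have hρpos : 0 < ρ := lt_min hρ₀ (by positivity)
  have hCρ : C * ρ ≤ c := by
    have h1 : (C + 1) * ρ ≤ c := by
      rw [← le_div_iff₀' (by positivity)]
      exact min_le_right _ _
    nlinarith
  have hsub : Metric.closedBall z₀ ρ ⊆ Metric.closedBall z₀ ρ₀ :=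
    Metric.closedBall_subset_closedBall (min_le_left _ _)
  have key : ∀ z ∈ Metric.closedBall z₀ ρ, ∀ z' ∈ Metric.closedBall z₀ ρ, ∀ x x',
      c * ‖x - x'‖ ≤ ‖affinePairing γ Φ z x - affinePairing γ Φ z' x'‖ + C * ‖z - z'‖ * ‖x'‖ :=
    fun z hz z' hz' x x' => antilipschitz_perturb hC
      (fun z hz => affinePairing_sub (hsmall z (hsub hz))) hlow hρpos.le hCρ
      (fun z hz z' hz' => hT z (hsub hz) z' (hsub hz')) hz hz' x x'
  -- Radius and constant are fixed before G, which may be defined only over a smaller ball.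
  refine ⟨ρ, hρpos, Real.toNNReal ((A' + C * (A / c)) / c), fun ρ' hρ' G hG => ?_⟩
  have hsub' : Metric.closedBall z₀ ρ' ⊆ Metric.closedBall z₀ ρ :=
    Metric.closedBall_subset_closedBall hρ'
  have hx : ∀ t ∈ Icc a b, ∀ z ∈ Metric.closedBall z₀ ρ', ∃ e,
      affinePairing γ Φ z (G t z, e) = R t z := fun t ht z hz => by
    obtain ⟨e, he⟩ := (hG t ht z hz).exists_pairing (hf.1 t (ha.trans ht.1))
      (fun i j => (hσ i j).1 t (ha.trans ht.1)) hN
    exact ⟨e, funext fun φ => he φ.1.1 φ.1.2.1 φ.1.2.2⟩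
  refine ⟨fun t ht => LipschitzOnWith.of_dist_le_mul fun z hz z' hz' => ?_, fun z hz => ?_⟩
  · obtain ⟨e, he⟩ := hx t ht z hz
    obtain ⟨e', he'⟩ := hx t ht z' hz'
    have h1 := key z (hsub' hz) z' (hsub' hz') (G t z, e) (G t z', e')
    -- Comparison with the zero vector bounds the solution (w, e) itself by A/c.
    have h2 := key z' (hsub' hz') z' (hsub' hz') (G t z', e') 0
    have h3 : affinePairing γ Φ z' (0 : Z × ℝ) = 0 := by
      rw [← zero_smul ℝ (0 : Z × ℝ), affinePairing_smul, zero_smul]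
    rw [he, he'] at h1
    rw [he', h3, sub_zero, sub_zero, norm_zero, mul_zero, add_zero] at h2
    have h4 : ‖((G t z', e') : Z × ℝ)‖ ≤ A / c := by
      rw [le_div_iff₀' hc]
      exact h2.trans (hRle t ht z' (hsub (hsub' hz')))
    rw [Real.coe_toNNReal _ (by positivity), dist_eq_norm, dist_eq_norm, div_mul_eq_mul_div,
      le_div_iff₀' hc]
    calc c * ‖G t z - G t z'‖ ≤ c * ‖((G t z, e) : Z × ℝ) - (G t z', e')‖ := by
          gcongr
          exact norm_fst_le (((G t z, e) : Z × ℝ) - (G t z', e'))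
      _ ≤ A' * ‖z - z'‖ + C * ‖z - z'‖ * (A / c) := h1.trans (add_le_add
          (hRsub t ht z (hsub (hsub' hz)) z' (hsub (hsub' hz'))) (by gcongr))
      _ = _ := by ring
  · intro t ht
    have hlim : Tendsto (fun s => ‖R s z - R t z‖ / c) (𝓝[Icc a b] t) (𝓝 0) := by
      have h1 := tendsto_iff_norm_sub_tendsto_zero.1 (hRcont z (hsub (hsub' hz)) t ht)
      simpa using h1.div_const c
    refine tendsto_iff_norm_sub_tendsto_zero.2 (squeeze_zero'
      (Eventually.of_forall fun s => norm_nonneg _) ?_ hlim)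
    filter_upwards [self_mem_nhdsWithin] with s hs
    obtain ⟨e, he⟩ := hx s hs z hz
    obtain ⟨e', he'⟩ := hx t ht z hz
    have h1 := key z (hsub' hz) z (hsub' hz) (G s z, e) (G t z, e')
    rw [he, he', sub_self z, norm_zero, mul_zero, zero_mul, add_zero] at h1
    rw [le_div_iff₀' hc]
    refine le_trans ?_ h1
    gcongr
    exact norm_fst_le (((G s z, e) : Z × ℝ) - (G t z, e'))

end FiniteDimensionalField

/-! ### The slice of a splitting chart that parametrizes the submanifold. -/

section Slice

variable {E Z W : Type*} [NormedAddCommGroup E] [NormedAddCommGroup Z] [NormedAddCommGroup W]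
  {φ : OpenPartialHomeomorph E (Z × W)} {z : Z}

/-- The slice `W = 0` of the chart `φ`, as a function of the coordinate in `Z`. -/
def chartSlice (φ : OpenPartialHomeomorph E (Z × W)) (z : Z) : E := φ.symm (z, 0)

theorem eventually_mem_target (hz : (z, 0) ∈ φ.target) : ∀ᶠ y in 𝓝 z, (y, 0) ∈ φ.target :=
  (Continuous.tendsto (by fun_prop : Continuous fun y : Z => (y, (0 : W))) z).eventually
    (φ.open_target.mem_nhds hz)

theorem chartSlice_mem_source (hz : (z, 0) ∈ φ.target) : chartSlice φ z ∈ φ.source :=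
  φ.map_target hz

theorem apply_chartSlice (hz : (z, 0) ∈ φ.target) : φ (chartSlice φ z) = (z, 0) :=
  φ.right_inv hz

variable [NormedSpace ℝ E] [NormedSpace ℝ Z] [NormedSpace ℝ W]

theorem contDiffAt_chartSlice (hs : ContDiffOn ℝ 2 φ.symm φ.target) (hz : (z, 0) ∈ φ.target) :
    ContDiffAt ℝ 2 (chartSlice φ) z :=
  ContDiffAt.comp z (hs.contDiffAt (φ.open_target.mem_nhds hz))
    (contDiffAt_id.prodMk contDiffAt_const)

theorem hasFDerivAt_chart (hφ : ContDiffOn ℝ 2 φ φ.source) {u : E} (hu : u ∈ φ.source) :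
    HasFDerivAt φ (fderiv ℝ φ u) u :=
  ((hφ.contDiffAt (φ.open_source.mem_nhds hu)).differentiableAt two_ne_zero).hasFDerivAt

theorem fderiv_apply_fderiv_chartSlice (hφ : ContDiffOn ℝ 2 φ φ.source)
    (hs : ContDiffOn ℝ 2 φ.symm φ.target) (hz : (z, 0) ∈ φ.target) (w : Z) :
    fderiv ℝ φ (chartSlice φ z) (fderiv ℝ (chartSlice φ) z w) = (w, 0) := by
  have h1 : HasFDerivAt (fun y => φ (chartSlice φ y))
      ((fderiv ℝ φ (chartSlice φ z)).comp (fderiv ℝ (chartSlice φ) z)) z :=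
    (hasFDerivAt_chart hφ (chartSlice_mem_source hz)).comp z
      ((contDiffAt_chartSlice hs hz).differentiableAt two_ne_zero).hasFDerivAt
  have h2 : HasFDerivAt (fun y => φ (chartSlice φ y)) (ContinuousLinearMap.inl ℝ Z W) z :=
    (hasFDerivAt_prodMk_left z (0 : W)).congr_of_eventuallyEq
      ((eventually_mem_target hz).mono fun y hy => apply_chartSlice hy)
  exact congrArg (fun A => A w) (h1.unique h2)

theorem injective_fderiv_chartSlice (hφ : ContDiffOn ℝ 2 φ φ.source)
    (hs : ContDiffOn ℝ 2 φ.symm φ.target) (hz : (z, 0) ∈ φ.target) :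
    Function.Injective (fderiv ℝ (chartSlice φ) z) := fun w w' h => by
  have h1 := fderiv_apply_fderiv_chartSlice hφ hs hz w
  rw [h, fderiv_apply_fderiv_chartSlice hφ hs hz w'] at h1
  exact (Prod.ext_iff.1 h1).1.symm

/-- A vector whose image under the chart has no W component is reproduced by the slice, because the
derivatives of the chart and of its inverse are mutually inverse. -/
theorem fderiv_chartSlice_apply (hφ : ContDiffOn ℝ 2 φ φ.source)
    (hs : ContDiffOn ℝ 2 φ.symm φ.target) (hz : (z, 0) ∈ φ.target) {U : E}
    (hU : (fderiv ℝ φ (chartSlice φ z) U).2 = 0) :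
    fderiv ℝ (chartSlice φ) z (fderiv ℝ φ (chartSlice φ z) U).1 = U := by
  have hs' : HasFDerivAt φ.symm (fderiv ℝ φ.symm (z, 0)) (z, 0) :=
    ((hs.contDiffAt (φ.open_target.mem_nhds hz)).differentiableAt two_ne_zero).hasFDerivAt
  have hp : HasFDerivAt (chartSlice φ)
      ((fderiv ℝ φ.symm (z, 0)).comp (ContinuousLinearMap.inl ℝ Z W)) z :=
    HasFDerivAt.comp z (f := fun y : Z => (y, (0 : W))) hs' (hasFDerivAt_prodMk_left z (0 : W))
  rw [← apply_chartSlice hz] at hs'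
  have h1 := (hs'.comp (chartSlice φ z) (hasFDerivAt_chart hφ (chartSlice_mem_source hz))).unique
    ((hasFDerivAt_id (𝕜 := ℝ) (chartSlice φ z)).congr_of_eventuallyEq
      (φ.eventually_left_inverse (chartSlice_mem_source hz)))
  have h2 := congrArg (fun A => A U) h1
  have h3 : ((fderiv ℝ φ (chartSlice φ z) U).1, (0 : W)) = fderiv ℝ φ (chartSlice φ z) U :=
    Prod.ext rfl hU.symm
  rw [hp.fderiv]
  change fderiv ℝ φ.symm (z, 0) ((fderiv ℝ φ (chartSlice φ z) U).1, (0 : W)) = U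
  rw [h3, ← apply_chartSlice hz]
  exact h2

/-- Along a curve in the submanifold the W coordinate is constantly zero, and so is its derivative.
-/
theorem fderiv_chart_snd_eq_zero (hφ : ContDiffOn ℝ 2 φ φ.source) (hz : (z, 0) ∈ φ.target)
    {S : Set E} (hS : ∀ u ∈ φ.source, u ∈ S → (φ u).2 = 0) {κ : ℝ → E} {U : E}
    (hκ : HasDerivAt κ U 0) (hκ0 : κ 0 = chartSlice φ z) (hκS : ∀ᶠ s in 𝓝 0, κ s ∈ S) :
    (fderiv ℝ φ (chartSlice φ z) U).2 = 0 := by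
  have hmem : κ 0 ∈ φ.source := hκ0 ▸ chartSlice_mem_source hz
  rw [← hκ0]
  have hd : HasDerivAt (fun s => (φ (κ s)).2) (fderiv ℝ φ (κ 0) U).2 0 :=
    (ContinuousLinearMap.snd ℝ Z W).hasFDerivAt.comp_hasDerivAt (0 : ℝ)
      ((hasFDerivAt_chart hφ hmem).comp_hasDerivAt (0 : ℝ) hκ)
  refine hd.unique ((hasDerivAt_const (0 : ℝ) (0 : W)).congr_of_eventuallyEq ?_)
  filter_upwards [hκ.continuousAt.eventually_mem (φ.open_source.mem_nhds hmem), hκS] with s h1 h2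
  exact hS _ h1 h2

/-- Lipschitz regularity of a vector field on the slice, given by the vector field `F` on `E`. -/
theorem exists_lipschitzOnWith_chartSlice (hφ : ContDiffOn ℝ 2 φ φ.source)
    (hs : ContDiffOn ℝ 2 φ.symm φ.target) (hz : (z, 0) ∈ φ.target) {F : ℝ → E → E} {I : Set ℝ}
    (hI : IsCompact I) {O S : Set E} {L : ℝ≥0} (hO : O ∈ 𝓝 (chartSlice φ z))
    (hS : ∀ y, (y, 0) ∈ φ.target → chartSlice φ y ∈ S)
    (hF : ∀ t ∈ I, LipschitzOnWith L (F t) (O ∩ S))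
    (hFc : ∀ u ∈ O ∩ S, ContinuousOn (fun t => F t u) I) :
    ∃ ρ : ℝ, 0 < ρ ∧ (∀ y ∈ Metric.closedBall z ρ, chartSlice φ y ∈ O ∧ (y, 0) ∈ φ.target) ∧
      ∃ K : ℝ≥0, (∀ t ∈ I, LipschitzOnWith K
        (fun y => (fderiv ℝ φ (chartSlice φ y) (F t (chartSlice φ y))).1) (Metric.closedBall z ρ)) ∧
      ∀ y ∈ Metric.closedBall z ρ, ContinuousOn
        (fun t => (fderiv ℝ φ (chartSlice φ y) (F t (chartSlice φ y))).1) I := by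
  have hγ := contDiffAt_chartSlice hs hz
  have hsrc := φ.open_source.mem_nhds (chartSlice_mem_source hz)
  obtain ⟨K₁, s₁, hs₁, hK₁⟩ := (hγ.of_le one_le_two).exists_lipschitzOnWith
  have hA : ContDiffAt ℝ 1 (fun y => fderiv ℝ φ (chartSlice φ y)) z :=
    ContDiffAt.comp z ((hφ.contDiffAt hsrc).fderiv_right (m := 1) (by norm_num))
      (hγ.of_le one_le_two)
  obtain ⟨K₂, s₂, hs₂, hK₂⟩ := hA.exists_lipschitzOnWith
  set D := ‖fderiv ℝ φ (chartSlice φ z)‖ + 1 with hD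
  have hnorm : ∀ᶠ y in 𝓝 z, ‖fderiv ℝ φ (chartSlice φ y)‖ < D :=
    hA.continuousAt.norm.eventually_lt_const (by linarith)
  obtain ⟨ρ, hρ, hsub⟩ := Metric.nhds_basis_closedBall.mem_iff.1
    (inter_mem (inter_mem (inter_mem hs₁ hs₂) (inter_mem hnorm (hγ.continuousAt.preimage_mem_nhds hO)))
      (eventually_mem_target hz))
  have hOS : ∀ y ∈ Metric.closedBall z ρ, chartSlice φ y ∈ O ∩ S := fun y hy =>
    ⟨(hsub hy).1.2.2, hS y (hsub hy).2⟩
  have hz0 : z ∈ Metric.closedBall z ρ := Metric.mem_closedBall_self hρ.le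
  obtain ⟨M, hM⟩ := hI.exists_bound_of_continuousOn (hFc _ (hOS z hz0))
  -- A bound for F on the slice, from its bound at the centre over the compact time set plus its
  -- Lipschitz variation. Applying the varying derivative of the chart to F is Lipschitz only with
  -- both factors bounded.
  set B := max M 0 + L * (K₁ * ρ) with hB
  have hB0 : 0 ≤ B := by positivity
  have hFle : ∀ t ∈ I, ∀ y ∈ Metric.closedBall z ρ, ‖F t (chartSlice φ y)‖ ≤ B := fun t ht y hy => by
    have h1 := (hF t ht).norm_sub_le (hOS y hy) (hOS z hz0)
    have h2 := hK₁.norm_sub_le (hsub hy).1.1.1 (hsub hz0).1.1.1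
    have h3 : ‖y - z‖ ≤ ρ := by rw [← dist_eq_norm]; exact hy
    have h4 : L * ‖chartSlice φ y - chartSlice φ z‖ ≤ L * (K₁ * ρ) :=
      mul_le_mul_of_nonneg_left (h2.trans (mul_le_mul_of_nonneg_left h3 K₁.2)) L.2
    have h5 := norm_add_le (F t (chartSlice φ y) - F t (chartSlice φ z)) (F t (chartSlice φ z))
    rw [sub_add_cancel] at h5
    have h6 := (hM t ht).trans (le_max_left _ 0)
    linarith
  refine ⟨ρ, hρ, fun y hy => ⟨(hsub hy).1.2.2, (hsub hy).2⟩,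
    Real.toNNReal (D * (L * K₁) + K₂ * B), fun t ht => ?_, fun y hy => ?_⟩
  · refine LipschitzOnWith.of_dist_le_mul fun y hy y' hy' => ?_
    have hD0 : 0 ≤ D := by positivity
    rw [Real.coe_toNNReal _ (by positivity), dist_eq_norm, dist_eq_norm, ← Prod.fst_sub]
    refine (norm_fst_le _).trans ?_
    have h1 := (hF t ht).norm_sub_le (hOS y hy) (hOS y' hy')
    have h2 := hK₁.norm_sub_le (hsub hy).1.1.1 (hsub hy').1.1.1
    have h3 := hK₂.norm_sub_le (hsub hy).1.1.2 (hsub hy').1.1.2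
    have h4 : ‖F t (chartSlice φ y) - F t (chartSlice φ y')‖ ≤ L * (K₁ * ‖y - y'‖) :=
      h1.trans (mul_le_mul_of_nonneg_left h2 L.2)
    have h5 : fderiv ℝ φ (chartSlice φ y) (F t (chartSlice φ y)) -
        fderiv ℝ φ (chartSlice φ y') (F t (chartSlice φ y')) =
        fderiv ℝ φ (chartSlice φ y) (F t (chartSlice φ y) - F t (chartSlice φ y')) +
        (fderiv ℝ φ (chartSlice φ y) - fderiv ℝ φ (chartSlice φ y')) (F t (chartSlice φ y')) := by
      rw [map_sub, sub_apply]
      abel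
    rw [h5]
    calc _ ≤ ‖fderiv ℝ φ (chartSlice φ y)‖ * ‖F t (chartSlice φ y) - F t (chartSlice φ y')‖ +
          ‖fderiv ℝ φ (chartSlice φ y) - fderiv ℝ φ (chartSlice φ y')‖ *
            ‖F t (chartSlice φ y')‖ :=
          (norm_add_le _ _).trans (add_le_add (ContinuousLinearMap.le_opNorm _ _)
            (ContinuousLinearMap.le_opNorm _ _))
      _ ≤ D * (L * (K₁ * ‖y - y'‖)) + K₂ * ‖y - y'‖ * B :=
          add_le_add (mul_le_mul (le_of_lt (hsub hy).1.2.1) h4 (norm_nonneg _) hD0)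
            (mul_le_mul h3 (hFle t ht y' hy') (norm_nonneg _) (by positivity))
      _ = _ := by ring
  · exact continuous_fst.comp_continuousOn
      ((fderiv ℝ φ (chartSlice φ y)).continuous.comp_continuousOn (hFc _ (hOS y hy)))

end Slice

/-! ### Integral curves of the field inside the submanifold. -/

section LocalSolution

theorem lipschitzOnWith_and_continuousOn_congr {Z : Type*} [NormedAddCommGroup Z]
    {G H : ℝ → Z → Z} {I : Set ℝ} {s s' : Set Z} {K : ℝ≥0} (hs : s' ⊆ s)
    (hK : ∀ t ∈ I, LipschitzOnWith K (H t) s) (hc : ∀ z ∈ s, ContinuousOn (fun t => H t z) I)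
    (h : ∀ t ∈ I, ∀ z ∈ s', G t z = H t z) :
    (∀ t ∈ I, LipschitzOnWith K (G t) s') ∧ ∀ z ∈ s', ContinuousOn (fun t => G t z) I := by
  refine ⟨fun t ht z hz y hy => ?_, fun z hz => (hc z (hs hz)).congr fun t ht => h t ht z hz⟩
  rw [h t ht z hz, h t ht y hy]
  exact hK t ht (hs hz) (hs hy)

theorem exists_forall_Icc_of_eventually {a b : ℝ} (hab : a < b) {φ : ℝ → Prop}
    (h : ∀ᶠ t in 𝓝[≥] a, φ t) : ∃ T ∈ Ioc a b, ∀ t ∈ Icc a T, φ t := by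
  obtain ⟨u, hu, hsub⟩ := mem_nhdsGE_iff_exists_Icc_subset.1 h
  exact ⟨min u b, ⟨lt_min hu hab, min_le_right _ _⟩, fun t ht =>
    hsub ⟨ht.1, ht.2.trans (min_le_left _ _)⟩⟩

theorem exists_hasDerivWithinAt_mem_closedBall {Z : Type*} [NormedAddCommGroup Z] [NormedSpace ℝ Z]
    [CompleteSpace Z] {G : ℝ → Z → Z} {z₀ : Z} {a b ρ : ℝ} {K : ℝ≥0} (hab : a < b) (hρ : 0 < ρ)
    (hLip : ∀ t ∈ Icc a b, LipschitzOnWith K (G t) (Metric.closedBall z₀ ρ))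
    (hcont : ∀ z ∈ Metric.closedBall z₀ ρ, ContinuousOn (fun t => G t z) (Icc a b)) :
    ∃ T ∈ Ioc a b, ∃ z : ℝ → Z, z a = z₀ ∧ ∀ t ∈ Icc a T, z t ∈ Metric.closedBall z₀ ρ ∧
      HasDerivWithinAt z (G t (z t)) (Icc a T) t := by
  have hz₀ : z₀ ∈ Metric.closedBall z₀ ρ := Metric.mem_closedBall_self hρ.le
  obtain ⟨M, hM⟩ := isCompact_Icc.exists_bound_of_continuousOn (hcont z₀ hz₀)
  set L := max M 0 + K * ρ with hL
  have hL0 : 0 ≤ L := by positivity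
  have hle : ∀ t ∈ Icc a b, ∀ z ∈ Metric.closedBall z₀ ρ, ‖G t z‖ ≤ L := fun t ht z hz => by
    have h1 := (hLip t ht).norm_sub_le hz hz₀
    have h2 : K * ‖z - z₀‖ ≤ K * ρ :=
      mul_le_mul_of_nonneg_left (by rw [← dist_eq_norm]; exact hz) K.2
    have h3 := norm_add_le (G t z - G t z₀) (G t z₀)
    rw [sub_add_cancel] at h3
    have h4 := (hM t ht).trans (le_max_left _ 0)
    linarith
  -- A time span too short for speed L to cross the radius ρ.
  set δ := min (b - a) (ρ / (L + 1)) with hδ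
  have hδ0 : 0 < δ := lt_min (sub_pos.2 hab) (by positivity)
  have hsub : Icc a (a + δ) ⊆ Icc a b := Icc_subset_Icc_right (by
    linarith [min_le_left (b - a) (ρ / (L + 1))])
  have hLδ : L * δ ≤ ρ := by
    have h1 : (L + 1) * δ ≤ ρ := by
      rw [← le_div_iff₀' (by positivity)]
      exact min_le_right _ _
    linarith
  have hPL : IsPicardLindelof G (tmin := a) (tmax := a + δ) ⟨a, by simp [hδ0.le]⟩ z₀ ⟨ρ, hρ.le⟩ 0
      ⟨L, hL0⟩ K :=
    { lipschitzOnWith := fun t ht => hLip t (hsub ht)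
      continuousOn := fun z hz => (hcont z hz).mono hsub
      norm_le := fun t ht z hz => hle t (hsub ht) z hz
      mul_max_le := by
        simp only [add_sub_cancel_left, sub_self, NNReal.coe_zero, sub_zero,
          max_eq_left hδ0.le]
        exact hLδ }
  obtain ⟨z, hza, hz⟩ := hPL.exists_eq_forall_mem_Icc_hasDerivWithinAt₀
  have hza' : z a = z₀ := hza
  have hev : ∀ᶠ t in 𝓝[≥] a, z t ∈ Metric.closedBall z₀ ρ := by
    rw [← nhdsWithin_Icc_eq_nhdsGE (lt_add_of_pos_right a hδ0)]
    refine (hz a ⟨le_rfl, by linarith⟩).continuousWithinAt ?_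
    rw [hza']
    exact Metric.closedBall_mem_nhds _ hρ
  obtain ⟨T, hT, hball⟩ := exists_forall_Icc_of_eventually (lt_add_of_pos_right a hδ0) hev
  have hTsub : Icc a T ⊆ Icc a (a + δ) := Icc_subset_Icc_right hT.2
  have hTb : T ≤ b := (hsub ⟨hT.1.le, hT.2⟩).2
  exact ⟨T, ⟨hT.1, hTb⟩, z, hza', fun t ht => ⟨hball t ht, (hz t (hTsub ht)).mono hTsub⟩⟩

variable {n m : ℕ} {f : ℝ → EuclideanSpace ℝ (Fin n) → EuclideanSpace ℝ (Fin n)}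
  {σ : ℝ → EuclideanSpace ℝ (Fin n) → Matrix (Fin n) (Fin m) ℝ}
  {N : Set (PosDensity (volume : Measure (EuclideanSpace ℝ (Fin n))))}
  {q₀ r : PosDensity (volume : Measure (EuclideanSpace ℝ (Fin n)))}

/-- Around a point of `N` the vector field `q ↦ L_t* q / q` has an integral curve in `N`, which is a
solution of the Fokker-Planck equation. -/
theorem exists_curve_of_isParamScore {Z : Type*} [NormedAddCommGroup Z] [NormedSpace ℝ Z]
    [CompleteSpace Z] {γ : Z → BSpace q₀} {G : ℝ → Z → Z} {z₀ : Z} {a b ρ : ℝ} {K : ℝ≥0}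
    (hN : ∀ q ∈ N, ExpConnected q₀ q) (h0 : γ z₀ = 0)
    (hγ : ∀ z ∈ Metric.closedBall z₀ ρ, DifferentiableAt ℝ γ z)
    (hG : ∀ t ∈ Icc a b, ∀ z ∈ Metric.closedBall z₀ ρ, IsParamScore f σ N γ t z (G t z))
    (hab : a < b) (hρ : 0 < ρ)
    (hLip : ∀ t ∈ Icc a b, LipschitzOnWith K (G t) (Metric.closedBall z₀ ρ))
    (hcont : ∀ z ∈ Metric.closedBall z₀ ρ, ContinuousOn (fun t => G t z) (Icc a b)) :
    ∃ T ∈ Ioc a b, ∃ c : ℝ → PosDensity (volume : Measure (EuclideanSpace ℝ (Fin n))),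
      c a = q₀ ∧ ∀ t ∈ Icc a T, c t ∈ N ∧ ∃ g, ContDiff ℝ 2 g ∧ (c t).toFun =ᵐ[volume] g ∧
        HasL1DerivWithinAt c (forwardOp (f t) (diffusionMatrix σ t) g) (Icc a T) t := by
  obtain ⟨T, hT, z, hza, hz⟩ := exists_hasDerivWithinAt_mem_closedBall hab hρ hLip hcont
  have hex : ∀ t, ∃ q : PosDensity (volume : Measure (EuclideanSpace ℝ (Fin n))), t ∈ Icc a T →
      q ∈ N ∧ expChart q₀ q = γ (z t) ∧ ∃ V : BSpace q, IsForwardScore f σ t q V ∧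
      BSpace.fn (fderiv ℝ γ (z t) (G t (z t))) =ᵐ[volume]
        fun x => BSpace.fn V x - q₀.expect (BSpace.fn V) := fun t => by
    by_cases ht : t ∈ Icc a T
    · obtain ⟨q, hq⟩ := hG t ⟨ht.1, ht.2.trans hT.2⟩ (z t) (hz t ht).1
      exact ⟨q, fun _ => hq⟩
    · exact ⟨q₀, fun h => absurd h ht⟩
  choose c hc using hex
  have haT : a ∈ Icc a T := ⟨le_rfl, hT.1.le⟩
  refine ⟨T, hT, c, ?_, fun t ht => ⟨(hc t ht).1, ?_⟩⟩
  · obtain ⟨h1, h2, -⟩ := hc a haT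
    refine (hN _ h1).eq_of_expChart_eq (ExpConnected.refl q₀) ?_
    rw [h2, hza, h0, expChart_self]
  obtain ⟨hcN, hcγ, V, ⟨g, hg, hcg, hVg⟩, hV⟩ := hc t ht
  have hconn := hN _ hcN
  have hev : ∀ᶠ s in 𝓝[Icc a T] t, ExpConnected q₀ (c s) :=
    eventually_nhdsWithin_of_forall fun s hs => hN _ (hc s hs).1
  have hd : HasDerivWithinAt (fun s => expChart q₀ (c s)) (fderiv ℝ γ (z t) (G t (z t)))
      (Icc a T) t :=
    ((hγ _ (hz t ht).1).hasFDerivAt.comp_hasDerivWithinAt t (hz t ht).2).congr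
      (fun s hs => (hc s hs).2.1) hcγ
  have hd' := hd.expChart_transport hconn hev hconn
  -- Moving the velocity from the chart at `q₀` to the chart at `c t` recenters it; as V has mean
  -- zero under `c t`, the constant E_{q₀}[V] cancels and V itself is recovered.
  have hVeq : BSpace.transport hconn.2 (fderiv ℝ γ (z t) (G t (z t))) = V := by
    have := (c t).isProbabilityMeasure
    have he : (c t).expect (BSpace.fn (fderiv ℝ γ (z t) (G t (z t)))) =
        -q₀.expect (BSpace.fn V) := by
      rw [PosDensity.expect, integral_congr_ae ((c t).prob_absolutelyContinuous.ae_le hV),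
        integral_sub (BSpace.integrable_fn V) (integrable_const _), integral_const,
        show ∫ x, BSpace.fn V x ∂(c t).prob = 0 from V.2]
      simp
    refine BSpace.ext_ae ?_
    filter_upwards [BSpace.fn_transport hconn.2 (fderiv ℝ γ (z t) (G t (z t))), hV] with x h1 h2
    rw [h1, h2, he]
    ring
  rw [hVeq] at hd'
  refine ⟨g, hg, hcg, (hasL1DerivWithinAt_of_expChart
    (eventually_nhdsWithin_of_forall fun s hs => hconn.symm.trans (hN _ (hc s hs).1)) hd').congr_ae ?_⟩
  filter_upwards [hcg, hVg, (c t).pos] with x h1 h2 h3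
  rw [h2, forwardScore, h1, mul_div_cancel₀ _ (h1 ▸ h3).ne']

/-- Identifies a coordinate velocity with the one read off from a field U given in the exponential
chart, so that the regularity of the latter passes to the former. -/
theorem IsParamScore.eq_apply {Z : Type*} [NormedAddCommGroup Z] [NormedSpace ℝ Z]
    {γ : Z → BSpace q₀} {t : ℝ} {z w : Z} (h : IsParamScore f σ N γ t z w) {A : BSpace q₀ → Z}
    (hA : A (fderiv ℝ γ z w) = w) {U : BSpace q₀}
    (hU : ∀ q ∈ N, expChart q₀ q = γ z → ∀ V : BSpace q, IsForwardScore f σ t q V →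
      BSpace.fn U =ᵐ[volume] fun x => BSpace.fn V x - q₀.expect (BSpace.fn V)) : w = A U := by
  obtain ⟨q, hq, hqz, V, hV, hfn⟩ := h
  rw [BSpace.ext_ae ((hU q hq hqz V hV).trans hfn.symm), hA]

theorem isClosed_BSpace (p : PosDensity (volume : Measure (EuclideanSpace ℝ (Fin n)))) :
    IsClosed (BSpace p : Set (LPhi p)) :=
  isClosed_eq (LPhi.expectL p).continuous continuous_const

theorem SplittingChart.completeSpace (C : SplittingChart N q₀) : CompleteSpace C.V₁ := by
  have := LPhi.completeSpace q₀
  have := (isClosed_BSpace q₀).completeSpace_coe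
  exact C.isClosed_V₁.completeSpace_coe

end LocalSolution

/-! ### Persistence of the flow in the submanifold for a short time. -/

section Invariance

variable {n m : ℕ} {f : ℝ → EuclideanSpace ℝ (Fin n) → EuclideanSpace ℝ (Fin n)}
  {σ : ℝ → EuclideanSpace ℝ (Fin n) → Matrix (Fin n) (Fin m) ℝ}
  {N : Set (PosDensity (volume : Measure (EuclideanSpace ℝ (Fin n))))}
  {q₀ r : PosDensity (volume : Measure (EuclideanSpace ℝ (Fin n)))}

/-- The diffeomorphism of a splitting chart, with the topologies of the norms. -/
def SplittingChart.chart (C : SplittingChart N q₀) :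
    @OpenPartialHomeomorph (BSpace q₀) (C.V₁ × C.V₂)
      (BSpace q₀).normedAddCommGroup.toPseudoMetricSpace.toUniformSpace.toTopologicalSpace
      (@instTopologicalSpaceProd _ _
        C.V₁.normedAddCommGroup.toPseudoMetricSpace.toUniformSpace.toTopologicalSpace
        C.V₂.normedAddCommGroup.toPseudoMetricSpace.toUniformSpace.toTopologicalSpace) := C.σ

theorem SplittingChart.contDiffOn_chart (C : SplittingChart N q₀) :
    ContDiffOn ℝ 2 C.chart C.chart.source := C.contDiffOn

theorem SplittingChart.contDiffOn_chart_symm (C : SplittingChart N q₀) :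
    ContDiffOn ℝ 2 C.chart.symm C.chart.target := C.contDiffOn_symm

theorem SplittingChart.mem_chart_iff (C : SplittingChart N q₀) :
    ∀ u ∈ C.chart.source, u ∈ expChart q₀ '' N ↔ (C.chart u).2 = 0 := C.mem_iff

theorem SplittingChart.zero_mem_chart_source (C : SplittingChart N q₀) :
    (0 : BSpace q₀) ∈ C.chart.source := C.zero_mem_source

theorem SplittingChart.slice_mem (C : SplittingChart N q₀) {z : C.V₁}
    (hz : (z, 0) ∈ C.chart.target) : chartSlice C.chart z ∈ expChart q₀ '' N :=
  (C.mem_chart_iff _ (chartSlice_mem_source hz)).2 (by rw [apply_chartSlice hz])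

theorem SplittingChart.apply_zero (C : SplittingChart N q₀) (hq₀ : q₀ ∈ N) :
    C.chart 0 = ((C.chart 0).1, 0) :=
  Prod.ext rfl ((C.mem_chart_iff 0 C.zero_mem_chart_source).1 ⟨q₀, hq₀, expChart_self q₀⟩)

theorem SplittingChart.slice_zero (C : SplittingChart N q₀) (hq₀ : q₀ ∈ N) :
    chartSlice C.chart (C.chart 0).1 = 0 := by
  rw [chartSlice, ← C.apply_zero hq₀, C.chart.left_inv C.zero_mem_chart_source]

theorem SplittingChart.zero_mem_target (C : SplittingChart N q₀) (hq₀ : q₀ ∈ N) :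
    ((C.chart 0).1, 0) ∈ C.chart.target := by
  rw [← C.apply_zero hq₀]
  exact C.chart.map_source C.zero_mem_chart_source

/-- The vector field `q ↦ L_t* q / q`, if tangent to `N`, is given in the coordinates of a splitting
chart by a vector of `V₁`. -/
theorem SplittingChart.exists_isParamScore (C : SplittingChart N q₀) (hN : N ⊆ maxExp r)
    (hq₀ : q₀ ∈ N) (htan : ForwardTangentTo f σ N) {t : ℝ} (ht : 0 ≤ t) {z : C.V₁}
    (hz : (z, 0) ∈ C.chart.target) : ∃ w, IsParamScore f σ N (chartSlice C.chart) t z w := by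
  obtain ⟨q, hq, hqz⟩ := C.slice_mem hz
  obtain ⟨V, hV, c, hc0, hcN, hc⟩ := htan t ht q hq
  have hconn : ∀ {p s}, p ∈ N → s ∈ N → ExpConnected p s := fun hp hs =>
    expConnected_of_mem (hN hp) (hN hs)
  have hd : HasDerivAt (fun s => expChart q₀ (c s))
      (BSpace.transport (hconn hq hq₀).2 V) 0 := by
    rw [← hasDerivWithinAt_univ] at hc ⊢
    refine hc.expChart_transport (hconn hq hq₀) ?_ (hc0 ▸ ExpConnected.refl q)
    rw [nhdsWithin_univ]
    exact hcN.mono fun s hs => hconn hq hs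
  -- The curve witnessing tangency at q is read in the chart at `q₀`, where it stays in the image of
  -- N; its velocity therefore has no V₂ component.
  have h0 := fderiv_chart_snd_eq_zero C.contDiffOn_chart hz (fun u hu => (C.mem_chart_iff u hu).1) hd
    (by rw [hc0, hqz]) (hcN.mono fun s hs => ⟨c s, hs, rfl⟩)
  refine ⟨(fderiv ℝ C.chart (chartSlice C.chart z) (BSpace.transport (hconn hq hq₀).2 V)).1,
    q, hq, hqz, V, hV, ?_⟩
  rw [fderiv_chartSlice_apply C.contDiffOn_chart C.contDiffOn_chart_symm hz h0]
  exact BSpace.fn_transport _ V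

/-- In the coordinates of the splitting chart `C` at `q₀`, the vector field `q ↦ L_t* q / q` is,
after the time `a`, locally Lipschitz and continuous in time. -/
def SplittingChart.IsRegularAt (f : ℝ → EuclideanSpace ℝ (Fin n) → EuclideanSpace ℝ (Fin n))
    (σ : ℝ → EuclideanSpace ℝ (Fin n) → Matrix (Fin n) (Fin m) ℝ) (C : SplittingChart N q₀)
    (a : ℝ) : Prop :=
  ∃ b > a, ∃ ρ > 0, ∃ K : ℝ≥0, ∀ ρ' ≤ ρ, ∀ G : ℝ → C.V₁ → C.V₁,
    (∀ t ∈ Icc a b, ∀ z ∈ Metric.closedBall (C.chart 0).1 ρ',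
      IsParamScore f σ N (chartSlice C.chart) t z (G t z)) →
    (∀ t ∈ Icc a b, LipschitzOnWith K (G t) (Metric.closedBall (C.chart 0).1 ρ')) ∧
    ∀ z ∈ Metric.closedBall (C.chart 0).1 ρ', ContinuousOn (fun t => G t z) (Icc a b)

theorem SplittingChart.isRegularAt_of_finiteDimensional (C : SplittingChart N q₀)
    [FiniteDimensional ℝ C.V₁] (hf : IsCk0 1 f)
    (hσ : ∀ i j, IsCk0 2 fun t x => diffusionMatrix σ t x i j)
    (hN : N ⊆ maxExp r) (hq₀ : q₀ ∈ N) {a : ℝ} (ha : 0 ≤ a) : C.IsRegularAt f σ a := by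
  obtain ⟨ρ, hρ, K, hK⟩ := exists_paramScore_regular (N := N) (b := a + 1) hf hσ
    (fun q hq => expConnected_of_mem (hN hq₀) (hN hq))
    (contDiffAt_chartSlice C.contDiffOn_chart_symm (C.zero_mem_target hq₀)) (C.slice_zero hq₀)
    (injective_fderiv_chartSlice C.contDiffOn_chart C.contDiffOn_chart_symm (C.zero_mem_target hq₀))
    ha
  exact ⟨a + 1, lt_add_one a, ρ, hρ, K, hK⟩

theorem SplittingChart.isRegularAt_of_forwardLocallyLipschitzOn (C : SplittingChart N q₀)
    (hq₀ : q₀ ∈ N) (hlip : ForwardLocallyLipschitzOn f σ N) {a : ℝ} (ha : 0 ≤ a) :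
    C.IsRegularAt f σ a := by
  obtain ⟨F, O, ε, L, hO, hε, hF, hFL, hFc⟩ := hlip q₀ hq₀ a ha
  have hI : Icc a (a + ε / 2) ⊆ Ici 0 ∩ Metric.ball a ε := fun t ht =>
    ⟨ha.trans ht.1, by
      rw [Metric.mem_ball, Real.dist_eq, abs_of_nonneg (sub_nonneg.2 ht.1)]
      linarith [ht.2]⟩
  obtain ⟨ρ, hρ, hmem, K, hK, hKc⟩ := exists_lipschitzOnWith_chartSlice C.contDiffOn_chart
    C.contDiffOn_chart_symm (C.zero_mem_target hq₀) isCompact_Icc ((C.slice_zero hq₀).symm ▸ hO)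
    (fun y => C.slice_mem) (fun t ht => hFL t (hI ht)) fun u hu => (hFc u hu).mono hI
  refine ⟨a + ε / 2, by linarith, ρ, hρ, K, fun ρ' hρ' G hG => ?_⟩
  have hsub : Metric.closedBall (C.chart 0).1 ρ' ⊆ Metric.closedBall (C.chart 0).1 ρ :=
    Metric.closedBall_subset_closedBall hρ'
  exact lipschitzOnWith_and_continuousOn_congr hsub hK hKc fun t ht z hz =>
    (hG t ht z hz).eq_apply (A := fun U => (fderiv ℝ C.chart (chartSlice C.chart z) U).1)
      (congrArg Prod.fst (fderiv_apply_fderiv_chartSlice C.contDiffOn_chart C.contDiffOn_chart_symm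
        (hmem z (hsub hz)).2 (G t z)))
      fun q hq hqz V hV => hqz ▸ hF t (hI ht) q hq (hqz ▸ (hmem z (hsub hz)).1) V hV

/-- The flow of densities stays in `N` for a short time after a time at which it is in `N`. -/
theorem IsFokkerPlanckFlow.exists_forall_Icc_mem
    {p : ℝ → EuclideanSpace ℝ (Fin n) → ℝ}
    {P : ℝ → PosDensity (volume : Measure (EuclideanSpace ℝ (Fin n)))}
    (hP : IsFokkerPlanckFlow f σ p P) (hN : N ⊆ maxExp r) {a : ℝ} (ha : 0 ≤ a) (hPa : P a ∈ N)
    (C : SplittingChart N (P a)) (hC : C.IsRegularAt f σ a)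
    (hα : ∀ t, 0 ≤ t → P t ∈ maxExp r →
      ContinuousIntoLPhiAt r (fun s => forwardScore (f s) (diffusionMatrix σ s) (p s)) (Ici 0) t)
    (htan : ForwardTangentTo f σ N) : ∃ T > a, ∀ t ∈ Icc a T, P t ∈ N := by
  have := C.completeSpace
  have hdiff : ∀ t, 0 ≤ t → P t ∈ maxExp r → DifferentiableIntoAt (maxExp r) P (Ici 0) t :=
    fun t ht h => hP.differentiableIntoAt ht h (hα t ht h)
  obtain ⟨b, hab, ρ₁, hρ₁, K, hK⟩ := hC
  obtain ⟨ρ₂, hρ₂, hsub⟩ := Metric.nhds_basis_closedBall.mem_iff.1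
    (eventually_mem_target (C.zero_mem_target hPa))
  have hball : ∀ z ∈ Metric.closedBall (C.chart 0).1 (min ρ₁ ρ₂), (z, 0) ∈ C.chart.target := fun z hz =>
    hsub (Metric.closedBall_subset_closedBall (min_le_right _ _) hz)
  have hex : ∀ t z, ∃ w, t ∈ Icc a b → z ∈ Metric.closedBall (C.chart 0).1 (min ρ₁ ρ₂) →
      IsParamScore f σ N (chartSlice C.chart) t z w := fun t z => by
    by_cases h : t ∈ Icc a b ∧ z ∈ Metric.closedBall (C.chart 0).1 (min ρ₁ ρ₂)
    · obtain ⟨w, hw⟩ := C.exists_isParamScore hN hPa htan (ha.trans h.1.1) (hball z h.2)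
      exact ⟨w, fun _ _ => hw⟩
    · exact ⟨0, fun h1 h2 => absurd ⟨h1, h2⟩ h⟩
  choose G hG using hex
  have hG' : ∀ t ∈ Icc a b, ∀ z ∈ Metric.closedBall (C.chart 0).1 (min ρ₁ ρ₂),
      IsParamScore f σ N (chartSlice C.chart) t z (G t z) := fun t ht z hz => hG t z ht hz
  obtain ⟨hLip, hcont⟩ := hK _ (min_le_left _ _) G hG'
  obtain ⟨T₁, hT₁, c, hca, hc⟩ := exists_curve_of_isParamScore
    (fun q hq => expConnected_of_mem (hN hPa) (hN hq)) (C.slice_zero hPa)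
    (fun z hz => (contDiffAt_chartSlice C.contDiffOn_chart_symm (hball z hz)).differentiableAt two_ne_zero)
    hG' hab (lt_min hρ₁ hρ₂) hLip hcont
  obtain ⟨T, hT, hPT⟩ := exists_forall_Icc_of_eventually hT₁.1
    (((hdiff a ha (hN hPa)).1).filter_mono (nhdsWithin_mono a (Ici_subset_Ici.2 ha)))
  obtain ⟨K', hK', hgrowth⟩ := hP.growth
  refine ⟨T, hT.1, fun t ht => ?_⟩
  have h0 : ∀ s ∈ Icc a t, 0 ≤ s := fun s hs => ha.trans hs.1
  have hsub₁ : Icc a t ⊆ Icc a T₁ := Icc_subset_Icc_right (ht.2.trans hT.2)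
  -- The integral curve and the flow start at the same density and both solve the equation in L¹ on
  -- [a, t]. For the flow this holds because it is still in the exponential manifold up to `T`.
  have hct : c t = P t := by
    refine eq_of_hasL1DerivWithinAt_forwardOp hK'.le ht.1
      (fun s hs => hP.drift_regular.1 s (h0 s hs))
      (fun s hs i j => (hP.diffusion_regular i j).1 s (h0 s hs))
      (fun s hs => hgrowth s (h0 s hs)) (fun s hs => ?_) (fun s hs => ?_) hca
    · obtain ⟨g, hg, hcg, hd⟩ := (hc s (hsub₁ hs)).2
      exact ⟨g, hg, hcg, hd.mono hsub₁⟩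
    · obtain ⟨-, -, -, hd⟩ := hP.hasDerivWithinAt_expChart (h0 s hs)
        (hdiff s (h0 s hs) (hPT s ⟨hs.1, hs.2.trans ht.2⟩))
      exact ⟨p s, hP.density_regular.1 s (h0 s hs), hP.density s (h0 s hs),
        hd.mono fun x hx => h0 x hx⟩
  rw [← hct]
  exact (hc t (hsub₁ (right_mem_Icc.2 ht.1))).1

end Invariance

/-! ### First exit time, and the case of a closed submanifold. -/

section FirstExit

variable {n m : ℕ} {f : ℝ → EuclideanSpace ℝ (Fin n) → EuclideanSpace ℝ (Fin n)}
  {σ : ℝ → EuclideanSpace ℝ (Fin n) → Matrix (Fin n) (Fin m) ℝ}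
  {p : ℝ → EuclideanSpace ℝ (Fin n) → ℝ}
  {P : ℝ → PosDensity (volume : Measure (EuclideanSpace ℝ (Fin n)))}
  {N : Set (PosDensity (volume : Measure (EuclideanSpace ℝ (Fin n))))}
  {r : PosDensity (volume : Measure (EuclideanSpace ℝ (Fin n)))}

/-- A property that persists for a short time holds up to a first exit time. -/
theorem exists_firstExit {φ : ℝ → Prop} (h0 : φ 0)
    (hstep : ∀ a, 0 ≤ a → φ a → ∃ T > a, ∀ t ∈ Icc a T, φ t) :
    ∃ τ : EReal, 0 < τ ∧ (∀ t : ℝ, 0 ≤ t → (t : EReal) < τ → φ t) ∧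
      ∀ T : ℝ, τ = (T : EReal) → ¬φ T := by
  by_cases hall : ∀ t, 0 ≤ t → φ t
  · exact ⟨⊤, EReal.zero_lt_top, fun t ht _ => hall t ht,
      fun T hT => absurd hT.symm (EReal.coe_ne_top T)⟩
  push Not at hall
  set S := {t : ℝ | 0 ≤ t ∧ ¬φ t} with hS
  have hne : S.Nonempty := hall
  have hbdd : BddBelow S := ⟨0, fun t ht => ht.1⟩
  have h0S : 0 ≤ sInf S := le_csInf hne fun t ht => ht.1
  have hlt : ∀ t, 0 ≤ t → t < sInf S → φ t := fun t ht h => by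
    by_contra hcon
    exact notMem_of_lt_csInf h hbdd ⟨ht, hcon⟩
  -- If the property held at the infimum of the exit times, it would persist beyond it and push the
  -- infimum up.
  have hexit : ¬φ (sInf S) := fun hcon => by
    obtain ⟨T, hT, hφ⟩ := hstep _ h0S hcon
    have h1 : T ≤ sInf S := le_csInf hne fun t ht => by
      by_contra hlt
      exact ht.2 (hφ t ⟨csInf_le hbdd ht, (not_le.1 hlt).le⟩)
    linarith
  have hpos : 0 < sInf S := h0S.lt_of_ne fun h => hexit (h ▸ h0)
  refine ⟨(sInf S : ℝ), by exact_mod_cast hpos, fun t ht h => hlt t ht (by exact_mod_cast h),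
    fun T hT => ?_⟩
  rwa [← EReal.coe_injective hT]

/-- Differentiability at T implies continuity in the chart at `P T`, so 0 is a limit of chart images
of points of N coming from earlier times. -/
theorem IsFokkerPlanckFlow.mem_of_isClosedIn (hP : IsFokkerPlanckFlow f σ p P) {T : ℝ} (hT : 0 < T)
    (hdiff : DifferentiableIntoAt (maxExp r) P (Ici 0) T) (hclosed : IsClosedIn (maxExp r) N)
    (hmem : ∀ t, 0 ≤ t → t < T → P t ∈ N) : P T ∈ N := by
  obtain ⟨V, -, hV, -⟩ := hP.hasDerivWithinAt_expChart hT.le hdiff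
  refine hclosed (P T) (hdiff.1.self_of_nhdsWithin hT.le) ?_
  have hlim : Tendsto (fun s => expChart (P T) (P s)) (𝓝[Ico 0 T] T) (𝓝 0) := by
    have h := hV.continuousWithinAt.mono (Ico_subset_Icc_self.trans Icc_subset_Ici_self : Ico 0 T ⊆ _)
    rwa [ContinuousWithinAt, expChart_self] at h
  have : (𝓝[Ico 0 T] T).NeBot := by
    rw [nhdsWithin_Ico_eq_nhdsLT hT]
    infer_instance
  exact mem_closure_of_tendsto hlim (eventually_nhdsWithin_of_forall fun s hs =>
    ⟨P s, hmem s hs.1 hs.2, rfl⟩)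

end FirstExit

theorem mainTheorem8 {n m : ℕ}
    (f : ℝ → EuclideanSpace ℝ (Fin n) → EuclideanSpace ℝ (Fin n))
    (σ : ℝ → EuclideanSpace ℝ (Fin n) → Matrix (Fin n) (Fin m) ℝ)
    (p : ℝ → EuclideanSpace ℝ (Fin n) → ℝ)
    (P : ℝ → PosDensity (volume : Measure (EuclideanSpace ℝ (Fin n))))
    (hP : IsFokkerPlanckFlow f σ p P)
    (r : PosDensity (volume : Measure (EuclideanSpace ℝ (Fin n)))) :
    (∀ t, 0 ≤ t → DifferentiableIntoAt (maxExp r) P (Ici 0) t →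
      ∃ V : BSpace (P t),
        BSpace.fn V =ᵐ[volume] forwardScore (f t) (diffusionMatrix σ t) (p t) ∧
        HasDerivWithinAt (fun s => expChart (P t) (P s)) V (Ici 0) t) ∧
    (∀ t₀, 0 ≤ t₀ → P t₀ ∈ maxExp r →
      ContinuousIntoLPhiAt r (fun t => forwardScore (f t) (diffusionMatrix σ t) (p t))
        (Ici 0) t₀ →
      DifferentiableIntoAt (maxExp r) P (Ici 0) t₀) ∧
    (∀ N : Set (PosDensity (volume : Measure (EuclideanSpace ℝ (Fin n)))),
      (IsFiniteDimSubmanifold (maxExp r) N ∨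
        (IsSubmanifold (maxExp r) N ∧ ForwardLocallyLipschitzOn f σ N)) →
      P 0 ∈ N →
      (∀ t, 0 ≤ t → P t ∈ maxExp r →
        ContinuousIntoLPhiAt r (fun s => forwardScore (f s) (diffusionMatrix σ s) (p s))
          (Ici 0) t) →
      ForwardTangentTo f σ N →
      ∃ τ : EReal, 0 < τ ∧ (∀ t : ℝ, 0 ≤ t → (t : EReal) < τ → P t ∈ N) ∧
        ∀ T : ℝ, τ = (T : EReal) →
          P T ∉ N ∧ (IsClosedIn (maxExp r) N → P T ∉ maxExp r)) := by
  refine ⟨fun t ht h => ?_, fun t₀ ht₀ hr hα => hP.differentiableIntoAt ht₀ hr hα,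
    fun N hsub h0 hα htan => ?_⟩
  · obtain ⟨V, hV, hd, -⟩ := hP.hasDerivWithinAt_expChart ht h
    exact ⟨V, hV, hd⟩
  have hN : N ⊆ maxExp r := hsub.elim (fun h => h.1) fun h => h.1.1
  -- The finite dimensional and the Lipschitz case differ only in the source of the regularity of
  -- the field in the splitting chart.
  obtain ⟨τ, hτ, hmem, hexit⟩ := exists_firstExit (φ := fun t => P t ∈ N) h0 fun a ha hPa => by
    rcases hsub with h | h
    · obtain ⟨C, hC⟩ := h.2 _ hPa
      exact hP.exists_forall_Icc_mem hN ha hPa C (C.isRegularAt_of_finiteDimensional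
        hP.drift_regular hP.diffusion_regular hN hPa ha) hα htan
    · obtain ⟨C⟩ := h.1.2 _ hPa
      exact hP.exists_forall_Icc_mem hN ha hPa C
        (C.isRegularAt_of_forwardLocallyLipschitzOn hPa h.2 ha) hα htan
  refine ⟨τ, hτ, hmem, fun T hT => ⟨hexit T hT, fun hclosed hTr => hexit T hT ?_⟩⟩
  have hT0 : 0 < T := by
    rw [hT] at hτ
    exact_mod_cast hτ
  exact hP.mem_of_isClosedIn hT0 (hP.differentiableIntoAt hT0.le hTr (hα T hT0.le hTr)) hclosed
    fun t ht htT => hmem t ht (by rw [hT]; exact_mod_cast htT)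

end
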